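/- All graphs are finite and simple. For a graph $G$ with degree diagonal matrix $D(G)$ and adjacency matrix $A(G)$, and for $\alpha\in[0,1)$, let $A_\alpha(G)=\alpha D(G)+(1-\alpha)A(G)$; the $A_\alpha$-spectral radius $\rho_\alpha(G)$ of $G$ is the largest eigenvalue of $A_\alpha(G)$. Let $\mathcal H_{n,m}$ be the set of connected graphs with $n$ vertices and $m$ edges. For $n-1\le m\le n(n-1)/2$ let $k$ be the largest integer with $1\le k\le n-1$ and $\sum_{i=1}^{k}(n-i)\le m$, put $a=m-\sum_{i=1}^{k}(n-i)$, and define the quasi-star graph $$S_{n,m}=K_k\vee\bigl(K_{1,a}\cup(n-a-k-1)K_1\bigr),$$ where $\cup$ is the disjoint union, $\vee$ is the join (disjoint union plus all edges between the two graphs), $tK_1$ consists of $t$ isolated vertices, and $K_{1,0}=K_1$. If $a=3$, that is, $m=kn-\frac{k(k+1)}2+3$, let $$\tilde S_{n,m}=K_k\vee\bigl(K_3\cup(n-k-3)K_1\bigr).$$ **Theorem.** Let $r,n,m$ be positive integers with $r\ge 3$, $$n>\frac{30r-63+5\sqrt{32r^2-136r+137}}{2}\qquad\text{and}\qquad n-1\le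 m\le rn-\frac{r(r+1)}2.$$ (1) If $\alpha\in(\frac12,1)$, or if $\alpha=\frac12$ and $m\ne kn-\frac{k(k+1)}2+3$ for every integer $k$ with $1\le k\le r-1$, then, up to isomorphism, $S_{n,m}$ is the unique graph that maximizes $\rho_\alpha$ over $\mathcal H_{n,m}$. (2) If $\alpha=\frac12$ and $m=kn-\frac{k(k+1)}2+3$ for some integer $k$ with $1\le k\le r-1$, then, up to isomorphism, the graphs that maximize $\rho_{1/2}$ over $\mathcal H_{n,m}$ are exactly the two non-isomorphic graphs $S_{n,m}$ and $\tilde S_{n,m}$. -/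

import Mathlib

open scoped Classical in
/-- The matrix `A_α(G) = α D(G) + (1 - α) A(G)`, where `D(G)` is the diagonal matrix of degrees and
`A(G)` the adjacency matrix. -/
noncomputable def alphaMatrix {V : Type*} [Fintype V] (α : ℝ) (G : SimpleGraph V) :
    Matrix V V ℝ :=
  α • G.degMatrix ℝ + (1 - α) • G.adjMatrix ℝ

open scoped Classical in
/-- The `A_α`-spectral radius `ρ_α(G)`: the largest eigenvalue of the real symmetric matrix
`A_α(G)` (for a nonempty vertex set the spectrum is finite and nonempty, so that the supremum is
attained). -/
noncomputable def alphaRadius {V : Type*} [Fintype V] (α : ℝ) (G : SimpleGraph V) : ℝ :=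
  sSup (spectrum ℝ (alphaMatrix α G))

/-- The set `H_{n,m}` of all connected simple graphs on the `n` vertices `Fin n` with exactly
`m` edges. -/
def connectedGraphs (n m : ℕ) : Set (SimpleGraph (Fin n)) :=
  {G | G.Connected ∧ G.edgeSet.ncard = m}

/-- `G` maximizes the `A_α`-spectral radius in `H_{n,m}`. -/
def IsExtremal (α : ℝ) (n m : ℕ) (G : SimpleGraph (Fin n)) : Prop :=
  G ∈ connectedGraphs n m ∧ ∀ G' ∈ connectedGraphs n m, alphaRadius α G' ≤ alphaRadius α G

/-- The join `G ∨ H`: the disjoint union of `G` and `H` together with all edges between them. -/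
def graphJoin {V W : Type*} (G : SimpleGraph V) (H : SimpleGraph W) : SimpleGraph (V ⊕ W) :=
  SimpleGraph.sum G H ⊔ completeBipartiteGraph V W

/-- The largest integer `k` (with `k ≤ n - 1`) such that `∑_{i=1}^k (n - i) ≤ m`. -/
def starK (n m : ℕ) : ℕ :=
  Nat.findGreatest (fun k => ∑ i ∈ Finset.Icc 1 k, (n - i) ≤ m) (n - 1)

/-- `a = m - ∑_{i=1}^k (n - i)`, where `k = starK n m`. -/
def starA (n m : ℕ) : ℕ :=
  m - ∑ i ∈ Finset.Icc 1 (starK n m), (n - i)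

/-- The quasi-star graph `S_{n,m} = K_k ∨ (K_{1,a} ∪ (n - a - k - 1) K_1)`. -/
def quasiStar (n m : ℕ) :
    SimpleGraph (Fin (starK n m) ⊕
      ((Fin 1 ⊕ Fin (starA n m)) ⊕ Fin (n - starA n m - starK n m - 1))) :=
  graphJoin (⊤ : SimpleGraph (Fin (starK n m)))
    (SimpleGraph.sum (completeBipartiteGraph (Fin 1) (Fin (starA n m)))
      (⊥ : SimpleGraph (Fin (n - starA n m - starK n m - 1))))

/-- The graph `S̃_{n,m} = K_k ∨ (K_3 ∪ (n - k - 3) K_1)`, used when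
`m = k n - k (k + 1) / 2 + 3`, that is, when `a = 3`. -/
def quasiStarTilde (n m : ℕ) :
    SimpleGraph (Fin (starK n m) ⊕ (Fin 3 ⊕ Fin (n - starK n m - 3))) :=
  graphJoin (⊤ : SimpleGraph (Fin (starK n m)))
    (SimpleGraph.sum (⊤ : SimpleGraph (Fin 3)) (⊥ : SimpleGraph (Fin (n - starK n m - 3))))

/-- `m` is one of the exceptional sizes `k n - k (k + 1) / 2 + 3`, `1 ≤ k ≤ r - 1`
(there is no truncation: the equation is one of real numbers). -/
def IsExceptionalSize (r n m : ℕ) : Prop :=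
  ∃ k : ℕ, 1 ≤ k ∧ k + 1 ≤ r ∧ (m : ℝ) = k * n - k * (k + 1) / 2 + 3

/-! Let `G` be extremal with positive Perron vector `x`. Replacing an edge `yu` by `yv` with `x u ≤
x v` strictly raises the radius (`alphaRadius_lt_moveEdge`). Hence a heaviest vertex is adjacent to
all others, and neighbourhoods are nested along `x` (`IsRadiusMaximal.nested`).

The first main point is that the `k` heaviest vertices `K` are all dominating
(`IsRadiusMaximal.exists_dominating_finset`). If not, let `z` be heaviest outside `K` and `W` the
set of remaining vertices. Compare `G` with `H = starJoin K z L`, where `L ⊆ W` has `a` elements, so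
that the edge numbers agree. Symmetry of `A_α` gives an exact formula for `(ρ(H) - ρ(G)) ⟨x, X⟩`,
with `X` the Perron vector of `H`, as a sum over the pairs on which `G` and `H` differ
(`perronPair_inner`). The vector `X` is explicit: it is `1` on `K`, `ζ` at `z`, constant on `L` and
constant on the rest, and the last two values are at most `3/20`. A gained `K`-`W` edge therefore
outweighs a lost edge inside `W`. The delicate terms are the edges at `z`, since `ζ` may be close to
`1`. If `z` has at least `a` neighbours in `W`, take `L` among them
(`IsTopPart.lt_starJoin_of_subset`); otherwise take `L` around them
(`IsTopPart.lt_starJoin_of_superset`). Either way `ρ(G) < ρ(H)`, a contradiction.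

The second main point (`star_optimal`) concerns the `a` edges outside `K`. The largest sum and the
largest difference of Perron entries along these edges satisfy two linear inequalities that become
equations for a star, because the end degrees of an edge sum to at most `a + 1`. Comparing total
weights gives optimality of the star, and equality forces the edges to meet pairwise, so they form a
star or a triangle. A triangle would have constant entries, which is impossible for `α > 1/2`. For
`α = 1/2` it ties with the star `K_{1,3}`: the two have the same line graph
(`alphaRadius_cliqueJoin_triangle`).

The hypothesis on `n` enters only through `23 r + 3 ≤ 3 n`. -/

/-! ### Rayleigh quotients and Perron vectors of `A_α`. -/

section Spectral

open scoped Classical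
open Finset

variable {V W : Type*} [Fintype V] [Fintype W]

/-- The matrix `A_α(G)` acting on a vector, written as a sum over neighbours. -/
noncomputable def alphaOp (α : ℝ) (G : SimpleGraph V) (x : V → ℝ) (v : V) : ℝ :=
  ∑ w, if G.Adj v w then α * x v + (1 - α) * x w else 0

/-- `x` is an entrywise positive eigenvector of `A_α(G)` with eigenvalue `ρ`. -/
def IsPerronPair (α : ℝ) (G : SimpleGraph V) (ρ : ℝ) (x : V → ℝ) : Prop :=
  (∀ v, 0 < x v) ∧ ∀ v, alphaOp α G x v = ρ * x v

theorem alphaMatrix_mulVec (α : ℝ) (G : SimpleGraph V) (x : V → ℝ) :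
    Matrix.mulVec (alphaMatrix α G) x = alphaOp α G x := by
  funext v
  have hdeg : (G.degree v : ℝ) = ∑ w, if G.Adj v w then (1 : ℝ) else 0 := by
    rw [Finset.sum_boole, ← SimpleGraph.card_neighborFinset_eq_degree,
      SimpleGraph.neighborFinset_eq_filter]
  simp only [alphaMatrix, Matrix.add_mulVec, Matrix.smul_mulVec, Pi.add_apply, Pi.smul_apply,
    smul_eq_mul, SimpleGraph.degMatrix, Matrix.mulVec_diagonal, alphaOp]
  rw [hdeg, SimpleGraph.adjMatrix_mulVec_apply, SimpleGraph.neighborFinset_eq_filter,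
    Finset.sum_filter, Finset.sum_mul, Finset.mul_sum, Finset.mul_sum, ← Finset.sum_add_distrib]
  refine Finset.sum_congr rfl fun w _ => ?_
  split_ifs <;> ring

theorem alphaMatrix_isHermitian (α : ℝ) (G : SimpleGraph V) : (alphaMatrix α G).IsHermitian := by
  unfold alphaMatrix
  refine Matrix.IsHermitian.add ?_ ?_
  · simp [Matrix.IsHermitian, SimpleGraph.degMatrix]
  · simp [Matrix.IsHermitian]

theorem spectrum_alphaMatrix_finite (α : ℝ) (G : SimpleGraph V) :
    (spectrum ℝ (alphaMatrix α G)).Finite := by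
  rw [(alphaMatrix_isHermitian α G).spectrum_real_eq_range_eigenvalues]
  exact Set.finite_range _

theorem alphaRadius_mem_spectrum [Nonempty V] (α : ℝ) (G : SimpleGraph V) :
    alphaRadius α G ∈ spectrum ℝ (alphaMatrix α G) := by
  refine Set.Nonempty.csSup_mem ?_ (spectrum_alphaMatrix_finite α G)
  rw [(alphaMatrix_isHermitian α G).spectrum_real_eq_range_eigenvalues]
  exact Set.range_nonempty _

/-- Positive semidefiniteness yields the Rayleigh bound and its equality case together: a vector
annihilated by the quadratic form lies in the kernel. -/
theorem posSemidef_alphaRadius_sub (α : ℝ) (G : SimpleGraph V) :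
    (algebraMap ℝ (Matrix V V ℝ) (alphaRadius α G) - alphaMatrix α G).PosSemidef := by
  rw [Matrix.posSemidef_iff_isHermitian_and_spectrum_nonneg]
  refine ⟨Matrix.IsHermitian.sub ?_ (alphaMatrix_isHermitian α G), ?_⟩
  · simp [Matrix.IsHermitian, Matrix.algebraMap_eq_diagonal]
  · rw [← spectrum.singleton_sub_eq]
    rintro _ ⟨a, ha, b, hb, rfl⟩
    rw [Set.mem_singleton_iff] at ha
    subst ha
    exact sub_nonneg.2 (le_csSup (spectrum_alphaMatrix_finite α G).bddAbove hb)

theorem alphaRadius_quadratic (α : ℝ) (G : SimpleGraph V) (y : V → ℝ) :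
    dotProduct (star y) (Matrix.mulVec
      (algebraMap ℝ (Matrix V V ℝ) (alphaRadius α G) - alphaMatrix α G) y) =
      alphaRadius α G * ∑ v, y v ^ 2 - ∑ v, y v * alphaOp α G y v := by
  rw [Matrix.sub_mulVec, alphaMatrix_mulVec, dotProduct_sub, Algebra.algebraMap_eq_smul_one,
    Matrix.smul_mulVec, Matrix.one_mulVec]
  simp only [dotProduct, star_trivial, Pi.smul_apply, smul_eq_mul, Finset.mul_sum]
  congr 1
  exact Finset.sum_congr rfl fun v _ => by ring

theorem rayleigh_le (α : ℝ) (G : SimpleGraph V) (y : V → ℝ) :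
    ∑ v, y v * alphaOp α G y v ≤ alphaRadius α G * ∑ v, y v ^ 2 := by
  have := (posSemidef_alphaRadius_sub α G).dotProduct_mulVec_nonneg y
  rw [alphaRadius_quadratic] at this
  linarith

theorem alphaOp_eq_of_rayleigh_eq (α : ℝ) (G : SimpleGraph V) (y : V → ℝ)
    (h : alphaRadius α G * ∑ v, y v ^ 2 ≤ ∑ v, y v * alphaOp α G y v) (v : V) :
    alphaOp α G y v = alphaRadius α G * y v := by
  have h0 := ((posSemidef_alphaRadius_sub α G).dotProduct_mulVec_zero_iff y).1 (by
    rw [alphaRadius_quadratic]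
    linarith [rayleigh_le α G y])
  rw [Matrix.sub_mulVec, alphaMatrix_mulVec, Algebra.algebraMap_eq_smul_one,
    Matrix.smul_mulVec, Matrix.one_mulVec] at h0
  have := congrFun h0 v
  simp only [Pi.sub_apply, Pi.smul_apply, smul_eq_mul, Pi.zero_apply] at this
  linarith

theorem sum_mul_alphaOp (α : ℝ) (G : SimpleGraph V) (x y : V → ℝ) :
    ∑ v, x v * alphaOp α G y v =
      ∑ v, ∑ w, if G.Adj v w then x v * (α * y v + (1 - α) * y w) else 0 := by
  simp only [alphaOp, Finset.mul_sum]
  refine Finset.sum_congr rfl fun v _ => Finset.sum_congr rfl fun w _ => ?_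
  split_ifs <;> ring

theorem sum_mul_alphaOp_comm (α : ℝ) (G : SimpleGraph V) (x y : V → ℝ) :
    ∑ v, x v * alphaOp α G y v = ∑ v, y v * alphaOp α G x v := by
  have key : ∀ x y : V → ℝ, ∑ v, x v * alphaOp α G y v =
      α * (∑ v, ∑ w, if G.Adj v w then x v * y v else 0) +
        (1 - α) * ∑ v, ∑ w, if G.Adj v w then x v * y w else 0 := by
    intro x y
    rw [sum_mul_alphaOp]
    simp only [Finset.mul_sum, ← Finset.sum_add_distrib]
    refine Finset.sum_congr rfl fun v _ => Finset.sum_congr rfl fun w _ => ?_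
    split_ifs <;> ring
  rw [key, key]
  congr 2
  · refine Finset.sum_congr rfl fun v _ => Finset.sum_congr rfl fun w _ => ?_
    rw [mul_comm]
  · rw [Finset.sum_comm]
    refine Finset.sum_congr rfl fun v _ => Finset.sum_congr rfl fun w _ => ?_
    rw [G.adj_comm, mul_comm]

/-- Perron–Frobenius for the matrix `A_α` of a connected graph. -/
theorem exists_perronPair {α : ℝ} (hα₁ : α < 1) {G : SimpleGraph V}
    (hG : G.Connected) : ∃ x, IsPerronPair α G (alphaRadius α G) x := by
  have := hG.nonempty
  obtain ⟨y, hy0, hy⟩ : ∃ y : V → ℝ, y ≠ 0 ∧ ∀ v, alphaOp α G y v = alphaRadius α G * y v := by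
    have h := alphaRadius_mem_spectrum α G
    rw [← Matrix.spectrum_toLin', ← Module.End.hasEigenvalue_iff_mem_spectrum] at h
    obtain ⟨y, hy⟩ := h.exists_hasEigenvector
    refine ⟨y, hy.2, fun v => ?_⟩
    have := congrFun hy.apply_eq_smul v
    rwa [Matrix.toLin'_apply, alphaMatrix_mulVec] at this
  have habs : ∀ v, alphaOp α G (fun v => |y v|) v = alphaRadius α G * |y v| := by
    -- Passing to absolute values does not lower the quadratic form, so `|y|` also attains the
    -- maximum. Its zeros then spread along edges, and connectedness excludes them.
    refine alphaOp_eq_of_rayleigh_eq α G _ ?_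
    have h1 : alphaRadius α G * ∑ v, |y v| ^ 2 = ∑ v, y v * alphaOp α G y v := by
      simp only [hy, sq_abs, Finset.mul_sum]
      exact Finset.sum_congr rfl fun v _ => by ring
    rw [h1, sum_mul_alphaOp, sum_mul_alphaOp]
    refine Finset.sum_le_sum fun v _ => Finset.sum_le_sum fun w _ => ?_
    split_ifs
    · have h2 : y v * y w ≤ |y v| * |y w| := by rw [← abs_mul]; exact le_abs_self _
      have h3 : y v * y v = |y v| * |y v| := (abs_mul_abs_self _).symm
      nlinarith
    · exact le_rfl
  have hstep : ∀ v, y v = 0 → ∀ w, G.Adj v w → y w = 0 := by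
    intro v hv w hvw
    have h1 := habs v
    simp only [alphaOp, hv, abs_zero, mul_zero, zero_add] at h1
    have h2 := (Finset.sum_eq_zero_iff_of_nonneg (fun w _ => by
      split_ifs
      · exact mul_nonneg (by linarith) (abs_nonneg _)
      · exact le_rfl)).1 h1 w (mem_univ w)
    rw [if_pos hvw] at h2
    rcases mul_eq_zero.1 h2 with h | h
    · linarith
    · exact abs_eq_zero.1 h
  refine ⟨fun v => |y v|, fun v => abs_pos.2 fun hv => hy0 ?_, habs⟩
  funext w
  obtain ⟨p⟩ := hG.preconnected v w
  induction p with
  | nil => exact hv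
  | cons h _ ih => exact ih (hstep _ hv _ h)

/-- Both sides are `xᵀ A_α(H) z - xᵀ A_α(G) z`, by symmetry of the matrices. Mixing the two Perron
vectors makes the comparison an identity in which the vector of `H` can be explicit while that of
`G` is known only through its ordering. -/
theorem perronPair_inner {α : ℝ} {G H : SimpleGraph V} {ρ μ : ℝ} {x z : V → ℝ}
    (hx : IsPerronPair α G ρ x) (hz : IsPerronPair α H μ z) :
    (μ - ρ) * ∑ v, x v * z v =
      ∑ v, ∑ w, ((if H.Adj v w then 1 else 0) - (if G.Adj v w then 1 else 0)) *
        (x v * (α * z v + (1 - α) * z w)) := by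
  have h1 : ∑ v, x v * alphaOp α H z v = μ * ∑ v, x v * z v := by
    simp only [hz.2, Finset.mul_sum]
    exact Finset.sum_congr rfl fun v _ => by ring
  have h2 : ∑ v, x v * alphaOp α G z v = ρ * ∑ v, x v * z v := by
    rw [sum_mul_alphaOp_comm]
    simp only [hx.2, Finset.mul_sum]
    exact Finset.sum_congr rfl fun v _ => by ring
  rw [sub_mul, ← h1, ← h2, sum_mul_alphaOp, sum_mul_alphaOp, ← Finset.sum_sub_distrib]
  refine Finset.sum_congr rfl fun v _ => ?_
  rw [← Finset.sum_sub_distrib]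
  refine Finset.sum_congr rfl fun w _ => ?_
  split_ifs <;> ring

theorem IsPerronPair.eq_alphaRadius {α : ℝ} (hα₁ : α < 1) {G : SimpleGraph V} (hG : G.Connected)
    {ρ : ℝ} {x : V → ℝ} (hx : IsPerronPair α G ρ x) : ρ = alphaRadius α G := by
  have := hG.nonempty
  obtain ⟨z, hz⟩ := exists_perronPair hα₁ hG
  have h := perronPair_inner hx hz
  simp only [sub_self, zero_mul, Finset.sum_const_zero] at h
  have hpos : 0 < ∑ v, x v * z v :=
    Finset.sum_pos (fun v _ => mul_pos (hx.1 v) (hz.1 v)) univ_nonempty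
  rcases mul_eq_zero.1 h with h | h
  · linarith
  · linarith

theorem alphaRadius_congr (α : ℝ) {G : SimpleGraph V} {H : SimpleGraph W} (e : G ≃g H) :
    alphaRadius α G = alphaRadius α H := by
  have hmat : Matrix.reindexAlgEquiv ℝ ℝ e.toEquiv (alphaMatrix α G) = alphaMatrix α H := by
    rw [Matrix.ext_iff_mulVec]
    intro x
    have h1 : (Matrix.reindexAlgEquiv ℝ ℝ e.toEquiv (alphaMatrix α G)) =
      (alphaMatrix α G).submatrix e.symm e.symm := rfl
    rw [h1]
    funext v
    have h2 : Matrix.mulVec ((alphaMatrix α G).submatrix e.symm e.symm) x v =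
        Matrix.mulVec (alphaMatrix α G) (fun w => x (e w)) (e.symm v) := by
      simp only [Matrix.mulVec, dotProduct, Matrix.submatrix_apply]
      rw [← Equiv.sum_comp e.toEquiv]
      simp
    rw [h2, alphaMatrix_mulVec, alphaMatrix_mulVec]
    simp only [alphaOp]
    rw [← Equiv.sum_comp e.toEquiv]
    refine Finset.sum_congr rfl fun w _ => ?_
    have h3 : G.Adj (e.symm v) w ↔ H.Adj v (e w) := by
      rw [← e.map_adj_iff, RelIso.apply_symm_apply]
    simp [h3]
  unfold alphaRadius
  rw [← hmat, AlgEquiv.spectrum_eq]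

end Spectral

/-! ### Edge rotations, dominating vertices and nested neighbourhoods. -/

section Rotation

open scoped Classical
open Finset

variable {V : Type*}

theorem sum_adj_eq_two_mul_ncard [Fintype V] (G : SimpleGraph V) :
    ∑ v, ∑ w, (if G.Adj v w then (1 : ℝ) else 0) = 2 * G.edgeSet.ncard := by
  have h := G.sum_degrees_eq_twice_card_edges
  have h2 : G.edgeSet.ncard = #G.edgeFinset := by
    rw [← SimpleGraph.coe_edgeFinset, Set.ncard_coe_finset]
  rw [h2]
  have h3 : ((∑ v, G.degree v : ℕ) : ℝ) = 2 * (#G.edgeFinset : ℝ) := by exact_mod_cast h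
  rw [← h3, Nat.cast_sum]
  refine Finset.sum_congr rfl fun v _ => ?_
  rw [Finset.sum_boole, ← SimpleGraph.card_neighborFinset_eq_degree,
    SimpleGraph.neighborFinset_eq_filter]

theorem connected_of_dominating {G : SimpleGraph V} {o : V} (h : ∀ w, w ≠ o → G.Adj o w) :
    G.Connected := by
  have : Nonempty V := ⟨o⟩
  refine ⟨fun a b => ?_⟩
  have key : ∀ w, G.Reachable o w := fun w => by
    by_cases hw : w = o
    · rw [hw]
    · exact (h w hw).reachable
  exact (key a).symm.trans (key b)

/-- The graph obtained from `G` by replacing the edge `yu` with `yv`. -/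
def moveEdge (G : SimpleGraph V) (y u v : V) : SimpleGraph V :=
  (G \ SimpleGraph.edge y u) ⊔ SimpleGraph.edge y v

theorem moveEdge_adj {G : SimpleGraph V} {y u v a b : V} (hv : y ≠ v) :
    (moveEdge G y u v).Adj a b ↔
      (G.Adj a b ∧ ¬ ((a = y ∧ b = u) ∨ (a = u ∧ b = y))) ∨
        ((a = y ∧ b = v) ∨ (a = v ∧ b = y)) := by
  simp only [moveEdge, SimpleGraph.sup_adj, SimpleGraph.sdiff_adj, SimpleGraph.edge_adj]
  constructor
  · rintro (⟨h1, h2⟩ | ⟨h, -⟩)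
    · refine Or.inl ⟨h1, fun h => h2 ⟨?_, h1.ne⟩⟩
      tauto
    · right; tauto
  · rintro (⟨h1, h2⟩ | h)
    · refine Or.inl ⟨h1, fun h => h2 ?_⟩
      tauto
    · refine Or.inr ⟨by tauto, ?_⟩
      rintro rfl
      rcases h with ⟨h, h'⟩ | ⟨h, h'⟩
      · exact hv (h.symm.trans h')
      · exact hv (h'.symm.trans h)

theorem moveEdge_indicator {G : SimpleGraph V} {y u v : V} (hyu : G.Adj y u) (hyv : ¬ G.Adj y v)
    (hv : y ≠ v) (a b : V) (t : ℝ) :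
    (if (moveEdge G y u v).Adj a b then t else 0) = (if G.Adj a b then t else 0) +
      (if a = y then (if b = v then t else 0) else 0) +
      (if a = v then (if b = y then t else 0) else 0) -
      (if a = y then (if b = u then t else 0) else 0) -
      (if a = u then (if b = y then t else 0) else 0) := by
  have huv : u ≠ v := by rintro rfl; exact hyv hyu
  have hyu' := hyu.ne
  rw [moveEdge_adj hv]
  by_cases h1 : a = y
  · subst h1
    by_cases h2 : b = v
    · subst h2; simp [hyv, hv, huv.symm, hyu']
    · by_cases h3 : b = u
      · subst h3; simp [hyu, hv, hyu', h2]
      · simp [h2, h3, hv, hyu']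
  · by_cases h2 : b = y
    · subst h2
      by_cases h3 : a = v
      · subst h3; simp [h1, G.adj_comm a b, hyv, huv.symm]
      · by_cases h4 : a = u
        · subst h4; simp [hyu.symm, h1, h3]
        · simp [h1, h3, h4]
    · simp [h1, h2]

variable [Fintype V]

theorem sum_moveEdge {G : SimpleGraph V} {y u v : V} (hyu : G.Adj y u) (hyv : ¬ G.Adj y v)
    (hv : y ≠ v) (f : V → V → ℝ) :
    ∑ a, ∑ b, (if (moveEdge G y u v).Adj a b then f a b else 0) =
      ∑ a, ∑ b, (if G.Adj a b then f a b else 0) + f y v + f v y - f y u - f u y := by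
  simp only [moveEdge_indicator hyu hyv hv, Finset.sum_add_distrib, Finset.sum_sub_distrib]
  simp [Finset.sum_ite_irrel]

theorem ncard_edgeSet_moveEdge {G : SimpleGraph V} {y u v : V} (hyu : G.Adj y u)
    (hyv : ¬ G.Adj y v) (hv : y ≠ v) : (moveEdge G y u v).edgeSet.ncard = G.edgeSet.ncard := by
  have h := sum_moveEdge hyu hyv hv (fun _ _ => (1 : ℝ))
  rw [sum_adj_eq_two_mul_ncard, sum_adj_eq_two_mul_ncard] at h
  have : ((moveEdge G y u v).edgeSet.ncard : ℝ) = G.edgeSet.ncard := by linarith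
  exact_mod_cast this

/-- Moving an edge towards an endpoint of larger Perron weight increases the spectral radius. -/
theorem alphaRadius_lt_moveEdge {α : ℝ} (hα₀ : 0 < α) (hα₁ : α < 1) {G : SimpleGraph V} {x : V → ℝ}
    (hx : IsPerronPair α G (alphaRadius α G) x) {y u v : V} (hyu : G.Adj y u)
    (hyv : ¬ G.Adj y v) (hv : y ≠ v) (huv : x u ≤ x v) :
    alphaRadius α G < alphaRadius α (moveEdge G y u v) := by
  have hsum := sum_moveEdge hyu hyv hv (fun a b => x a * (α * x a + (1 - α) * x b))
  rw [← sum_mul_alphaOp, ← sum_mul_alphaOp] at hsum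
  have hG : ∑ v, x v * alphaOp α G x v = alphaRadius α G * ∑ v, x v ^ 2 := by
    simp only [hx.2, Finset.mul_sum]
    exact Finset.sum_congr rfl fun v _ => by ring
  -- The quadratic form changes by `α (x v ^ 2 - x u ^ 2) + 2 (1 - α) x y (x v - x u)`.
  have hge : ∑ a, x a * alphaOp α G x a ≤ ∑ a, x a * alphaOp α (moveEdge G y u v) x a := by
    have h1 := hx.1 u
    have h2 := hx.1 y
    have h3 : 0 ≤ (1 - α) * x y * (x v - x u) :=
      mul_nonneg (mul_nonneg (by linarith) h2.le) (by linarith)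
    have h4 : 0 ≤ α * ((x v - x u) * (x v + x u)) :=
      mul_nonneg hα₀.le (mul_nonneg (by linarith) (by linarith))
    nlinarith
  have hpos : 0 < ∑ v, x v ^ 2 := Finset.sum_pos (fun v _ => pow_pos (hx.1 v) 2) ⟨y, mem_univ y⟩
  have hle := rayleigh_le α (moveEdge G y u v) x
  by_contra hcon
  have hrad : alphaRadius α G = alphaRadius α (moveEdge G y u v) := by
    refine le_antisymm ?_ (not_lt.1 hcon)
    by_contra h
    have := mul_lt_mul_of_pos_right (not_le.1 h) hpos
    linarith
  -- If the radius did not grow, `x` would be an eigenvector of the new graph as well; but the row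
  -- of `v` has gained the positive term `α x v + (1 - α) x y`.
  have h5 := alphaOp_eq_of_rayleigh_eq α (moveEdge G y u v) x (by rw [← hrad]; linarith) v
  have h6 : alphaOp α (moveEdge G y u v) x v = alphaOp α G x v + (α * x v + (1 - α) * x y) := by
    have huv : v ≠ u := by rintro rfl; exact hyv hyu
    simp only [alphaOp, moveEdge_indicator hyu hyv hv, Finset.sum_add_distrib,
      Finset.sum_sub_distrib]
    simp [hv.symm, huv]
  rw [h6, ← hrad, hx.2 v] at h5
  have := mul_pos hα₀ (hx.1 v)
  have := mul_pos (sub_pos.2 hα₁) (hx.1 y)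
  linarith

/-- `G` has the largest spectral radius among connected graphs with the same vertices and the same
number of edges. -/
def IsRadiusMaximal (α : ℝ) (G : SimpleGraph V) : Prop :=
  G.Connected ∧ ∀ H : SimpleGraph V, H.Connected → H.edgeSet.ncard = G.edgeSet.ncard →
    alphaRadius α H ≤ alphaRadius α G

theorem IsRadiusMaximal.not_connected_moveEdge {α : ℝ} (hα₀ : 0 < α) (hα₁ : α < 1)
    {G : SimpleGraph V} (hG : IsRadiusMaximal α G) {x : V → ℝ}
    (hx : IsPerronPair α G (alphaRadius α G) x) {y u v : V} (hyu : G.Adj y u)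
    (hyv : ¬ G.Adj y v) (hv : y ≠ v) (huv : x u ≤ x v) : ¬ (moveEdge G y u v).Connected :=
  fun hc => absurd (hG.2 _ hc (ncard_edgeSet_moveEdge hyu hyv hv))
    (not_le.2 (alphaRadius_lt_moveEdge hα₀ hα₁ hx hyu hyv hv huv))

theorem IsRadiusMaximal.dominating {α : ℝ} (hα₀ : 0 < α) (hα₁ : α < 1)
    {G : SimpleGraph V} (hG : IsRadiusMaximal α G) {x : V → ℝ}
    (hx : IsPerronPair α G (alphaRadius α G) x) {o : V} (ho : ∀ v, x v ≤ x o) {w : V}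
    (hw : w ≠ o) : G.Adj o w := by
  by_contra hcon
  obtain ⟨p⟩ := hG.1.preconnected o w
  -- A walk from `o` to `w` leaves the closed neighbourhood of `o` along some edge `c w'`. Replacing
  -- it by `o w'` keeps the graph connected, because `w'` still reaches `c` through `o`.
  obtain ⟨d, -, hd1, hd2⟩ := p.exists_boundary_dart {v | v = o ∨ G.Adj o v} (Or.inl rfl)
    (by rintro (h | h); exacts [hw h, hcon h])
  have hd := d.adj
  set c := d.fst
  set w' := d.snd
  rw [Set.mem_ofPred_eq, not_or] at hd2
  have hoc : G.Adj o c := by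
    rcases hd1 with h | h
    · exact absurd (h ▸ hd) hd2.2
    · exact h
  have hyv : ¬ G.Adj w' o := fun h => hd2.2 h.symm
  refine hG.not_connected_moveEdge hα₀ hα₁ hx hd.symm hyv hd2.1 (ho c) ?_
  have hreach : ∀ a b, G.Adj a b → (moveEdge G w' c o).Reachable a b := by
    have h1 : (moveEdge G w' c o).Adj w' o := by rw [moveEdge_adj hd2.1]; tauto
    have h2 : (moveEdge G w' c o).Adj o c := by
      rw [moveEdge_adj hd2.1]
      refine Or.inl ⟨hoc, ?_⟩
      rintro (⟨h, -⟩ | ⟨h, -⟩)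
      · exact hd2.1 h.symm
      · exact hoc.ne h
    have h3 : (moveEdge G w' c o).Reachable w' c := h1.reachable.trans h2.reachable
    intro a b hab
    by_cases h : (a = w' ∧ b = c) ∨ (a = c ∧ b = w')
    · rcases h with ⟨rfl, rfl⟩ | ⟨rfl, rfl⟩
      exacts [h3, h3.symm]
    · exact SimpleGraph.Adj.reachable (by rw [moveEdge_adj hd2.1]; tauto)
  have := hG.1.nonempty
  refine ⟨fun a b => ?_⟩
  obtain ⟨q⟩ := hG.1.preconnected a b
  induction q with
  | nil => exact SimpleGraph.Reachable.refl _
  | cons h _ ih => exact (hreach _ _ h).trans ih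

/-- Neighbourhoods in an extremal graph are nested along the Perron vector. -/
theorem IsRadiusMaximal.nested {α : ℝ} (hα₀ : 0 < α) (hα₁ : α < 1)
    {G : SimpleGraph V} (hG : IsRadiusMaximal α G) {x : V → ℝ}
    (hx : IsPerronPair α G (alphaRadius α G) x) {u v y : V} (huv : x u ≤ x v)
    (hyu : G.Adj y u) (hyv : y ≠ v) : G.Adj y v := by
  by_contra hcon
  have := hG.1.nonempty
  obtain ⟨o, ho⟩ := Finite.exists_max x
  have hdom : ∀ o', (∀ v, x v ≤ x o') → ∀ w, w ≠ o' → G.Adj o' w :=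
    fun o' ho' w hw => hG.dominating hα₀ hα₁ hx ho' hw
  have hvo : v ≠ o := by rintro rfl; exact hcon (hdom v ho y hyv).symm
  have huo : u ≠ o := by
    rintro rfl
    exact hcon (hdom v (fun w => (ho w).trans huv) y hyv).symm
  have hyo : y ≠ o := by rintro rfl; exact hcon (hdom y ho v hyv.symm)
  -- The heaviest vertex `o` differs from `y` and `u`, so it loses no edge and keeps the rotated
  -- graph connected.
  refine hG.not_connected_moveEdge hα₀ hα₁ hx hyu hcon hyv huv
    (connected_of_dominating (o := o) fun w hw => ?_)
  rw [moveEdge_adj hyv]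
  refine Or.inl ⟨hdom o ho w hw, ?_⟩
  rintro (⟨h, -⟩ | ⟨h, -⟩)
  exacts [hyo h.symm, huo h.symm]

end Rotation

/-! ### The comparison graph and its Perron vector. -/

section StarJoin

open scoped Classical
open Finset

variable {V : Type*}

/-- The graph in which the vertices of `K` are adjacent to all other vertices, and `z` is moreover
adjacent to the vertices of `L`. -/
def starJoin (K : Finset V) (z : V) (L : Finset V) : SimpleGraph V where
  Adj v w := v ≠ w ∧ (v ∈ K ∨ w ∈ K ∨ (v = z ∧ w ∈ L) ∨ (w = z ∧ v ∈ L))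
  symm := ⟨fun v w h => ⟨h.1.symm, by tauto⟩⟩
  loopless := ⟨fun v h => h.1 rfl⟩

theorem starJoin_adj {K L : Finset V} {z v w : V} :
    (starJoin K z L).Adj v w ↔
      v ≠ w ∧ (v ∈ K ∨ w ∈ K ∨ (v = z ∧ w ∈ L) ∨ (w = z ∧ v ∈ L)) := Iff.rfl

variable {K L : Finset V} {z : V}

theorem starJoin_dominating {v w : V} (hv : v ∈ K) (hw : w ≠ v) : (starJoin K z L).Adj v w :=
  ⟨hw.symm, Or.inl hv⟩

theorem starJoin_connected (hK : K.Nonempty) : (starJoin K z L).Connected := by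
  obtain ⟨o, ho⟩ := hK
  exact connected_of_dominating (o := o) fun w hw => starJoin_dominating ho hw

variable [Fintype V]

theorem alphaOp_eq_sum_of_adj_iff {α : ℝ} {G : SimpleGraph V} {x : V → ℝ} {v : V} {N : Finset V}
    (h : ∀ w, G.Adj v w ↔ w ∈ N) :
    alphaOp α G x v = α * #N * x v + (1 - α) * ∑ w ∈ N, x w := by
  simp only [alphaOp, h]
  rw [← Finset.sum_filter, Finset.filter_mem_eq_inter, Finset.univ_inter, Finset.sum_add_distrib,
    Finset.sum_const, nsmul_eq_mul, Finset.mul_sum]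
  ring

theorem alphaOp_of_dominating {G : SimpleGraph V} (α : ℝ) (x : V → ℝ) {v : V}
    (hv : ∀ w, w ≠ v → G.Adj v w) :
    alphaOp α G x v = α * (Fintype.card V - 1) * x v + (1 - α) * (∑ w, x w - x v) := by
  rw [alphaOp_eq_sum_of_adj_iff (N := univ.erase v)]
  · rw [card_erase_of_mem (mem_univ v), Nat.cast_sub (card_pos.2 ⟨v, mem_univ v⟩),
      ← Finset.add_sum_erase univ x (mem_univ v), card_univ]
    push_cast
    ring
  · intro w
    refine ⟨fun h => by simpa using h.ne', fun h => hv w (by simpa using h)⟩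

theorem alphaOp_starJoin_center (hzK : z ∉ K) (hzL : z ∉ L) (hKL : Disjoint K L) (α : ℝ)
    (x : V → ℝ) :
    alphaOp α (starJoin K z L) x z =
      α * (#K + #L) * x z + (1 - α) * (∑ w ∈ K, x w + ∑ w ∈ L, x w) := by
  rw [alphaOp_eq_sum_of_adj_iff (N := K ∪ L), card_union_of_disjoint hKL, sum_union hKL]
  · push_cast; ring
  · intro w
    rw [starJoin_adj, mem_union]
    constructor
    · tauto
    · rintro (h | h)
      · exact ⟨by rintro rfl; exact hzK h, by tauto⟩
      · exact ⟨by rintro rfl; exact hzL h, by tauto⟩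

theorem alphaOp_starJoin_leaf (hzK : z ∉ K) (hzL : z ∉ L) (hKL : Disjoint K L) (α : ℝ)
    (x : V → ℝ) {v : V} (hv : v ∈ L) :
    alphaOp α (starJoin K z L) x v =
      α * (#K + 1) * x v + (1 - α) * (∑ w ∈ K, x w + x z) := by
  have hvK : v ∉ K := fun h => disjoint_left.1 hKL h hv
  have hvz : v ≠ z := by rintro rfl; exact hzL hv
  rw [alphaOp_eq_sum_of_adj_iff (N := insert z K), card_insert_of_notMem hzK, sum_insert hzK]
  · push_cast; ring
  · intro w
    rw [starJoin_adj, mem_insert]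
    constructor
    · tauto
    · rintro (rfl | h)
      · exact ⟨hvz, by tauto⟩
      · exact ⟨by rintro rfl; exact hvK h, by tauto⟩

theorem alphaOp_starJoin_other (α : ℝ) (x : V → ℝ) {v : V} (hvK : v ∉ K) (hvz : v ≠ z)
    (hvL : v ∉ L) :
    alphaOp α (starJoin K z L) x v = α * #K * x v + (1 - α) * ∑ w ∈ K, x w := by
  rw [alphaOp_eq_sum_of_adj_iff (N := K)]
  intro w
  rw [starJoin_adj]
  constructor
  · tauto
  · intro h
    exact ⟨by rintro rfl; exact hvK h, by tauto⟩

theorem sum_starJoin_parts (hzK : z ∉ K) (hzL : z ∉ L) (hKL : Disjoint K L) (f : V → ℝ) :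
    ∑ v, f v = ∑ v ∈ K, f v + f z + ∑ v ∈ L, f v + ∑ v ∈ (K ∪ insert z L)ᶜ, f v := by
  rw [← Finset.sum_add_sum_compl (K ∪ insert z L) f, sum_union, sum_insert hzL]
  · ring
  · rw [disjoint_insert_right]
    exact ⟨hzK, hKL⟩

theorem card_starJoin_parts (hzK : z ∉ K) (hzL : z ∉ L) (hKL : Disjoint K L) :
    (Fintype.card V : ℝ) = #K + 1 + #L + #(K ∪ insert z L)ᶜ := by
  have := sum_starJoin_parts hzK hzL hKL (fun _ => (1 : ℝ))
  simpa using this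

theorem two_mul_ncard_starJoin (hzK : z ∉ K) (hzL : z ∉ L) (hKL : Disjoint K L) :
    2 * ((starJoin K z L).edgeSet.ncard : ℝ) =
      #K * (Fintype.card V - 1) + #K * (Fintype.card V - #K) + 2 * #L := by
  -- With `α = 1` and the all-ones vector, `alphaOp` returns degrees, so the row formulas also count
  -- edges.
  have h : ∀ v, ∑ w, (if (starJoin K z L).Adj v w then (1 : ℝ) else 0) =
      alphaOp 1 (starJoin K z L) (fun _ => 1) v := fun v => by simp [alphaOp]
  rw [← sum_adj_eq_two_mul_ncard, Finset.sum_congr rfl fun v _ => h v,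
    sum_starJoin_parts hzK hzL hKL, alphaOp_starJoin_center hzK hzL hKL,
    Finset.sum_congr rfl fun v hv => alphaOp_of_dominating (G := starJoin K z L) 1 (fun _ => 1)
      (fun w hw => starJoin_dominating hv hw),
    Finset.sum_congr rfl fun v hv => alphaOp_starJoin_leaf hzK hzL hKL 1 (fun _ => 1) hv,
    Finset.sum_congr rfl fun v hv => alphaOp_starJoin_other (z := z) (L := L) 1 (fun _ => 1)
      (v := v) (by simp at hv; tauto) (by simp at hv; tauto) (by simp at hv; tauto)]
  simp only [sum_const, nsmul_eq_mul]
  rw [card_starJoin_parts hzK hzL hKL]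
  ring

/-- The Perron vector of a graph with a set `K` of dominating vertices, scaled to be `1` on `K`. -/
theorem exists_scaled_perron {α : ℝ} (hα₁ : α < 1) {G : SimpleGraph V}
    (hK : K.Nonempty) (hdom : ∀ v ∈ K, ∀ w, w ≠ v → G.Adj v w) :
    ∃ x, IsPerronPair α G (alphaRadius α G) x ∧ (∀ v ∈ K, x v = 1) ∧
      alphaRadius α G - α * (Fintype.card V - 1) + (1 - α) = (1 - α) * ∑ v, x v := by
  obtain ⟨o, ho⟩ := hK
  obtain ⟨y, hy0, hy⟩ := exists_perronPair hα₁ (connected_of_dominating (hdom o ho))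
  -- The row of a dominating vertex involves only its own entry and the total weight, so all entries
  -- on `K` agree. After scaling, the radius becomes an affine function of the total weight.
  have heq : ∀ v ∈ K, (alphaRadius α G - α * (Fintype.card V - 1) + (1 - α)) * y v =
      (1 - α) * ∑ w, y w := by
    intro v hv
    have := hy v
    rw [alphaOp_of_dominating α y (hdom v hv)] at this
    linarith
  have hS : 0 < (1 - α) * ∑ w, y w :=
    mul_pos (by linarith) (Finset.sum_pos (fun v _ => hy0 v) ⟨o, mem_univ o⟩)
  have hC : alphaRadius α G - α * (Fintype.card V - 1) + (1 - α) ≠ 0 := by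
    intro h
    have := heq o ho
    rw [h, zero_mul] at this
    linarith
  have hconst : ∀ v ∈ K, y v = y o := fun v hv =>
    mul_left_cancel₀ hC ((heq v hv).trans (heq o ho).symm)
  have hyo := (hy0 o).ne'
  refine ⟨fun v => y v / y o, ⟨fun v => div_pos (hy0 v) (hy0 o), fun v => ?_⟩, fun v hv => ?_, ?_⟩
  · have h1 : alphaOp α G (fun v => y v / y o) v = alphaOp α G y v / y o := by
      simp only [alphaOp, Finset.sum_div]
      refine Finset.sum_congr rfl fun w _ => ?_
      split_ifs
      · ring
      · simp
    rw [h1, hy]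
    ring
  · simp only [hconst v hv, div_self hyo]
  · rw [← Finset.sum_div, ← mul_div_assoc, ← heq o ho, mul_div_assoc, div_self hyo, mul_one]

/-- Each row outside `K` can be solved from the entry at `z`, so the vector takes one value per
class and the eigenvalue equation becomes a system of four equations. The condition on the number of
vertices keeps the divisor `ρ - α (#K + 1)` positive. -/
theorem exists_perron_starJoin {α : ℝ} (hα₀ : 0 < α) (hα₁ : α < 1) (hK : K.Nonempty)
    (hzK : z ∉ K) (hzL : z ∉ L) (hKL : Disjoint K L) (hn : #K + 2 ≤ Fintype.card V) :
    ∃ (x : V → ℝ) (ζ h η : ℝ), IsPerronPair α (starJoin K z L) (alphaRadius α (starJoin K z L)) x ∧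
      (∀ v ∈ K, x v = 1) ∧ x z = ζ ∧ (∀ v ∈ L, x v = h) ∧
      (∀ v, v ∉ K → v ≠ z → v ∉ L → x v = η) ∧ 0 < ζ ∧ 0 < h ∧ 0 < η ∧
      alphaRadius α (starJoin K z L) - α * (Fintype.card V - 1) + (1 - α) =
        (1 - α) * (#K + ζ + #L * h + #(K ∪ insert z L)ᶜ * η) ∧
      (alphaRadius α (starJoin K z L) - α * (#K + #L)) * ζ = (1 - α) * (#K + #L * h) ∧
      (alphaRadius α (starJoin K z L) - α * (#K + 1)) * h = (1 - α) * (#K + ζ) ∧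
      (alphaRadius α (starJoin K z L) - α * #K) * η = (1 - α) * #K ∧
      α * (Fintype.card V - 1) < alphaRadius α (starJoin K z L) := by
  obtain ⟨x, hx, hx1, hsum⟩ := exists_scaled_perron (G := starJoin K z L) hα₁ hK
    (fun v hv w hw => starJoin_dominating hv hw)
  set ρ := alphaRadius α (starJoin K z L)
  have hKsum : ∑ v ∈ K, x v = #K := by
    rw [Finset.sum_congr rfl hx1]; simp
  have hk1 : (1 : ℝ) ≤ #K := by exact_mod_cast hK.card_pos
  have hρ : α * (Fintype.card V - 1) < ρ := by
    have h1 : (#K : ℝ) + x z ≤ ∑ v, x v := by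
      rw [sum_starJoin_parts hzK hzL hKL, hKsum]
      have := Finset.sum_nonneg (s := L) fun v _ => (hx.1 v).le
      have := Finset.sum_nonneg (s := (K ∪ insert z L)ᶜ) fun v _ => (hx.1 v).le
      linarith
    have := hx.1 z
    have : 0 < (1 - α) * (∑ v, x v - 1) := mul_pos (by linarith) (by linarith)
    linarith
  have hn' : (#K : ℝ) + 2 ≤ Fintype.card V := by exact_mod_cast hn
  have hρ1 : 0 < ρ - α * (#K + 1) := by nlinarith
  have hρ0 : 0 < ρ - α * #K := by nlinarith
  have hL : ∀ v ∈ L, x v = (1 - α) * (#K + x z) / (ρ - α * (#K + 1)) := by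
    intro v hv
    have := hx.2 v
    rw [alphaOp_starJoin_leaf hzK hzL hKL α x hv, hKsum] at this
    rw [eq_div_iff hρ1.ne']
    linarith
  have hO : ∀ v, v ∉ K → v ≠ z → v ∉ L → x v = (1 - α) * #K / (ρ - α * #K) := by
    intro v h1 h2 h3
    have := hx.2 v
    rw [alphaOp_starJoin_other α x h1 h2 h3, hKsum] at this
    rw [eq_div_iff hρ0.ne']
    linarith
  have hLsum : ∑ v ∈ L, x v = #L * ((1 - α) * (#K + x z) / (ρ - α * (#K + 1))) := by
    rw [Finset.sum_congr rfl hL]; simp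
  have hOsum : ∑ v ∈ (K ∪ insert z L)ᶜ, x v =
      #(K ∪ insert z L)ᶜ * ((1 - α) * #K / (ρ - α * #K)) := by
    rw [Finset.sum_congr rfl fun v hv => hO v (by simp at hv; tauto) (by simp at hv; tauto)
      (by simp at hv; tauto)]
    simp
  have hz := hx.1 z
  refine ⟨x, x z, _, _, hx, hx1, rfl, hL, hO, hz, ?_, ?_, ?_, ?_, ?_, ?_, hρ⟩
  · exact div_pos (mul_pos (by linarith) (by linarith)) hρ1
  · exact div_pos (mul_pos (by linarith) (by linarith)) hρ0
  · rw [hsum, sum_starJoin_parts hzK hzL hKL, hKsum, hLsum, hOsum]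
  · have := hx.2 z
    rw [alphaOp_starJoin_center hzK hzL hKL, hKsum, hLsum] at this
    linarith
  · exact mul_div_cancel₀ _ hρ1.ne'
  · exact mul_div_cancel₀ _ hρ0.ne'

end StarJoin

/-! ### Inequalities between the class values. -/

section Numeric

/-- Estimates for the Perron vector of a star join. -/
theorem starJoin_perron_bounds {α ρ k a δ n ζ h η : ℝ} (hα₀ : 1 / 2 ≤ α) (hα₁ : α < 1)
    (hk : 1 ≤ k) (ha : 0 ≤ a) (hδ : 0 ≤ δ) (hn : n = k + 1 + a + δ)
    (hζ : 0 < ζ) (hh : 0 < h) (hη : 0 < η)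
    (e₁ : ρ - α * (n - 1) + (1 - α) = (1 - α) * (k + ζ + a * h + δ * η))
    (e₂ : (ρ - α * (k + a)) * ζ = (1 - α) * (k + a * h))
    (e₃ : (ρ - α * (k + 1)) * h = (1 - α) * (k + ζ))
    (e₄ : (ρ - α * k) * η = (1 - α) * k) (hρ : α * (n - 1) < ρ)
    (hY : 20 * k ≤ 3 * (n - 1 - k)) (hY' : 0 < a → 20 * (k + 1) ≤ 3 * (n - 2 - k)) :
    ζ ≤ 1 ∧ η ≤ ζ ∧ η ≤ 3 / 20 ∧ (0 < a → h ≤ 3 / 20) ∧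
      (0 < a → α * η + (1 - α) * ζ ≤ 23 / 40) ∧
      (a = 0 → α * η + (1 - α) * ζ ≤ 3 / 20) ∧
      (0 < δ → δ * (α * η + (1 - α) * ζ) < α * (1 - ζ) * (α * (n - 1 - k))) := by
  have hα : 0 < α := by linarith
  have hβ : 0 < 1 - α := by linarith
  have hαα : 1 / 4 ≤ α * α := by nlinarith
  have hρk : 0 < ρ - α * k := by
    have : α * k ≤ α * (n - 1) := mul_le_mul_of_nonneg_left (by linarith) hα.le
    linarith
  -- By `e₁`, `Γ + α δ = ρ - α (k + a) + (1 - α)`, which turns the equation of the centre into one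
  -- for `1 - ζ`.
  set Γ := (1 - α) * (k + ζ + a * h + δ * η) with hΓ
  have hΓ0 : 0 < Γ := by positivity
  have hz : (Γ + α * δ) * ζ = Γ - (1 - α) * (δ * η) := by
    have : Γ + α * δ = ρ - α * (k + a) + (1 - α) := by rw [← e₁, hn]; ring
    rw [this, hΓ]
    linear_combination e₂
  have hζ1 : ζ ≤ 1 := by
    have h1 : 0 ≤ (1 - α) * (δ * η) := by positivity
    have h2 : 0 ≤ α * δ * ζ := by positivity
    by_contra hcon
    have := mul_lt_mul_of_pos_left (not_le.1 hcon) hΓ0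
    linarith
  have hηζ : η ≤ ζ := by
    have h1 : (ρ - α * k) * η ≤ (ρ - α * k) * ζ := by
      have : 0 ≤ α * a * ζ := by positivity
      have : 0 ≤ (1 - α) * (a * h) := by positivity
      linarith
    exact le_of_mul_le_mul_left h1 hρk
  have hαη : α * η ≤ (1 - α) * (3 / 20) := by
    have h1 : α * (n - 1 - k) * η ≤ (1 - α) * k := by
      rw [← e₄]
      exact mul_le_mul_of_nonneg_right (by linarith) hη.le
    have h2 : α * η * (20 * k) ≤ α * η * (3 * (n - 1 - k)) :=
      mul_le_mul_of_nonneg_left hY (by positivity)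
    have h3 : (α * η) * k ≤ ((1 - α) * (3 / 20)) * k := by linarith
    exact le_of_mul_le_mul_right h3 (by linarith)
  have hη1 : η ≤ 3 / 20 := by
    have : 1 / 2 * η ≤ α * η := mul_le_mul_of_nonneg_right hα₀ hη.le
    linarith
  have hh1 : 0 < a → h ≤ 3 / 20 := by
    intro ha'
    have hY2 := hY' ha'
    have h1 : α * (n - 2 - k) * h ≤ (1 - α) * (k + 1) := by
      have : (ρ - α * (k + 1)) * h ≤ (1 - α) * (k + 1) := by
        rw [e₃]; exact mul_le_mul_of_nonneg_left (by linarith) hβ.le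
      refine le_trans (mul_le_mul_of_nonneg_right (by linarith) hh.le) this
    have h2 : α * h * (20 * (k + 1)) ≤ α * h * (3 * (n - 2 - k)) :=
      mul_le_mul_of_nonneg_left hY2 (by positivity)
    have h3 : (α * h) * (k + 1) ≤ ((1 - α) * (3 / 20)) * (k + 1) := by linarith
    have h4 := le_of_mul_le_mul_right h3 (by linarith)
    have : 1 / 2 * h ≤ α * h := mul_le_mul_of_nonneg_right hα₀ hh.le
    linarith
  refine ⟨hζ1, hηζ, hη1, hh1, fun _ => ?_, fun ha' => ?_, fun hδ' => ?_⟩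
  · have : (1 - α) * ζ ≤ (1 - α) * 1 := mul_le_mul_of_nonneg_left hζ1 hβ.le
    linarith
  · have h1 : ζ = η := by
      refine mul_left_cancel₀ hρk.ne' ?_
      rw [e₄]
      rw [ha'] at e₂
      linarith
    rw [h1]; linarith
  · set ψ := α * η + (1 - α) * ζ with hψ
    have hψ0 : 0 < ψ := by positivity
    -- This bounds `1 - ζ` from below: for `α ≥ 1/2` the right-hand side is at least `δ ψ`, and `Γ`
    -- is smaller than `α (α (n - 1 - k))`.
    have h1 : Γ * (1 - ζ) = δ * (α * ζ + (1 - α) * η) := by linear_combination -hz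
    have h2 : ψ ≤ α * ζ + (1 - α) * η := by
      have : 0 ≤ (2 * α - 1) * (ζ - η) := mul_nonneg (by linarith) (by linarith)
      linarith
    have hΓP : Γ < α * (α * (n - 1 - k)) := by
      have hah : a * h ≤ a * (3 / 20) := by
        rcases ha.eq_or_lt with h0 | h0
        · rw [← h0]; simp
        · exact mul_le_mul_of_nonneg_left (hh1 h0) ha
      have hδη : δ * η ≤ δ * (3 / 20) := mul_le_mul_of_nonneg_left hη1 hδ
      have h3 : Γ ≤ 1 / 2 * (k + 1 + (a + δ) * (3 / 20)) := by
        rw [hΓ]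
        have h5 : 0 < k + ζ + a * h + δ * η := by positivity
        have h6 : (1 - α) * (k + ζ + a * h + δ * η) ≤ 1 / 2 * (k + ζ + a * h + δ * η) :=
          mul_le_mul_of_nonneg_right (by linarith) h5.le
        linarith
      have h4 : 1 / 4 * (n - 1 - k) ≤ α * (α * (n - 1 - k)) := by
        rw [← mul_assoc]
        exact mul_le_mul_of_nonneg_right hαα (by linarith)
      linarith
    have hζlt : 0 < 1 - ζ := by
      by_contra hcon
      have : 0 < Γ * (1 - ζ) := by
        rw [h1]; positivity
      exact absurd this (not_lt.2 (mul_nonpos_of_nonneg_of_nonpos hΓ0.le (not_lt.1 hcon)))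
    calc δ * ψ ≤ Γ * (1 - ζ) := by rw [h1]; exact mul_le_mul_of_nonneg_left h2 hδ
      _ < α * (α * (n - 1 - k)) * (1 - ζ) := mul_lt_mul_of_pos_right hΓP hζlt
      _ = α * (1 - ζ) * (α * (n - 1 - k)) := by ring

/-- The final inequality of the removal case in abstract form. `M` counts missing pairs between `K`
and `W`, `u` edges inside `W`, `τ` superfluous leaves at `z`, and `s` bounds the missing pairs at
one vertex. `X` and `Xw` are the weights of the `K`-ends and `W`-ends of missing pairs, `B` the
weight of the superfluous leaves. After multiplication by `P M`, the bounds on `B` and on `M xz`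
leave a positive coefficient of `X` and a nonnegative one of `Xw`. -/
theorem compare_star_removal {α P M u τ s δ ζ η ψ E X Xw B xz : ℝ}
    (hα₀ : 0 < α) (hα₁ : α < 1) (hP : 0 < P) (hM : 0 < M) (hu : 0 ≤ u) (hτ : 0 ≤ τ)
    (hMu : M = u + τ) (hs₀ : 0 ≤ s) (hsM : s ≤ M) (hδ : τ + 1 ≤ δ)
    (hη : 0 < η) (hζ : 0 < ζ) (hζ1 : ζ ≤ 1) (hE : 0 ≤ E) (hψ : ψ = α * η + (1 - α) * ζ)
    (hxz : 0 < xz) (hX : M * xz ≤ X) (hXw : 0 ≤ Xw)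
    (hB : M * P * B ≤ τ * (P * Xw + s * X) + M * xz * (τ + 2 * u))
    (hδψ : δ * ψ < α * (1 - ζ) * P) (hnum : 2 * E * P + (s + 2) * ψ < α * P) :
    0 < X * (α + (1 - α) * η) + (α * η + (1 - α)) * Xw - τ * xz * (α * ζ + (1 - α) * η) - ψ * B
      - 2 * u * xz * E := by
  have hβ : 0 < 1 - α := by linarith
  have hψ0 : 0 < ψ := by rw [hψ]; positivity
  have hX0 : 0 < X := lt_of_lt_of_le (by positivity) hX
  have hc : s * ψ < P * α - 2 * P * E - 2 * ψ := by linarith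
  -- For `s ≤ τ` the second bracket is nonnegative thanks to `hδψ`. For `s > τ` its deficit is at
  -- most `τ ψ (s - τ)`, and `s - τ ≤ u` lets the first bracket absorb it.
  have hbr : 0 < u * (P * α - 2 * P * E - 2 * ψ) + τ * (P * α * (1 - ζ) - ψ * (s + 1)) := by
    have hg : 0 < P * α * (1 - ζ) - ψ * (τ + 1) := by
      have := mul_le_mul_of_nonneg_right hδ hψ0.le
      linarith
    have hsψ : 0 ≤ s * ψ := by positivity
    rcases le_or_gt s τ with hs | hs
    · have hg' : 0 < P * α * (1 - ζ) - ψ * (s + 1) := by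
        have := mul_le_mul_of_nonneg_right hs hψ0.le
        linarith
      rcases hτ.eq_or_lt with h0 | h0
      · rw [← h0, zero_mul, add_zero]
        exact mul_pos (by linarith) (by linarith)
      · have := mul_pos h0 hg'
        have : 0 ≤ u * (P * α - 2 * P * E - 2 * ψ) := mul_nonneg hu (by linarith)
        linarith
    · have hu0 : 0 < u := by linarith
      have h1 : u * (s * ψ) < u * (P * α - 2 * P * E - 2 * ψ) := mul_lt_mul_of_pos_left hc hu0
      have h2 : 0 ≤ τ * (P * α * (1 - ζ) - ψ * (τ + 1)) := mul_nonneg hτ hg.le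
      have h3 : τ * (ψ * (s - τ)) ≤ u * (s * ψ) := by
        have h4 : ψ * (s - τ) ≤ ψ * u := mul_le_mul_of_nonneg_left (by linarith) hψ0.le
        have h5 : τ * (ψ * (s - τ)) ≤ τ * (ψ * u) := mul_le_mul_of_nonneg_left h4 hτ
        have h6 : τ * (ψ * u) ≤ s * (ψ * u) :=
          mul_le_mul_of_nonneg_right hs.le (by positivity)
        linarith
      linarith
  have hXw' : 0 ≤ P * Xw * (M * (α * η + (1 - α)) - ψ * τ) := by
    refine mul_nonneg (by positivity) ?_
    have h1 : ψ ≤ α * η + (1 - α) := by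
      have : (1 - α) * ζ ≤ (1 - α) * 1 := mul_le_mul_of_nonneg_left hζ1 hβ.le
      linarith
    have h2 : ψ * τ ≤ (α * η + (1 - α)) * τ := mul_le_mul_of_nonneg_right h1 hτ
    have h3 : (α * η + (1 - α)) * τ ≤ (α * η + (1 - α)) * M :=
      mul_le_mul_of_nonneg_left (by linarith) (by positivity)
    linarith
  -- `Q` collects the coefficients of `M xz`, to be bounded by `X` through `hX`.
  set Q := P * τ * (α * ζ + (1 - α) * η) + ψ * (τ + 2 * u) + 2 * u * P * E with hQ
  have hQX : M * xz * Q ≤ X * Q := mul_le_mul_of_nonneg_right hX (by positivity)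
  have hψB := mul_le_mul_of_nonneg_left hB hψ0.le
  have hXbr := mul_pos hX0 hbr
  have huη : 0 ≤ X * (P * u * (1 - α) * η) := by positivity
  have hfin : 0 < P * M * (X * (α + (1 - α) * η) + (α * η + (1 - α)) * Xw -
      τ * xz * (α * ζ + (1 - α) * η) - ψ * B - 2 * u * xz * E) := by
    have hX2 : P * M * (X * (α + (1 - α) * η)) =
        X * (P * (u + τ) * α) + X * (P * u * (1 - α) * η) + X * (P * τ * (1 - α) * η) := by
      rw [hMu]; ring
    have : P * M * (X * (α + (1 - α) * η) + (α * η + (1 - α)) * Xw -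
      τ * xz * (α * ζ + (1 - α) * η) - ψ * B - 2 * u * xz * E) =
      P * M * (X * (α + (1 - α) * η)) + P * M * ((α * η + (1 - α)) * Xw) - ψ * (M * P * B)
        - M * xz * (Q - ψ * (τ + 2 * u)) := by rw [hQ]; ring
    rw [this, hX2]
    rw [hQ] at hQX ⊢
    linarith
  exact pos_of_mul_pos_right hfin (by positivity)

end Numeric

/-! ### Edge sums and entry differences compared between two graphs. -/

section Compare

open scoped Classical
open Finset

variable {V : Type*} [Fintype V]

theorem sum_insert_compl {K : Finset V} {z : V} (hzK : z ∉ K) (f : V → ℝ) :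
    ∑ v, f v = ∑ v ∈ K, f v + f z + ∑ v ∈ (insert z K)ᶜ, f v := by
  rw [← Finset.sum_add_sum_compl (insert z K) f, sum_insert hzK]
  ring

/-- Comparison of a sum over the edges of `starJoin K z L` with the sum over the edges of a graph
in which `K` is a clique all of whose vertices are adjacent to `z`. -/
theorem sum_starJoin_sub {G : SimpleGraph V} {K L : Finset V} {z : V} (hzK : z ∉ K)
    (hclique : ∀ i ∈ K, ∀ j ∈ insert z K, j ≠ i → G.Adj i j)
    (b : V → V → ℝ) :
    ∑ v, ∑ w, ((if (starJoin K z L).Adj v w then 1 else 0) - (if G.Adj v w then 1 else 0)) *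
        b v w =
      ∑ i ∈ K, ∑ w ∈ (insert z K)ᶜ, (if G.Adj i w then 0 else b i w + b w i) +
      ∑ w ∈ (insert z K)ᶜ, ((if w ∈ L then 1 else 0) - (if G.Adj z w then 1 else 0)) *
        (b z w + b w z) -
      ∑ u ∈ (insert z K)ᶜ, ∑ w ∈ (insert z K)ᶜ, if G.Adj u w then b u w else 0 := by
  set W := (insert z K)ᶜ with hW
  have memW : ∀ w, w ∈ W ↔ w ≠ z ∧ w ∉ K := by intro w; simp [hW]
  set D : V → V → ℝ := fun v w =>
    (if (starJoin K z L).Adj v w then 1 else 0) - (if G.Adj v w then 1 else 0) with hD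
  have hDsymm : ∀ v w, D v w = D w v := by
    intro v w
    simp only [hD, SimpleGraph.adj_comm _ v w]
  have hD0 : ∀ i ∈ K, ∀ j ∈ insert z K, D i j = 0 := by
    intro i hi j hj
    by_cases h : j = i
    · simp [hD, h]
    · simp only [hD]
      rw [if_pos (starJoin_dominating hi h), if_pos (hclique i hi j hj h), sub_self]
  have hDzz : D z z = 0 := by simp [hD]
  have hDKW : ∀ i ∈ K, ∀ w ∈ W, ∀ t : ℝ, D i w * t = if G.Adj i w then 0 else t := by
    intro i hi w hw t
    have hne : w ≠ i := by rintro rfl; exact ((memW _).1 hw).2 hi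
    simp only [hD]
    rw [if_pos (starJoin_dominating hi hne)]
    split_ifs <;> simp
  have hDz : ∀ w ∈ W, D z w = (if w ∈ L then 1 else 0) - (if G.Adj z w then 1 else 0) := by
    intro w hw
    have h := (memW _).1 hw
    have : (starJoin K z L).Adj z w ↔ w ∈ L := by
      rw [starJoin_adj]
      constructor
      · rintro ⟨-, h1 | h1 | h1 | h1⟩
        exacts [absurd h1 hzK, absurd h1 h.2, h1.2, absurd h1.1 h.1]
      · intro h1
        exact ⟨h.1.symm, by tauto⟩
    simp only [hD, this]
  have hDW : ∀ u ∈ W, ∀ w ∈ W, ∀ t : ℝ, D u w * t = -(if G.Adj u w then t else 0) := by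
    intro u hu w hw t
    have h1 := (memW _).1 hu
    have h2 := (memW _).1 hw
    have : ¬ (starJoin K z L).Adj u w := by
      rw [starJoin_adj]; tauto
    simp only [hD]
    rw [if_neg this]
    split_ifs <;> simp
  have hrow : ∀ i ∈ K, ∑ w, D i w * b i w = ∑ w ∈ W, if G.Adj i w then 0 else b i w := by
    intro i hi
    rw [sum_insert_compl hzK, hD0 i hi z (mem_insert_self _ _),
      Finset.sum_congr rfl fun w hw => by rw [hD0 i hi w (mem_insert_of_mem hw)],
      Finset.sum_congr rfl fun w hw => hDKW i hi w hw _]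
    simp
  have hrowz : ∑ w, D z w * b z w = ∑ w ∈ W, D z w * b z w := by
    rw [sum_insert_compl hzK, hDzz,
      Finset.sum_congr rfl fun w hw => by rw [hDsymm, hD0 w hw z (mem_insert_self _ _)]]
    simp [hW]
  have hrowW : ∀ w ∈ W, ∑ u, D w u * b w u = ∑ i ∈ K, (if G.Adj i w then 0 else b w i) +
      D z w * b w z - ∑ u ∈ W, if G.Adj w u then b w u else 0 := by
    intro w hw
    rw [sum_insert_compl hzK, hDsymm w z,
      Finset.sum_congr rfl fun i hi => by rw [hDsymm, hDKW i hi w hw],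
      Finset.sum_congr (s₁ := (insert z K)ᶜ) rfl fun u hu => hDW w hw u hu _,
      Finset.sum_neg_distrib, sub_eq_add_neg]
  rw [sum_insert_compl hzK, Finset.sum_congr rfl hrow, hrowz,
    Finset.sum_congr (s₁ := (insert z K)ᶜ) rfl hrowW, Finset.sum_sub_distrib,
    Finset.sum_add_distrib, Finset.sum_comm (s := W) (t := K)]
  have h1 : ∑ i ∈ K, ∑ w ∈ W, (if G.Adj i w then 0 else b i w + b w i) =
      ∑ i ∈ K, ∑ w ∈ W, (if G.Adj i w then 0 else b i w) +
        ∑ i ∈ K, ∑ w ∈ W, (if G.Adj i w then 0 else b w i) := by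
    simp only [← Finset.sum_add_distrib]
    refine Finset.sum_congr rfl fun i _ => Finset.sum_congr rfl fun w _ => ?_
    split_ifs <;> simp
  have h2 : ∑ w ∈ W, ((if w ∈ L then 1 else 0) - (if G.Adj z w then 1 else 0)) *
        (b z w + b w z) = ∑ w ∈ W, D z w * b z w + ∑ w ∈ W, D z w * b w z := by
    rw [← Finset.sum_add_distrib]
    refine Finset.sum_congr rfl fun w hw => ?_
    rw [hDz w hw]; ring
  rw [h1, h2]
  ring

/-- Subtract the eigenvalue equations at `u` and `w` after adding `α c` to every neighbour's
contribution. Common neighbours cancel and only neighbours of `u` can contribute positively. The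
choices `c = x u` and `c = x w` put the degree of `w` or of `u` into the coefficient; the removal
case needs the first, the extension case the second. -/
theorem sum_adj_mul_sub_le {α ρ : ℝ} (hα₀ : 0 ≤ α) (hα₁ : α ≤ 1) {G : SimpleGraph V} {x : V → ℝ}
    (hx : IsPerronPair α G ρ x) {K : Finset V} {z u w : V} (hzK : z ∉ K) :
    (ρ - α * ∑ y, if G.Adj w y then 1 else 0) * (x u - x w) ≤
      ∑ i ∈ K, (if G.Adj i w then 0 else (1 - α) * x i + α * x u) +
        ((1 - α) * x z + α * x u) +
        ∑ y ∈ (insert z K)ᶜ, (if G.Adj u y then (1 - α) * x y + α * x u else 0) ∧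
    (ρ - α * ∑ y, if G.Adj u y then 1 else 0) * (x u - x w) ≤
      ∑ i ∈ K, (if G.Adj i w then 0 else (1 - α) * x i + α * x w) +
        ((1 - α) * x z + α * x w) +
        ∑ y ∈ (insert z K)ᶜ, (if G.Adj u y then (1 - α) * x y + α * x w else 0) := by
  have hbound : ∀ c : ℝ, 0 < c → ∑ y, ((if G.Adj u y then (1 - α) * x y + α * c else 0) -
      (if G.Adj w y then (1 - α) * x y + α * c else 0)) ≤
      ∑ i ∈ K, (if G.Adj i w then 0 else (1 - α) * x i + α * c) + ((1 - α) * x z + α * c) +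
        ∑ y ∈ (insert z K)ᶜ, (if G.Adj u y then (1 - α) * x y + α * c else 0) := by
    intro c hc
    have hnn : ∀ y, 0 ≤ (1 - α) * x y + α * c := fun y =>
      add_nonneg (mul_nonneg (by linarith) (hx.1 y).le) (mul_nonneg hα₀ hc.le)
    rw [sum_insert_compl hzK]
    refine add_le_add (add_le_add (Finset.sum_le_sum fun i _ => ?_) ?_)
      (Finset.sum_le_sum fun y _ => ?_)
    · have := hnn i
      rw [G.adj_comm i w]
      split_ifs <;> linarith
    · have := hnn z
      split_ifs <;> linarith
    · have := hnn y
      split_ifs <;> linarith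
  have hu := hx.2 u
  have hw := hx.2 w
  simp only [alphaOp] at hu hw
  constructor
  · refine le_trans (le_of_eq ?_) (hbound (x u) (hx.1 u))
    rw [Finset.sum_sub_distrib]
    have h1 : ∑ y, (if G.Adj u y then (1 - α) * x y + α * x u else 0) = ρ * x u := by
      rw [← hu]
      exact Finset.sum_congr rfl fun y _ => by split_ifs <;> ring
    have h2 : ∑ y, (if G.Adj w y then (1 - α) * x y + α * x u else 0) =
        ρ * x w + α * (∑ y, if G.Adj w y then 1 else 0) * (x u - x w) := by
      rw [← hw, Finset.mul_sum, Finset.sum_mul, ← Finset.sum_add_distrib]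
      exact Finset.sum_congr rfl fun y _ => by split_ifs <;> ring
    rw [h1, h2]; ring
  · refine le_trans (le_of_eq ?_) (hbound (x w) (hx.1 w))
    rw [Finset.sum_sub_distrib]
    have h1 : ∑ y, (if G.Adj w y then (1 - α) * x y + α * x w else 0) = ρ * x w := by
      rw [← hw]
      exact Finset.sum_congr rfl fun y _ => by split_ifs <;> ring
    have h2 : ∑ y, (if G.Adj u y then (1 - α) * x y + α * x w else 0) =
        ρ * x u + α * (∑ y, if G.Adj u y then 1 else 0) * (x w - x u) := by
      rw [← hu, Finset.mul_sum, Finset.sum_mul, ← Finset.sum_add_distrib]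
      exact Finset.sum_congr rfl fun y _ => by split_ifs <;> ring
    rw [h1, h2]; ring

end Compare

/-! ### Consequences of nestedness when `K` is not fully joined. -/

section Nested

open scoped Classical
open Finset

variable {V : Type*} [Fintype V]

/-- `K` consists of vertices of largest weight in the positive eigenvector `x`, neighbourhoods are
nested along `x`, and `z` is a vertex of largest weight outside `K`. -/
structure IsTopPart (α ρ : ℝ) (G : SimpleGraph V) (x : V → ℝ) (K : Finset V) (z : V) : Prop where
  perron : IsPerronPair α G ρ x
  nested : ∀ u v y, x u ≤ x v → G.Adj y u → y ≠ v → G.Adj y v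
  notMem : z ∉ K
  top : ∀ v ∈ K, ∀ u, u ∉ K → x u ≤ x v
  le_center : ∀ u, u ∉ K → x u ≤ x z
  clique : ∀ i ∈ K, ∀ j ∈ insert z K, j ≠ i → G.Adj i j
  dominating : ∃ o ∈ K, ∀ w, w ≠ o → G.Adj o w

variable {α ρ : ℝ} {G : SimpleGraph V} {x : V → ℝ} {K L : Finset V} {z : V}

theorem mem_compl_insert {w : V} : w ∈ (insert z K)ᶜ ↔ w ≠ z ∧ w ∉ K := by simp

theorem card_compl_insert (hzK : z ∉ K) :
    (#(insert z K)ᶜ : ℝ) = Fintype.card V - 1 - #K := by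
  have := sum_insert_compl hzK (fun _ => (1 : ℝ))
  simp only [sum_const, card_univ, nsmul_eq_mul, mul_one] at this
  linarith

/-- Every vertex of `K` is at least as heavy as `y`, so an edge `wy` would force the edge `wi`. -/
theorem IsTopPart.not_adj_of_not_adj (h : IsTopPart α ρ G x K z) {i w y : V} (hi : i ∈ K)
    (hw : w ∉ K) (hiw : ¬ G.Adj i w) (hy : y ∉ K) : ¬ G.Adj w y := fun hwy =>
  hiw (h.nested y i w (h.top i hi y hy) hwy (by rintro rfl; exact hw hi)).symm

theorem IsTopPart.center_adj (h : IsTopPart α ρ G x K z) {u w : V} (hu : u ∉ K) (hw : w ≠ z)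
    (huw : G.Adj w u) : G.Adj z w :=
  (h.nested u z w (h.le_center u hu) huw hw).symm

/-- The comparison formula with unit weights: missing pairs plus new leaves at `z` (minus removed
ones) are paid for by the edges inside the complement of `insert z K`. -/
theorem edge_balance (hzK : z ∉ K) (hL : L ⊆ (insert z K)ᶜ)
    (hclique : ∀ i ∈ K, ∀ j ∈ insert z K, j ≠ i → G.Adj i j)
    (hm : (starJoin K z L).edgeSet.ncard = G.edgeSet.ncard) :
    2 * ∑ i ∈ K, ∑ w ∈ (insert z K)ᶜ, (if G.Adj i w then (0 : ℝ) else 1) +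
      2 * (#L - ∑ w ∈ (insert z K)ᶜ, if G.Adj z w then (1 : ℝ) else 0) =
      ∑ u ∈ (insert z K)ᶜ, ∑ w ∈ (insert z K)ᶜ, if G.Adj u w then (1 : ℝ) else 0 := by
  have h := sum_starJoin_sub (L := L) hzK hclique (fun _ _ => (1 : ℝ))
  simp only [mul_one, Finset.sum_sub_distrib] at h
  rw [sum_adj_eq_two_mul_ncard, sum_adj_eq_two_mul_ncard, hm, sub_self] at h
  have h1 : ∑ w ∈ (insert z K)ᶜ, (if w ∈ L then (1 : ℝ) else 0) = #L := by
    rw [Finset.sum_boole, Finset.filter_mem_eq_inter, inter_eq_right.2 hL]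
  have h2 : ∑ i ∈ K, ∑ w ∈ (insert z K)ᶜ, (if G.Adj i w then (0 : ℝ) else 1 + 1) =
      2 * ∑ i ∈ K, ∑ w ∈ (insert z K)ᶜ, (if G.Adj i w then (0 : ℝ) else 1) := by
    simp only [Finset.mul_sum]
    refine Finset.sum_congr rfl fun i _ => Finset.sum_congr rfl fun w _ => ?_
    split_ifs <;> norm_num
  rw [← Finset.sum_mul, Finset.sum_sub_distrib, h1, h2] at h
  linarith

theorem IsTopPart.card_mul_center_le (h : IsTopPart α ρ G x K z) :
    (∑ i ∈ K, ∑ w ∈ (insert z K)ᶜ, (if G.Adj i w then (0 : ℝ) else 1)) * x z ≤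
      ∑ i ∈ K, ∑ w ∈ (insert z K)ᶜ, (if G.Adj i w then 0 else x i) := by
  simp only [Finset.sum_mul]
  refine Finset.sum_le_sum fun i hi => Finset.sum_le_sum fun w _ => ?_
  split_ifs
  · simp
  · simpa using h.top i hi z h.notMem

/-- A vertex `w` missing some `i ∈ K` has all its neighbours in `K`, so its degree is at most `#K`
and the coefficient `ρ - α deg w` is at least `α (n - 1 - #K)`. -/
theorem IsTopPart.sub_le_removal (h : IsTopPart α ρ G x K z) (hα₀ : 0 ≤ α) (hα₁ : α ≤ 1)
    (hρ : α * (Fintype.card V - 1) < ρ) {b i w : V} (hb : b ∈ (insert z K)ᶜ) (hi : i ∈ K)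
    (hw : w ∈ (insert z K)ᶜ) (hiw : ¬ G.Adj i w) :
    α * (Fintype.card V - 1 - #K) * x b ≤ α * (Fintype.card V - 1 - #K) * x w +
      ∑ j ∈ K, (if G.Adj j w then 0 else x j) +
      (1 + ∑ y ∈ (insert z K)ᶜ, if G.Adj b y then (1 : ℝ) else 0) * x z := by
  rw [mem_compl_insert] at hb hw
  have key := (sum_adj_mul_sub_le hα₀ hα₁ h.perron (u := b) (w := w) h.notMem).1
  have hd : ∑ y, (if G.Adj w y then (1 : ℝ) else 0) ≤ #K := by
    rw [Finset.sum_boole]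
    refine Nat.cast_le.2 (card_le_card fun y hy => ?_)
    rw [mem_filter] at hy
    by_contra hyK
    exact h.not_adj_of_not_adj hi hw.2 hiw hyK hy.2
  have hxz := h.perron.1 z
  have hbz : x b ≤ x z := h.le_center b hb.2
  have hR1 : ∑ j ∈ K, (if G.Adj j w then 0 else (1 - α) * x j + α * x b) ≤
      ∑ j ∈ K, (if G.Adj j w then 0 else x j) := by
    refine Finset.sum_le_sum fun j hj => ?_
    split_ifs
    · exact le_rfl
    · have := mul_le_mul_of_nonneg_left (h.top j hj b hb.2) hα₀
      linarith
  have hR2 : (1 - α) * x z + α * x b ≤ x z := by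
    have := mul_le_mul_of_nonneg_left hbz hα₀
    linarith
  have hR3 : ∑ y ∈ (insert z K)ᶜ, (if G.Adj b y then (1 - α) * x y + α * x b else 0) ≤
      (∑ y ∈ (insert z K)ᶜ, if G.Adj b y then (1 : ℝ) else 0) * x z := by
    rw [Finset.sum_mul]
    refine Finset.sum_le_sum fun y hy => ?_
    split_ifs
    · have h1 := mul_le_mul_of_nonneg_left hbz hα₀
      have h2 := mul_le_mul_of_nonneg_left (h.le_center y (mem_compl_insert.1 hy).2)
        (sub_nonneg.2 hα₁)
      linarith
    · simp
  have hR0 : 0 ≤ ∑ j ∈ K, (if G.Adj j w then 0 else x j) :=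
    Finset.sum_nonneg fun j _ => by
      split_ifs
      · exact le_rfl
      · exact (h.perron.1 j).le
  have hR4 : 0 ≤ (∑ y ∈ (insert z K)ᶜ, if G.Adj b y then (1 : ℝ) else 0) * x z :=
    mul_nonneg (Finset.sum_nonneg fun y _ => by split_ifs <;> norm_num) hxz.le
  have hPn : 0 ≤ α * (Fintype.card V - 1 - #K) := by
    rw [← card_compl_insert h.notMem]; positivity
  rcases le_total (x b) (x w) with hbw | hbw
  · have := mul_le_mul_of_nonneg_left hbw hPn
    linarith
  · have hP : α * (Fintype.card V - 1 - #K) ≤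
        ρ - α * ∑ y, (if G.Adj w y then (1 : ℝ) else 0) := by
      have := mul_le_mul_of_nonneg_left hd hα₀
      linarith
    have := mul_le_mul_of_nonneg_right hP (sub_nonneg.2 hbw)
    linarith

/-- Take the maximal number of missing pairs at one vertex; it is at most `#K - 1` because `K`
contains a dominating vertex. -/
theorem IsTopPart.exists_missing_bound (h : IsTopPart α ρ G x K z)
    (hM : 0 < ∑ i ∈ K, ∑ w ∈ (insert z K)ᶜ, (if G.Adj i w then (0 : ℝ) else 1)) :
    ∃ s : ℝ, 0 ≤ s ∧ s + 1 ≤ #K ∧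
      s ≤ ∑ i ∈ K, ∑ w ∈ (insert z K)ᶜ, (if G.Adj i w then (0 : ℝ) else 1) ∧
      ∀ w ∈ (insert z K)ᶜ, ∑ i ∈ K, (if G.Adj i w then (0 : ℝ) else 1) ≤ s := by
  have hW : ((insert z K)ᶜ).Nonempty := by
    by_contra hcon
    rw [not_nonempty_iff_eq_empty] at hcon
    simp [hcon] at hM
  obtain ⟨w, hw, hmax⟩ := exists_max_image _
    (fun w => ∑ i ∈ K, (if G.Adj i w then (0 : ℝ) else 1)) hW
  have hnn : ∀ w, 0 ≤ ∑ i ∈ K, (if G.Adj i w then (0 : ℝ) else 1) := fun w =>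
    Finset.sum_nonneg fun i _ => by split_ifs <;> norm_num
  refine ⟨_, hnn w, ?_, ?_, hmax⟩
  · obtain ⟨o, ho, hdom⟩ := h.dominating
    have hwo : w ≠ o := by
      rintro rfl
      exact (mem_compl_insert.1 hw).2 ho
    rw [← Finset.add_sum_erase K _ ho, if_pos (hdom w hwo), zero_add]
    have h1 : ∑ i ∈ K.erase o, (if G.Adj i w then (0 : ℝ) else 1) ≤ ∑ i ∈ K.erase o, (1 : ℝ) :=
      Finset.sum_le_sum fun i _ => by split_ifs <;> norm_num
    have h2 : (#(K.erase o) : ℝ) + 1 = #K := by exact_mod_cast card_erase_add_one ho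
    simp only [sum_const, nsmul_eq_mul, mul_one] at h1
    linarith
  · rw [Finset.sum_comm]
    exact Finset.single_le_sum (f := fun w => ∑ i ∈ K, (if G.Adj i w then (0 : ℝ) else 1))
      (fun w _ => hnn w) hw

/-- The preceding bound is summed over all `b ∈ B` and all missing pairs, so no matching between
removed leaves and missing pairs has to be chosen. -/
theorem IsTopPart.sum_removed_le (h : IsTopPart α ρ G x K z) (hα₀ : 0 ≤ α) (hα₁ : α ≤ 1)
    (hρ : α * (Fintype.card V - 1) < ρ) {s : ℝ}
    (hs : ∀ w ∈ (insert z K)ᶜ, ∑ i ∈ K, (if G.Adj i w then (0 : ℝ) else 1) ≤ s)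
    {B : Finset V} (hB : B ⊆ (insert z K)ᶜ) :
    (∑ i ∈ K, ∑ w ∈ (insert z K)ᶜ, (if G.Adj i w then (0 : ℝ) else 1)) *
        (α * (Fintype.card V - 1 - #K)) * ∑ b ∈ B, x b ≤
      #B * (α * (Fintype.card V - 1 - #K) *
          ∑ i ∈ K, ∑ w ∈ (insert z K)ᶜ, (if G.Adj i w then 0 else x w) +
        s * ∑ i ∈ K, ∑ w ∈ (insert z K)ᶜ, (if G.Adj i w then 0 else x i)) +
      (∑ i ∈ K, ∑ w ∈ (insert z K)ᶜ, (if G.Adj i w then (0 : ℝ) else 1)) * x z *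
        (#B + ∑ u ∈ (insert z K)ᶜ, ∑ w ∈ (insert z K)ᶜ, if G.Adj u w then (1 : ℝ) else 0) := by
  set W := (insert z K)ᶜ with hW
  set P := α * ((Fintype.card V : ℝ) - 1 - #K) with hP
  set M := ∑ i ∈ K, ∑ w ∈ W, (if G.Adj i w then (0 : ℝ) else 1) with hMdef
  set deg : V → ℝ := fun b => ∑ y ∈ W, if G.Adj b y then (1 : ℝ) else 0 with hdeg
  have hM0 : 0 ≤ M := Finset.sum_nonneg fun i _ => Finset.sum_nonneg fun w _ => by
    split_ifs <;> norm_num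
  have hxz := h.perron.1 z
  -- Double counting: the weight missing at `w` appears once for each missing pair at `w`, hence at
  -- most `s` times.
  have hY : ∑ i ∈ K, ∑ w ∈ W, (if G.Adj i w then (0 : ℝ) else 1) *
      (∑ j ∈ K, (if G.Adj j w then 0 else x j)) ≤
      s * ∑ i ∈ K, ∑ w ∈ W, (if G.Adj i w then 0 else x i) := by
    rw [Finset.sum_comm, Finset.sum_comm (s := K), Finset.mul_sum]
    refine Finset.sum_le_sum fun w hw => ?_
    rw [← Finset.sum_mul]
    refine mul_le_mul_of_nonneg_right (hs w hw) (Finset.sum_nonneg fun j _ => ?_)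
    split_ifs
    · exact le_rfl
    · exact (h.perron.1 j).le
  have hone : ∀ b ∈ B, M * P * x b ≤ P * ∑ i ∈ K, ∑ w ∈ W, (if G.Adj i w then 0 else x w) +
      s * ∑ i ∈ K, ∑ w ∈ W, (if G.Adj i w then 0 else x i) + M * x z * (1 + deg b) := by
    intro b hb
    have h1 : M * P * x b ≤ ∑ i ∈ K, ∑ w ∈ W, (P * (if G.Adj i w then 0 else x w) +
        (if G.Adj i w then (0 : ℝ) else 1) * (∑ j ∈ K, (if G.Adj j w then 0 else x j)) +
        (if G.Adj i w then (0 : ℝ) else 1) * ((1 + deg b) * x z)) := by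
      rw [hMdef, mul_assoc, Finset.sum_mul]
      refine Finset.sum_le_sum fun i hi => ?_
      rw [Finset.sum_mul]
      refine Finset.sum_le_sum fun w hw => ?_
      split_ifs with hiw
      · simp
      · have := h.sub_le_removal hα₀ hα₁ hρ (hB hb) hi hw hiw
        simp only [one_mul]
        exact this
    refine h1.trans ?_
    simp only [Finset.sum_add_distrib, ← Finset.mul_sum, ← Finset.sum_mul]
    have : M * x z * (1 + deg b) = M * ((1 + deg b) * x z) := by ring
    rw [this]
    have hY' := hY
    linarith
  have hdegsum : ∑ b ∈ B, deg b ≤ ∑ u ∈ W, deg u :=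
    Finset.sum_le_sum_of_subset_of_nonneg hB fun u _ _ =>
      Finset.sum_nonneg fun y _ => by split_ifs <;> norm_num
  rw [Finset.mul_sum]
  refine (Finset.sum_le_sum hone).trans ?_
  rw [Finset.sum_add_distrib, Finset.sum_const, nsmul_eq_mul, ← Finset.mul_sum,
    Finset.sum_add_distrib, Finset.sum_const, nsmul_eq_mul, mul_one]
  have : 0 ≤ M * x z := mul_nonneg hM0 hxz.le
  gcongr

end Nested

/-! ### The case where `z` has at least as many leaves as needed. -/

section Improve

open scoped Classical
open Finset

variable {V : Type*} [Fintype V] {α ρ : ℝ} {G : SimpleGraph V} {x : V → ℝ} {K L : Finset V} {z : V}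

theorem lt_of_inner_pos {H : SimpleGraph V} {μ : ℝ} {y : V → ℝ} [Nonempty V]
    (hx : IsPerronPair α G ρ x) (hy : IsPerronPair α H μ y)
    (hpos : 0 < ∑ v, ∑ w, ((if H.Adj v w then 1 else 0) - (if G.Adj v w then 1 else 0)) *
        (x v * (α * y v + (1 - α) * y w))) : ρ < μ := by
  rw [← perronPair_inner hx hy] at hpos
  have : 0 < ∑ v, x v * y v :=
    Finset.sum_pos (fun v _ => mul_pos (hx.1 v) (hy.1 v)) univ_nonempty
  have := pos_of_mul_pos_left hpos this.le
  linarith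

theorem IsTopPart.exists_missing
    (hM : 0 < ∑ i ∈ K, ∑ w ∈ (insert z K)ᶜ, (if G.Adj i w then (0 : ℝ) else 1)) :
    ∃ i ∈ K, ∃ w ∈ (insert z K)ᶜ, ¬ G.Adj i w := by
  by_contra! hcon
  refine hM.ne' (Finset.sum_eq_zero fun i hi => Finset.sum_eq_zero fun w hw => ?_)
  rw [if_pos (hcon i hi w hw)]

set_option maxHeartbeats 1600000 in
/-- If `K` is not completely joined to the rest and the star at `z` has at least `#L` leaves, then
moving edges to obtain `starJoin K z L` increases the spectral radius. -/
theorem IsTopPart.lt_starJoin_of_subset (h : IsTopPart α ρ G x K z) (hα₀ : 1 / 2 ≤ α) (hα₁ : α < 1)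
    (hρ : α * (Fintype.card V - 1) < ρ)
    (hM : 0 < ∑ i ∈ K, ∑ w ∈ (insert z K)ᶜ, (if G.Adj i w then (0 : ℝ) else 1))
    (hLW : L ⊆ (insert z K)ᶜ) (hLz : ∀ w ∈ L, G.Adj z w)
    (hm : (starJoin K z L).edgeSet.ncard = G.edgeSet.ncard)
    (hY : 20 * (#K : ℝ) ≤ 3 * (Fintype.card V - 1 - #K))
    (hY' : 0 < (#L : ℝ) → 20 * ((#K : ℝ) + 1) ≤ 3 * (Fintype.card V - 2 - #K)) :
    ρ < alphaRadius α (starJoin K z L) := by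
  have hzK := h.notMem
  have hzL : z ∉ L := fun hz => (mem_compl_insert.1 (hLW hz)).1 rfl
  have hKL : Disjoint K L := disjoint_left.2 fun v hv hv' => (mem_compl_insert.1 (hLW hv')).2 hv
  obtain ⟨o, ho, -⟩ := h.dominating
  have : Nonempty V := ⟨o⟩
  have hk1 : (1 : ℝ) ≤ #K := by exact_mod_cast card_pos.2 ⟨o, ho⟩
  have hn : #K + 2 ≤ Fintype.card V := by
    have : (#K : ℝ) + 2 ≤ Fintype.card V := by linarith
    exact_mod_cast this
  obtain ⟨X, ζ, t, η, hX, hXK, hXz, hXL, hXO, hζ, ht, hη, e₁, e₂, e₃, e₄, hρ'⟩ :=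
    exists_perron_starJoin (by linarith) hα₁ ⟨o, ho⟩ hzK hzL hKL hn
  have hcard := card_starJoin_parts hzK hzL hKL
  obtain ⟨hζ1, hηζ, hη1, ht1, hψ1, hψ0, hδψ⟩ := starJoin_perron_bounds hα₀ hα₁ hk1
    (Nat.cast_nonneg _) (Nat.cast_nonneg _) hcard hζ ht hη e₁ e₂ e₃ e₄ hρ' hY hY'
  have hbal := edge_balance hzK hLW h.clique hm
  obtain ⟨s, hs0, hsk, hsM, hs⟩ := h.exists_missing_bound hM
  refine lt_of_inner_pos h.perron hX ?_
  rw [sum_starJoin_sub hzK h.clique]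
  set W := (insert z K)ᶜ with hW
  set M := ∑ i ∈ K, ∑ w ∈ W, (if G.Adj i w then (0 : ℝ) else 1) with hMdef
  set U := ∑ u ∈ W, ∑ w ∈ W, (if G.Adj u w then (1 : ℝ) else 0) with hU
  set XX := ∑ i ∈ K, ∑ w ∈ W, (if G.Adj i w then 0 else x i) with hXX
  set Xw := ∑ i ∈ K, ∑ w ∈ W, (if G.Adj i w then 0 else x w) with hXw
  set B := W.filter fun w => G.Adj z w ∧ w ∉ L with hBdef
  have hp : ∑ w ∈ W, (if G.Adj z w then (1 : ℝ) else 0) = #B + #L := by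
    rw [Finset.sum_boole, ← Nat.cast_add]
    congr 1
    rw [← card_union_of_disjoint]
    · congr 1
      ext w
      simp only [hBdef, mem_union, mem_filter]
      constructor
      · tauto
      · rintro (hh | hh)
        · exact ⟨hh.1, hh.2.1⟩
        · exact ⟨hLW hh, hLz w hh⟩
    · exact disjoint_left.2 fun v hv hv' => (mem_filter.1 hv).2.2 hv'
  obtain ⟨i₀, hi₀, w₀, hw₀, hiw₀⟩ := IsTopPart.exists_missing hM
  -- A vertex with a missing pair is not adjacent to `z`, so the neighbours of `z` do not exhaust
  -- the complement; this supplies the extra `1`.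
  have hδτ : (#B : ℝ) + 1 ≤ #(K ∪ insert z L)ᶜ := by
    have h1 : (#B : ℝ) + #L + 1 ≤ #W := by
      have h2 : #(W.filter fun w => G.Adj z w) < #W := by
        refine card_lt_card (filter_ssubset.2 ⟨w₀, hw₀, fun hzw => ?_⟩)
        exact h.not_adj_of_not_adj hi₀ (mem_compl_insert.1 hw₀).2 hiw₀ hzK hzw.symm
      have h3 : (#(W.filter fun w => G.Adj z w) : ℝ) = #B + #L := by
        rw [← hp, Finset.sum_boole]
      rw [← h3]
      exact_mod_cast h2
    have h2 := card_compl_insert (V := V) hzK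
    rw [← hW] at h2
    linarith
  have hxz := h.perron.1 z
  have hU0 : 0 ≤ U := Finset.sum_nonneg fun i _ => Finset.sum_nonneg fun w _ => by
    split_ifs <;> norm_num
  have hXw0 : 0 ≤ Xw := Finset.sum_nonneg fun i _ => Finset.sum_nonneg fun w _ => by
    split_ifs
    · exact le_rfl
    · exact (h.perron.1 w).le
  have hsum := h.sum_removed_le (by linarith) hα₁.le hρ hs (B := B) (filter_subset _ _)
  have hP : 0 < α * ((Fintype.card V : ℝ) - 1 - #K) := mul_pos (by linarith) (by linarith)
  -- Here `s + 2 ≤ #K + 1`, and `3/20` bounds `X` outside `insert z K`. The weight `α η + (1 - α) ζ`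
  -- is at most `23/40 = 3/40 + 1/2` when there are leaves, and at most `3/20` otherwise.
  have hnum : 2 * (3 / 20) * (α * ((Fintype.card V : ℝ) - 1 - #K)) +
      (s + 2) * (α * η + (1 - α) * ζ) < α * (α * ((Fintype.card V : ℝ) - 1 - #K)) := by
    set P := α * ((Fintype.card V : ℝ) - 1 - #K)
    have h1 : 1 / 2 * ((Fintype.card V : ℝ) - 1 - #K) ≤ P :=
      mul_le_mul_of_nonneg_right hα₀ (by linarith)
    have h2 : 1 / 2 * P ≤ α * P := mul_le_mul_of_nonneg_right hα₀ hP.le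
    have hψ : 0 < α * η + (1 - α) * ζ :=
      add_pos (mul_pos (by linarith) hη) (mul_pos (by linarith) hζ)
    have h3 : (s + 2) * (α * η + (1 - α) * ζ) ≤ ((#K : ℝ) + 1) * (α * η + (1 - α) * ζ) :=
      mul_le_mul_of_nonneg_right (by linarith) hψ.le
    rcases (Nat.cast_nonneg (α := ℝ) #L).eq_or_lt with ha | ha
    · have := mul_le_mul_of_nonneg_left (hψ0 ha.symm) (by linarith : (0 : ℝ) ≤ (#K : ℝ) + 1)
      linarith
    · have := mul_le_mul_of_nonneg_left (hψ1 ha) (by linarith : (0 : ℝ) ≤ (#K : ℝ) + 1)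
      have := hY' ha
      linarith
  have hmain := compare_star_removal (α := α) (u := U / 2) (τ := #B) (by linarith) hα₁ hP hM
    (by linarith) (Nat.cast_nonneg _) (by rw [hp] at hbal; linarith) hs0 hsM hδτ hη hζ hζ1
    (E := 3 / 20) (by norm_num) rfl hxz h.card_mul_center_le hXw0
    (by rw [mul_div_cancel₀ _ two_ne_zero]; exact hsum)
    (hδψ (by have := Nat.cast_nonneg (α := ℝ) #B; linarith)) hnum
  -- An end of a missing pair is not adjacent to `z`, hence not in `L`, so it has the value `η`.
  have hXη : ∀ i ∈ K, ∀ w ∈ W, ¬ G.Adj i w → X w = η := by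
    intro i hi w hw hiw
    have hw' := mem_compl_insert.1 hw
    refine hXO w hw'.2 hw'.1 fun hwL => ?_
    exact h.not_adj_of_not_adj hi hw'.2 hiw hzK (hLz w hwL).symm
  have hT1 : ∑ i ∈ K, ∑ w ∈ W, (if G.Adj i w then 0 else
      x i * (α * X i + (1 - α) * X w) + x w * (α * X w + (1 - α) * X i)) =
      XX * (α + (1 - α) * η) + (α * η + (1 - α)) * Xw := by
    rw [hXX, hXw, Finset.sum_mul, Finset.mul_sum, ← Finset.sum_add_distrib]
    refine Finset.sum_congr rfl fun i hi => ?_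
    rw [Finset.sum_mul, Finset.mul_sum, ← Finset.sum_add_distrib]
    refine Finset.sum_congr rfl fun w hw => ?_
    split_ifs with hiw
    · simp
    · rw [hXK i hi, hXη i hi w hw hiw]; ring
  have hT2 : ∑ w ∈ W, ((if w ∈ L then 1 else 0) - (if G.Adj z w then 1 else 0)) *
      (x z * (α * X z + (1 - α) * X w) + x w * (α * X w + (1 - α) * X z)) =
      -(#B * x z * (α * ζ + (1 - α) * η) + (α * η + (1 - α) * ζ) * ∑ b ∈ B, x b) := by
    have : ∑ b ∈ B, (x z * (α * ζ + (1 - α) * η) + x b * (α * η + (1 - α) * ζ)) =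
      #B * x z * (α * ζ + (1 - α) * η) + (α * η + (1 - α) * ζ) * ∑ b ∈ B, x b := by
      rw [Finset.sum_add_distrib, Finset.sum_const, nsmul_eq_mul, ← Finset.sum_mul]
      ring
    rw [← this, hBdef, Finset.sum_filter, ← Finset.sum_neg_distrib]
    refine Finset.sum_congr rfl fun w hw => ?_
    have hw' := mem_compl_insert.1 hw
    by_cases hwL : w ∈ L
    · simp [hwL, hLz w hwL]
    · rw [hXz, hXO w hw'.2 hw'.1 hwL]
      by_cases hzw : G.Adj z w
      · simp [hwL, hzw]
      · simp [hwL, hzw]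
  have hXE : ∀ w ∈ W, X w ≤ 3 / 20 := by
    intro w hw
    have hw' := mem_compl_insert.1 hw
    by_cases hwL : w ∈ L
    · rw [hXL w hwL]
      exact ht1 (by exact_mod_cast card_pos.2 ⟨w, hwL⟩)
    · rw [hXO w hw'.2 hw'.1 hwL]
      exact hη1
  have hT3 : ∑ u ∈ W, ∑ w ∈ W, (if G.Adj u w then x u * (α * X u + (1 - α) * X w) else 0) ≤
      U * x z * (3 / 20) := by
    rw [hU, mul_assoc, Finset.sum_mul]
    refine Finset.sum_le_sum fun u hu => ?_
    rw [Finset.sum_mul]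
    refine Finset.sum_le_sum fun w hw => ?_
    split_ifs
    · rw [one_mul]
      refine mul_le_mul (h.le_center u (mem_compl_insert.1 hu).2) ?_ ?_ hxz.le
      · have := mul_le_mul_of_nonneg_left (hXE u hu) (by linarith : 0 ≤ α)
        have := mul_le_mul_of_nonneg_left (hXE w hw) (by linarith : 0 ≤ 1 - α)
        linarith
      · exact add_nonneg (mul_nonneg (by linarith) (hX.1 u).le)
          (mul_nonneg (by linarith) (hX.1 w).le)
    · simp
  rw [hT1, hT2]
  linarith

end Improve

/-! ### The case where `z` has too few leaves. -/

section Extend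

open scoped Classical
open Finset

variable {V : Type*} [Fintype V] {α ρ : ℝ} {G : SimpleGraph V} {x : V → ℝ} {K L : Finset V} {z : V}

/-- A vertex `c` that has a neighbour outside `K` and `z` is not much heavier than any other
vertex `w` outside `K` and `z`, in terms of the number `p` of neighbours of `z`. -/
theorem IsTopPart.sub_le_extension (h : IsTopPart α ρ G x K z) (hα₀ : 1 / 2 ≤ α) (hα₁ : α < 1)
    (hρ : α * (Fintype.card V - 1) < ρ) {a D : ℝ}
    (hpa : ∑ y ∈ (insert z K)ᶜ, (if G.Adj z y then (1 : ℝ) else 0) + 1 ≤ a)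
    (ha : a + #K + 2 ≤ Fintype.card V) (hD : 0 < D) (hDρ : D ≤ ρ - α * (#K + a) + (1 - α))
    {b c w : V} (hb : b ∈ (insert z K)ᶜ) (hc : c ∈ (insert z K)ᶜ) (hbc : G.Adj b c)
    (hw : w ∈ (insert z K)ᶜ) :
    x c ≤ x w + ∑ i ∈ K, (if G.Adj i w then 0 else x i) +
      (a - 1) / D * ((1 - α) * x z + α * x w) := by
  have key := (sum_adj_mul_sub_le (by linarith) hα₁.le h.perron (u := c) (w := w) h.notMem).2
  set W := (insert z K)ᶜ with hW
  set p := ∑ y ∈ W, (if G.Adj z y then (1 : ℝ) else 0) with hp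
  rw [mem_compl_insert] at hb hc hw
  have hzc : G.Adj z c := h.center_adj hb.2 hc.1 hbc.symm
  have hxz := h.perron.1 z
  have hxw := h.perron.1 w
  -- Every neighbour of `c` in `W`, and `c` itself, is a neighbour of `z`.
  have hnbr : 1 + ∑ y ∈ W, (if G.Adj c y then (1 : ℝ) else 0) ≤ p := by
    have hcW : c ∈ W := mem_compl_insert.2 hc
    rw [hp, ← Finset.add_sum_erase W _ hcW, ← Finset.add_sum_erase W _ hcW, if_pos hzc,
      if_neg (G.loopless.irrefl c), zero_add]
    gcongr with y hy
    have hy' := mem_compl_insert.1 (mem_of_mem_erase hy)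
    by_cases hcy : G.Adj c y
    · rw [if_pos hcy, if_pos (h.center_adj hc.2 hy'.1 hcy.symm)]
    · rw [if_neg hcy]; split_ifs <;> norm_num
  have hd : ∑ y, (if G.Adj c y then (1 : ℝ) else 0) ≤ #K + p := by
    rw [sum_insert_compl h.notMem, if_pos hzc.symm]
    have : ∑ y ∈ K, (if G.Adj c y then (1 : ℝ) else 0) ≤ #K := by
      rw [Finset.sum_boole]
      exact_mod_cast card_filter_le _ _
    linarith
  set g := (1 - α) * x z + α * x w with hg
  have hg0 : 0 ≤ g := add_nonneg (mul_nonneg (by linarith) hxz.le) (mul_nonneg (by linarith) hxw.le)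
  set A := ∑ i ∈ K, (if G.Adj i w then 0 else x i) with hA
  have hA0 : 0 ≤ A := Finset.sum_nonneg fun i _ => by
    split_ifs
    · exact le_rfl
    · exact (h.perron.1 i).le
  have hR1 : ∑ i ∈ K, (if G.Adj i w then 0 else (1 - α) * x i + α * x w) ≤ A := by
    refine Finset.sum_le_sum fun i hi => ?_
    split_ifs
    · exact le_rfl
    · have := mul_le_mul_of_nonneg_left (h.top i hi w hw.2) (by linarith : 0 ≤ α)
      linarith
  have hR3 : ∑ y ∈ W, (if G.Adj c y then (1 - α) * x y + α * x w else 0) ≤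
      (∑ y ∈ W, if G.Adj c y then (1 : ℝ) else 0) * g := by
    rw [Finset.sum_mul]
    refine Finset.sum_le_sum fun y hy => ?_
    split_ifs
    · have h2 := mul_le_mul_of_nonneg_left (h.le_center y (mem_compl_insert.1 hy).2)
        (by linarith : 0 ≤ 1 - α)
      linarith
    · simp
  have ha1 : 0 ≤ a - 1 := by
    have : 0 ≤ ∑ y ∈ W, (if G.Adj c y then (1 : ℝ) else 0) :=
      Finset.sum_nonneg fun y _ => by split_ifs <;> norm_num
    linarith
  have hfrac : 0 ≤ (a - 1) / D * g := mul_nonneg (div_nonneg ha1 hD.le) hg0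
  rcases le_total (x c) (x w) with hcw | hcw
  · linarith
  · set R := ρ - α * ∑ y, (if G.Adj c y then (1 : ℝ) else 0) with hR
    have hd' := mul_le_mul_of_nonneg_left hd (by linarith : 0 ≤ α)
    have hpa' := mul_le_mul_of_nonneg_left hpa (by linarith : 0 ≤ α)
    have ha' := mul_le_mul_of_nonneg_left ha (by linarith : 0 ≤ α)
    have hRD : D ≤ R := by linarith
    -- Since `deg c ≤ #K + a - 1` and `ρ > α (#K + a + 1)`, the coefficient exceeds `2 α ≥ 1`.
    have hR1' : 1 ≤ R := by linarith
    have hRx : R * (x c - x w) ≤ A + (a - 1) * g := by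
      have : (1 + ∑ y ∈ W, (if G.Adj c y then (1 : ℝ) else 0)) * g ≤ (a - 1) * g :=
        mul_le_mul_of_nonneg_right (by linarith) hg0
      linarith
    have hsub : 0 ≤ x c - x w := by linarith
    have hle : R * (x c - x w) ≤ R * (A + (a - 1) / D * g) := by
      refine hRx.trans ?_
      have h1 : A ≤ R * A := le_mul_of_one_le_left hA0 hR1'
      have h2 : (a - 1) * g ≤ R * ((a - 1) / D * g) := by
        have : (a - 1) * g = D * ((a - 1) / D * g) := by field_simp
        rw [this]
        exact mul_le_mul_of_nonneg_right hRD hfrac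
      linarith
    have := le_of_mul_le_mul_left hle (by linarith)
    linarith

/-- There are `M + #A` edges inside `W`, to be exchanged for `M` missing pairs and `#A` new leaves.
Each edge weight is at most `2 x z` and also at most a bound attached to any given `w ∈ A`;
averaging these bounds with weights `M` and `#A` replaces an explicit matching. -/
theorem IsTopPart.sum_edges_le (h : IsTopPart α ρ G x K z) (hα₀ : 1 / 2 ≤ α) (hα₁ : α < 1)
    (hρ : α * (Fintype.card V - 1) < ρ) {a D M : ℝ} {A : Finset V}
    (hpa : ∑ y ∈ (insert z K)ᶜ, (if G.Adj z y then (1 : ℝ) else 0) + 1 ≤ a)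
    (ha : a + #K + 2 ≤ Fintype.card V) (hD : 0 < D) (hDρ : D ≤ ρ - α * (#K + a) + (1 - α))
    (hA : A ⊆ (insert z K)ᶜ) (hM : 0 < M)
    (hbal : 2 * M + 2 * #A =
      ∑ u ∈ (insert z K)ᶜ, ∑ w ∈ (insert z K)ᶜ, if G.Adj u w then (1 : ℝ) else 0) :
    ∑ u ∈ (insert z K)ᶜ, ∑ w ∈ (insert z K)ᶜ, (if G.Adj u w then x u else 0) ≤
      2 * M * x z + ∑ w ∈ A, (x z + x w + (a - 1) / D * ((1 - α) * x z + α * x w)) +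
      ∑ i ∈ K, ∑ w ∈ (insert z K)ᶜ, (if G.Adj i w then 0 else x i) := by
  have hadj := fun b c w hb hc hbc hw => h.sub_le_extension hα₀ hα₁ hρ hpa ha hD hDρ
    (b := b) (c := c) (w := w) hb hc hbc hw
  set W := (insert z K)ᶜ with hW
  set U := ∑ u ∈ W, ∑ w ∈ W, (if G.Adj u w then (1 : ℝ) else 0) with hU
  set Q := ∑ u ∈ W, ∑ w ∈ W, (if G.Adj u w then x u else 0) with hQ
  set F : V → ℝ := fun w => x z + (x w + ∑ i ∈ K, (if G.Adj i w then 0 else x i) +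
      (a - 1) / D * ((1 - α) * x z + α * x w)) with hF
  have hQ2 : 2 * Q = ∑ u ∈ W, ∑ w ∈ W, (if G.Adj u w then x u + x w else 0) := by
    have : Q = ∑ u ∈ W, ∑ w ∈ W, (if G.Adj u w then x w else 0) := by
      rw [hQ, Finset.sum_comm]
      simp only [G.adj_comm]
    rw [two_mul]
    nth_rewrite 2 [this]
    rw [hQ, ← Finset.sum_add_distrib]
    refine Finset.sum_congr rfl fun u _ => ?_
    rw [← Finset.sum_add_distrib]
    refine Finset.sum_congr rfl fun w _ => ?_
    split_ifs <;> simp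
  have hall : ∀ C : ℝ, (∀ u ∈ W, ∀ w ∈ W, G.Adj u w → x u + x w ≤ C) → 2 * Q ≤ U * C := by
    intro C hC
    rw [hQ2, hU, Finset.sum_mul]
    refine Finset.sum_le_sum fun u hu => ?_
    rw [Finset.sum_mul]
    refine Finset.sum_le_sum fun w hw => ?_
    split_ifs with huw
    · simpa using hC u hu w hw huw
    · simp
  have h1 : 2 * Q ≤ U * (2 * x z) := hall _ fun u hu w hw _ => by
    have := h.le_center u (mem_compl_insert.1 hu).2
    have := h.le_center w (mem_compl_insert.1 hw).2
    linarith
  have h2 : #A * (2 * Q) ≤ U * ∑ w ∈ A, F w := by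
    rw [Finset.mul_sum A F U, ← nsmul_eq_mul, ← Finset.sum_const]
    refine Finset.sum_le_sum fun w hw => hall _ fun b hb c hc hbc => ?_
    have := hadj b c w hb hc hbc (hA hw)
    have := h.le_center b (mem_compl_insert.1 hb).2
    simp only [hF]
    linarith
  have hMA : 0 < M + #A := by positivity
  have h3 : (M + #A) * Q ≤ (M + #A) * (2 * M * x z + ∑ w ∈ A, F w) := by
    rw [← hbal] at h1 h2
    have := mul_le_mul_of_nonneg_left h1 hM.le
    linarith
  refine (le_of_mul_le_mul_left h3 hMA).trans ?_
  have h4 : ∑ w ∈ A, F w = ∑ w ∈ A, (x z + x w + (a - 1) / D * ((1 - α) * x z + α * x w)) +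
      ∑ w ∈ A, ∑ i ∈ K, (if G.Adj i w then 0 else x i) := by
    rw [← Finset.sum_add_distrib]
    exact Finset.sum_congr rfl fun w _ => by simp only [hF]; ring
  have h5 : ∑ w ∈ A, ∑ i ∈ K, (if G.Adj i w then 0 else x i) ≤
      ∑ w ∈ W, ∑ i ∈ K, (if G.Adj i w then 0 else x i) :=
    Finset.sum_le_sum_of_subset_of_nonneg hA fun w _ _ => Finset.sum_nonneg fun i _ => by
      split_ifs
      · exact le_rfl
      · exact (h.perron.1 i).le
  rw [Finset.sum_comm (s := W)] at h5
  linarith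

/-- If `K` is not completely joined to the rest and the star at `z` has fewer than `#L` leaves,
then moving edges to obtain `starJoin K z L` increases the spectral radius. -/
theorem IsTopPart.lt_starJoin_of_superset (h : IsTopPart α ρ G x K z) (hα₀ : 1 / 2 ≤ α)
    (hα₁ : α < 1) (hρ : α * (Fintype.card V - 1) < ρ)
    (hM : 0 < ∑ i ∈ K, ∑ w ∈ (insert z K)ᶜ, (if G.Adj i w then (0 : ℝ) else 1))
    (hLW : L ⊆ (insert z K)ᶜ) (hLz : ∀ w ∈ (insert z K)ᶜ, G.Adj z w → w ∈ L)
    (hex : ∃ w ∈ L, ¬ G.Adj z w) (hm : (starJoin K z L).edgeSet.ncard = G.edgeSet.ncard)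
    (hY : 20 * (#K : ℝ) ≤ 3 * (Fintype.card V - 1 - #K))
    (hY' : 20 * ((#K : ℝ) + 1) ≤ 3 * (Fintype.card V - 2 - #K))
    (ha : #L + #K + 2 ≤ Fintype.card V) :
    ρ < alphaRadius α (starJoin K z L) := by
  -- The negation is used quantitatively: `ρ' ≤ ρ` permits the denominator `D` below to be formed
  -- from `ρ'` instead of `ρ`.
  by_contra hcon
  rw [not_lt] at hcon
  have hzK := h.notMem
  have hzL : z ∉ L := fun hz => (mem_compl_insert.1 (hLW hz)).1 rfl
  have hKL : Disjoint K L := disjoint_left.2 fun v hv hv' => (mem_compl_insert.1 (hLW hv')).2 hv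
  obtain ⟨o, ho, -⟩ := h.dominating
  have : Nonempty V := ⟨o⟩
  have hk1 : (1 : ℝ) ≤ #K := by exact_mod_cast card_pos.2 ⟨o, ho⟩
  have ha' : (#L : ℝ) + #K + 2 ≤ Fintype.card V := by exact_mod_cast ha
  obtain ⟨w₁, hw₁, hzw₁⟩ := hex
  have hL0 : (0 : ℝ) < #L := by exact_mod_cast card_pos.2 ⟨w₁, hw₁⟩
  obtain ⟨X, ζ, t, η, hX, hXK, hXz, hXL, hXO, hζ, ht, hη, e₁, e₂, e₃, e₄, hρ'⟩ :=
    exists_perron_starJoin (by linarith) hα₁ ⟨o, ho⟩ hzK hzL hKL (by omega)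
  have hcard := card_starJoin_parts hzK hzL hKL
  obtain ⟨-, -, -, ht1, -, -, -⟩ := starJoin_perron_bounds hα₀ hα₁ hk1
    (Nat.cast_nonneg _) (Nat.cast_nonneg _) hcard hζ ht hη e₁ e₂ e₃ e₄ hρ' hY (fun _ => hY')
  have ht1 := ht1 hL0
  have hbal := edge_balance hzK hLW h.clique hm
  refine absurd (lt_of_inner_pos h.perron hX ?_) (not_lt.2 hcon)
  rw [sum_starJoin_sub hzK h.clique]
  set ρ' := alphaRadius α (starJoin K z L) with hρ'def
  set A := L.filter fun w => ¬ G.Adj z w with hAdef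
  have hp : (#L : ℝ) = #A + ∑ w ∈ (insert z K)ᶜ, (if G.Adj z w then (1 : ℝ) else 0) := by
    rw [Finset.sum_boole, ← Nat.cast_add]
    congr 1
    rw [← card_filter_add_card_filter_not (s := L) (fun w => G.Adj z w), add_comm]
    congr 2
    ext w
    simp only [mem_filter]
    exact ⟨fun hw => ⟨hLW hw.1, hw.2⟩, fun hw => ⟨hLz w hw.1 hw.2, hw.2⟩⟩
  have hA1 : (1 : ℝ) ≤ #A := by
    exact_mod_cast card_pos.2 ⟨w₁, mem_filter.2 ⟨hw₁, hzw₁⟩⟩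
  have hAW : A ⊆ (insert z K)ᶜ := (filter_subset _ _).trans hLW
  set D := ρ' - α * (#K + #L) + (1 - α) with hD
  have hD0 : 0 < D := by
    have := mul_le_mul_of_nonneg_left ha' (by linarith : 0 ≤ α)
    linarith
  -- The reason for this `D`: the factor `(a - 1) / D` bounding entry differences in `G` is exactly
  -- the relative difference `(ζ - t) / t` of the star.
  have hζt : (#L - 1) / D * t = ζ - t := by
    rw [div_mul_eq_mul_div, div_eq_iff hD0.ne', hD]
    linear_combination e₃ - e₂
  have hQ := h.sum_edges_le hα₀ hα₁ hρ (a := #L) (D := D) (A := A) (by linarith) ha' hD0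
    (by linarith) hAW hM (by linarith)
  have hMz := h.card_mul_center_le
  have hXX : 0 < ∑ i ∈ K, ∑ w ∈ (insert z K)ᶜ, (if G.Adj i w then 0 else x i) :=
    lt_of_lt_of_le (mul_pos hM (h.perron.1 z)) hMz
  have hT1 : α * ∑ i ∈ K, ∑ w ∈ (insert z K)ᶜ, (if G.Adj i w then 0 else x i) ≤
      ∑ i ∈ K, ∑ w ∈ (insert z K)ᶜ, (if G.Adj i w then 0 else
      x i * (α * X i + (1 - α) * X w) + x w * (α * X w + (1 - α) * X i)) := by
    rw [Finset.mul_sum]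
    refine Finset.sum_le_sum fun i hi => ?_
    rw [Finset.mul_sum]
    refine Finset.sum_le_sum fun w _ => ?_
    split_ifs
    · simp
    · rw [hXK i hi]
      have h1 := mul_pos (h.perron.1 i) (mul_pos (sub_pos.2 hα₁) (hX.1 w))
      have h2 := mul_pos (h.perron.1 w) (mul_pos (by linarith : 0 < α) (hX.1 w))
      have h3 := mul_pos (h.perron.1 w) (sub_pos.2 hα₁)
      linarith
  have hT2 : t * ∑ w ∈ A, (x z + x w + (#L - 1) / D * ((1 - α) * x z + α * x w)) ≤
      ∑ w ∈ (insert z K)ᶜ, ((if w ∈ L then 1 else 0) - (if G.Adj z w then 1 else 0)) *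
      (x z * (α * X z + (1 - α) * X w) + x w * (α * X w + (1 - α) * X z)) := by
    have h1 : ∑ w ∈ (insert z K)ᶜ, ((if w ∈ L then 1 else 0) - (if G.Adj z w then 1 else 0)) *
      (x z * (α * X z + (1 - α) * X w) + x w * (α * X w + (1 - α) * X z)) =
      ∑ w ∈ A, (x z * (α * ζ + (1 - α) * t) + x w * (α * t + (1 - α) * ζ)) := by
      rw [hAdef, Finset.sum_filter, ← Finset.sum_subset hLW]
      · refine Finset.sum_congr rfl fun w hw => ?_
        rw [hXz, hXL w hw]
        by_cases hzw : G.Adj z w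
        · simp [hw, hzw]
        · simp [hw, hzw]
      · intro w hw hwL
        have : ¬ G.Adj z w := fun hzw => hwL (hLz w hw hzw)
        simp [hwL, this]
    rw [h1, Finset.mul_sum]
    refine Finset.sum_le_sum fun w hw => ?_
    -- The only loss in this estimate of a new leaf; it is nonnegative because `α ≥ 1/2`, and zero
    -- when `α = 1/2`.
    have h2 : 0 ≤ (ζ - t) * ((2 * α - 1) * (x z - x w)) := by
      refine mul_nonneg ?_ (mul_nonneg (by linarith) ?_)
      · rw [← hζt]
        refine mul_nonneg (div_nonneg ?_ hD0.le) ht.le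
        have : 1 ≤ #L := card_pos.2 ⟨w₁, hw₁⟩
        have : (1 : ℝ) ≤ #L := by exact_mod_cast this
        linarith
      · have := h.le_center w (mem_compl_insert.1 (hAW hw)).2
        linarith
    have h3 : t * (x z + x w + (#L - 1) / D * ((1 - α) * x z + α * x w)) =
        t * (x z + x w) + (ζ - t) * ((1 - α) * x z + α * x w) := by
      rw [← hζt]; ring
    rw [h3]
    linarith
  have hT3 : ∑ u ∈ (insert z K)ᶜ, ∑ w ∈ (insert z K)ᶜ,
      (if G.Adj u w then x u * (α * X u + (1 - α) * X w) else 0) =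
      t * ∑ u ∈ (insert z K)ᶜ, ∑ w ∈ (insert z K)ᶜ, (if G.Adj u w then x u else 0) := by
    rw [Finset.mul_sum]
    refine Finset.sum_congr rfl fun u hu => ?_
    rw [Finset.mul_sum]
    refine Finset.sum_congr rfl fun w hw => ?_
    split_ifs with huw
    · have hu' := mem_compl_insert.1 hu
      have hw' := mem_compl_insert.1 hw
      rw [hXL u (hLz u hu (h.center_adj hw'.2 hu'.1 huw)),
        hXL w (hLz w hw (h.center_adj hu'.2 hw'.1 huw.symm))]
      ring
    · simp
  rw [hT3]
  have hQt := mul_le_mul_of_nonneg_left hQ ht.le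
  have hMt := mul_le_mul_of_nonneg_left hMz ht.le
  -- The missing pairs gain at least `α` times their `K`-weight and the uncompensated losses cost at
  -- most `3 t` times it; `3 t ≤ 9/20 < 1/2 ≤ α`.
  have hfin := mul_pos (by linarith : 0 < α - 3 * t) hXX
  linarith

end Extend

/-! ### The heaviest `k` vertices are dominating. -/

section Dominating

open scoped Classical
open Finset

theorem exists_top_finset {V : Type*} [Fintype V] (x : V → ℝ) {k : ℕ} (hk : k ≤ Fintype.card V) :
    ∃ K : Finset V, #K = k ∧ ∀ v ∈ K, ∀ u, u ∉ K → x u ≤ x v := by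
  induction k with
  | zero => exact ⟨∅, rfl, by simp⟩
  | succ k ih =>
    obtain ⟨K, hK, htop⟩ := ih (by omega)
    have hne : (Kᶜ).Nonempty := by
      rw [← card_pos, card_compl]; omega
    obtain ⟨z, hz, hmax⟩ := exists_max_image Kᶜ x hne
    rw [mem_compl] at hz
    refine ⟨insert z K, by rw [card_insert_of_notMem hz, hK], fun v hv u hu => ?_⟩
    rw [mem_insert, not_or] at hu
    rcases mem_insert.1 hv with rfl | hv
    · exact hmax u (mem_compl.2 hu.2)
    · exact htop v hv u hu.2

variable {V : Type*} [Fintype V] {α : ℝ} {G : SimpleGraph V}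

theorem lt_of_dominating_perron {ρ : ℝ} {x : V → ℝ} (hα₁ : α < 1) (hx : IsPerronPair α G ρ x)
    (hV : 2 ≤ Fintype.card V) {o : V} (ho : ∀ w, w ≠ o → G.Adj o w) :
    α * (Fintype.card V - 1) < ρ := by
  have h := hx.2 o
  rw [alphaOp_of_dominating α x ho, ← Finset.add_sum_erase univ x (mem_univ o)] at h
  have hpos : 0 < ∑ v ∈ univ.erase o, x v := by
    refine Finset.sum_pos (fun v _ => hx.1 v) ?_
    rw [← card_pos, card_erase_of_mem (mem_univ o), card_univ]
    omega
  have h1 := mul_pos (sub_pos.2 hα₁) hpos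
  by_contra hcon
  have := mul_le_mul_of_nonneg_right (not_lt.1 hcon) (hx.1 o).le
  linarith

/-- In a maximal graph with sufficiently few edges, the expected number of vertices is adjacent to
all the other vertices. -/
theorem IsRadiusMaximal.exists_dominating_finset (hα₀ : 1 / 2 ≤ α) (hα₁ : α < 1)
    (hG : IsRadiusMaximal α G) {k a : ℕ} (hk : 1 ≤ k)
    (hm : 2 * (G.edgeSet.ncard : ℝ) =
      k * (Fintype.card V - 1) + k * (Fintype.card V - k) + 2 * a)
    (ha : a + k + 2 ≤ Fintype.card V)
    (hY : 20 * (k : ℝ) ≤ 3 * (Fintype.card V - 1 - k))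
    (hY' : 0 < a → 20 * ((k : ℝ) + 1) ≤ 3 * (Fintype.card V - 2 - k)) :
    ∃ K : Finset V, #K = k ∧ ∀ i ∈ K, ∀ w, w ≠ i → G.Adj i w := by
  obtain ⟨x, hx⟩ := exists_perronPair hα₁ hG.1
  have hα : 0 < α := by linarith
  have hnest : ∀ u v y, x u ≤ x v → G.Adj y u → y ≠ v → G.Adj y v :=
    fun u v y huv hyu hyv => hG.nested hα hα₁ hx huv hyu hyv
  obtain ⟨K, rfl, htop⟩ := exists_top_finset x (show k ≤ Fintype.card V by omega)
  refine ⟨K, rfl, ?_⟩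
  by_contra! hcon
  obtain ⟨i₀, hi₀, w₀, hw₀, hiw₀⟩ := hcon
  have hne : (Kᶜ).Nonempty := by
    rw [← card_pos, card_compl]; omega
  obtain ⟨z, hz, hzmax⟩ := exists_max_image Kᶜ x hne
  rw [mem_compl] at hz
  have := hG.1.nonempty
  have hdom : ∃ o ∈ K, ∀ w, w ≠ o → G.Adj o w := by
    obtain ⟨o, ho⟩ := Finite.exists_max x
    by_cases hoK : o ∈ K
    · exact ⟨o, hoK, fun w hw => hG.dominating hα hα₁ hx ho hw⟩
    · exact ⟨i₀, hi₀, fun w hw =>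
        hG.dominating hα hα₁ hx (fun v => (ho v).trans (htop i₀ hi₀ o hoK)) hw⟩
  -- Without such an edge, `G` would be a proper subgraph of the join of `K` with isolated vertices
  -- and have too few edges. Nestedness then turns the edge into a neighbour of `z` outside `K` and
  -- makes `insert z K` a clique.
  obtain ⟨u, w, hu, hw, huw⟩ : ∃ u w, u ∉ K ∧ w ∉ K ∧ G.Adj u w := by
    by_contra! hno
    have hlt : G < starJoin K z ∅ := by
      refine lt_of_le_of_ne (fun u w huw => ?_) ?_
      · rw [starJoin_adj]
        refine ⟨huw.ne, ?_⟩
        by_contra hcon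
        exact hno u w (by tauto) (by tauto) huw
      · intro heq
        apply hiw₀
        rw [heq]
        exact starJoin_dominating hi₀ hw₀
    have h1 : G.edgeSet.ncard < (starJoin K z ∅).edgeSet.ncard :=
      Set.ncard_lt_ncard (SimpleGraph.edgeSet_strict_mono hlt) (Set.toFinite _)
    have h2 := two_mul_ncard_starJoin (K := K) (z := z) (L := ∅) hz (by simp) (by simp)
    have h3 : (G.edgeSet.ncard : ℝ) < (starJoin K z ∅).edgeSet.ncard := by exact_mod_cast h1
    simp only [card_empty, Nat.cast_zero, mul_zero, add_zero] at h2
    have : (0 : ℝ) ≤ a := Nat.cast_nonneg a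
    linarith
  have hzy : ∃ y, y ∉ K ∧ G.Adj z y := by
    by_cases hwz : w = z
    · subst hwz; exact ⟨u, hu, huw.symm⟩
    · exact ⟨w, hw, (hnest u z w (hzmax u (mem_compl.2 hu)) huw.symm hwz).symm⟩
  have hclique : ∀ i ∈ K, ∀ j ∈ insert z K, j ≠ i → G.Adj i j := by
    intro i hi j hj hji
    rcases mem_insert.1 hj with rfl | hj
    · obtain ⟨y, hy, hjy⟩ := hzy
      exact (hnest y i j (htop i hi y hy) hjy hji).symm
    · have h1 : G.Adj w j := hnest u j w (htop j hj u hu) huw.symm (by rintro rfl; exact hw hj)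
      exact (hnest w i j (htop i hi w hw) h1.symm hji).symm
  have hρ : α * (Fintype.card V - 1) < alphaRadius α G := by
    obtain ⟨o, -, ho⟩ := hdom
    exact lt_of_dominating_perron hα₁ hx (by omega) ho
  have htp : IsTopPart α (alphaRadius α G) G x K z :=
    ⟨hx, hnest, hz, htop, fun v hv => hzmax v (mem_compl.2 hv), hclique, hdom⟩
  have hM : 0 < ∑ i ∈ K, ∑ w ∈ (insert z K)ᶜ, (if G.Adj i w then (0 : ℝ) else 1) := by
    have hw₀' : w₀ ∈ (insert z K)ᶜ := by
      rw [mem_compl]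
      exact fun h => hiw₀ (hclique i₀ hi₀ w₀ h hw₀)
    have hnn : ∀ i w, 0 ≤ (if G.Adj i w then (0 : ℝ) else 1) := fun i w => by
      split_ifs <;> norm_num
    refine Finset.sum_pos' (fun i _ => Finset.sum_nonneg fun w _ => hnn i w) ⟨i₀, hi₀, ?_⟩
    exact Finset.sum_pos' (fun w _ => hnn i₀ w) ⟨w₀, hw₀', by rw [if_neg hiw₀]; norm_num⟩
  have hfin : ∀ L : Finset V, L ⊆ (insert z K)ᶜ → #L = a →
      (starJoin K z L).edgeSet.ncard = G.edgeSet.ncard := by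
    intro L hL hLa
    have h2 := two_mul_ncard_starJoin (K := K) (z := z) (L := L) hz
      (fun h => (mem_compl_insert.1 (hL h)).1 rfl)
      (disjoint_left.2 fun v hv hv' => (mem_compl_insert.1 (hL hv')).2 hv)
    rw [hLa] at h2
    have : ((starJoin K z L).edgeSet.ncard : ℝ) = G.edgeSet.ncard := by linarith
    exact_mod_cast this
  have hmax : ∀ L : Finset V, (starJoin K z L).edgeSet.ncard = G.edgeSet.ncard →
      ¬ alphaRadius α G < alphaRadius α (starJoin K z L) := fun L hL =>
    not_lt.2 (hG.2 _ (starJoin_connected ⟨i₀, hi₀⟩) hL)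
  set N := ((insert z K)ᶜ).filter fun w => G.Adj z w with hN
  -- The leaf set is chosen comparable with the neighbourhood of `z`, so edges at `z` are either
  -- only deleted or only added.
  rcases le_or_gt a #N with haN | haN
  · obtain ⟨L, hLN, hLa⟩ := exists_subset_card_eq haN
    have hLW : L ⊆ (insert z K)ᶜ := hLN.trans (filter_subset _ _)
    refine hmax L (hfin L hLW hLa) (htp.lt_starJoin_of_subset hα₀ hα₁ hρ hM hLW
      (fun w hw => (mem_filter.1 (hLN hw)).2) (hfin L hLW hLa) hY fun h => hY' ?_)
    rw [hLa] at h
    exact_mod_cast h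
  · have hcard : a ≤ #(insert z K)ᶜ := by
      rw [card_compl, card_insert_of_notMem hz]; omega
    obtain ⟨L, hNL, hLW, hLa⟩ := exists_subsuperset_card_eq (filter_subset _ _) haN.le hcard
    refine hmax L (hfin L hLW hLa) (htp.lt_starJoin_of_superset hα₀ hα₁ hρ hM hLW
      (fun w hw hzw => hNL (mem_filter.2 ⟨hw, hzw⟩)) ?_ (hfin L hLW hLa) hY
      (hY' (by omega)) (by omega))
    by_contra! hall
    have : L ⊆ N := fun w hw => mem_filter.2 ⟨hLW hw, hall w hw⟩
    have := card_le_card this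
    omega

end Dominating

/-! ### Degree sums along edges and a two-variable linear system. -/

section EdgeBounds

open scoped Classical
open Finset

variable {V : Type*} [Fintype V] {α : ℝ}

theorem degree_eq_sum (R : SimpleGraph V) (u : V) :
    (R.degree u : ℝ) = ∑ w, if R.Adj u w then (1 : ℝ) else 0 := by
  rw [Finset.sum_boole, ← SimpleGraph.card_neighborFinset_eq_degree,
    SimpleGraph.neighborFinset_eq_filter]

theorem card_incidence_union {R : SimpleGraph V} {u v : V} (huv : R.Adj u v) :
    #(R.incidenceFinset u ∪ R.incidenceFinset v) + 1 = R.degree u + R.degree v := by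
  rw [← SimpleGraph.card_incidenceFinset_eq_degree, ← SimpleGraph.card_incidenceFinset_eq_degree,
    ← card_union_add_card_inter]
  congr 1
  have : R.incidenceFinset u ∩ R.incidenceFinset v = {s(u, v)} := by
    rw [← Finset.coe_inj]
    push_cast
    simpa using R.incidenceSet_inter_incidenceSet_of_adj huv
  rw [this, card_singleton]

theorem incidence_union_subset (R : SimpleGraph V) (u v : V) :
    R.incidenceFinset u ∪ R.incidenceFinset v ⊆ R.edgeFinset :=
  union_subset (R.incidenceFinset_subset u) (R.incidenceFinset_subset v)

theorem ncard_edgeSet_eq_card (R : SimpleGraph V) : R.edgeSet.ncard = #R.edgeFinset := by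
  rw [← SimpleGraph.coe_edgeFinset, Set.ncard_coe_finset]

theorem degree_add_degree_le {R : SimpleGraph V} {u v : V} (huv : R.Adj u v) :
    R.degree u + R.degree v ≤ R.edgeSet.ncard + 1 := by
  rw [← card_incidence_union huv, ncard_edgeSet_eq_card]
  exact Nat.add_le_add_right (card_le_card (incidence_union_subset R u v)) 1

/-- Exactly `deg u + deg v - 1` edges meet `uv`; if this reaches the total, no edge avoids `uv`. -/
theorem meets_of_degree_add_degree {R : SimpleGraph V} {u v : V} (huv : R.Adj u v)
    (h : R.edgeSet.ncard + 1 ≤ R.degree u + R.degree v) {b c : V} (hbc : R.Adj b c) :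
    b = u ∨ b = v ∨ c = u ∨ c = v := by
  rw [← card_incidence_union huv, ncard_edgeSet_eq_card] at h
  have heq := eq_of_subset_of_card_le (incidence_union_subset R u v) (by omega)
  have hmem : s(b, c) ∈ R.edgeFinset := by simpa using hbc
  rw [← heq, mem_union, SimpleGraph.mem_incidenceFinset, SimpleGraph.mem_incidenceFinset] at hmem
  rcases hmem with hm | hm
  · have := hm.2
    rw [Sym2.mem_iff] at this
    tauto
  · have := hm.2
    rw [Sym2.mem_iff] at this
    tauto

theorem alphaOp_eq_add_erase (R : SimpleGraph V) (y : V → ℝ) {u v : V} (huv : R.Adj u v) :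
    alphaOp α R y u = (α * y u + (1 - α) * y v) +
      ∑ w ∈ univ.erase v, if R.Adj u w then α * y u + (1 - α) * y w else 0 := by
  rw [alphaOp, ← Finset.add_sum_erase univ _ (mem_univ v), if_pos huv]

theorem alphaOp_le_of_edge_bound {R : SimpleGraph V} {y : V → ℝ} {C : ℝ}
    (hC : ∀ u v, R.Adj u v → α * y u + (1 - α) * y v ≤ C) {u v : V} (huv : R.Adj u v) :
    alphaOp α R y u ≤ (α * y u + (1 - α) * y v) + (R.degree u - 1) * C := by
  rw [alphaOp_eq_add_erase R y huv]
  have h1 : ∑ w ∈ univ.erase v, (if R.Adj u w then α * y u + (1 - α) * y w else 0) ≤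
      (∑ w ∈ univ.erase v, if R.Adj u w then (1 : ℝ) else 0) * C := by
    rw [Finset.sum_mul]
    refine Finset.sum_le_sum fun w _ => ?_
    split_ifs with h
    · rw [one_mul]; exact hC u w h
    · simp
  have h2 : (R.degree u : ℝ) - 1 = ∑ w ∈ univ.erase v, if R.Adj u w then (1 : ℝ) else 0 := by
    rw [degree_eq_sum, ← Finset.add_sum_erase univ _ (mem_univ v), if_pos huv]
    ring
  rw [h2]
  linarith

theorem le_alphaOp_of_adj (hα₀ : 0 ≤ α) (hα₁ : α ≤ 1) {R : SimpleGraph V} {y : V → ℝ}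
    (hy : ∀ v, 0 ≤ y v) {u v : V} (huv : R.Adj u v) :
    α * y u + (1 - α) * y v ≤ alphaOp α R y u := by
  rw [alphaOp_eq_add_erase R y huv]
  have : 0 ≤ ∑ w ∈ univ.erase v, (if R.Adj u w then α * y u + (1 - α) * y w else 0) :=
    Finset.sum_nonneg fun w _ => by
      split_ifs
      · exact add_nonneg (mul_nonneg hα₀ (hy u)) (mul_nonneg (by linarith) (hy w))
      · exact le_rfl
  linarith

/-- In the total the two ends of an edge exchange their roles, so `α` drops out and only edge sums
matter. -/
theorem two_mul_sum_alphaOp (R : SimpleGraph V) (y : V → ℝ) :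
    2 * ∑ v, alphaOp α R y v = ∑ u, ∑ v, if R.Adj u v then y u + y v else 0 := by
  have h1 : ∑ v, alphaOp α R y v = α * (∑ u, ∑ v, if R.Adj u v then y u else 0) +
      (1 - α) * ∑ u, ∑ v, if R.Adj u v then y v else 0 := by
    simp only [alphaOp, Finset.mul_sum, ← Finset.sum_add_distrib]
    refine Finset.sum_congr rfl fun u _ => Finset.sum_congr rfl fun v _ => ?_
    split_ifs <;> simp
  have h2 : (∑ u, ∑ v, if R.Adj u v then y v else 0) = ∑ u, ∑ v, if R.Adj u v then y u else 0 := by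
    rw [Finset.sum_comm]
    simp only [R.adj_comm]
  have h3 : (∑ u, ∑ v, if R.Adj u v then y u + y v else 0) =
      (∑ u, ∑ v, if R.Adj u v then y u else 0) + ∑ u, ∑ v, if R.Adj u v then y v else 0 := by
    simp only [← Finset.sum_add_distrib]
    refine Finset.sum_congr rfl fun u _ => Finset.sum_congr rfl fun v _ => ?_
    split_ifs <;> simp
  rw [h1, h3, h2]
  ring

/-- A system of two linear inequalities, compared with the corresponding system of equations for a
star with `a` edges. -/
theorem star_system_le {a c κ l l' g h g' h' : ℝ} (ha : 1 ≤ a) (hc : 0 < c) (hκ : 0 ≤ κ)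
    (hl1 : 1 < l') (hlκ : 2 * κ < l') (hll : l' ≤ l)
    (hg' : 0 < g') (hh' : 0 ≤ h')
    (eg : l' * g' = 2 * c + g' + (a - 1) * (g' / 2 + κ * h'))
    (eh : l' * h' = 2 * κ * h' + (a - 1) * (g' / 2 + κ * h'))
    (ig : l * g ≤ 2 * c + g + (a - 1) * (g / 2 + κ * h))
    (ih : l * h ≤ 2 * κ * h + (a - 1) * (g / 2 + κ * h)) :
    g / 2 + κ * h ≤ g' / 2 + κ * h' ∧ g ≤ g' := by
  set B := g / 2 + κ * h with hB
  set B' := g' / 2 + κ * h' with hB'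
  have hB'0 : 0 < B' := by
    have := mul_nonneg hκ hh'
    rw [hB']; linarith
  have p1 : 0 < l' - 1 := by linarith
  have p2 : 0 < l' - 2 * κ := by linarith
  have q1 : 0 < l - 1 := by linarith
  have q2 : 0 < l - 2 * κ := by linarith
  have hBB : B ≤ B' := by
    -- Solving for `g` and `h` bounds `B` by an affine function of `B` with positive constant term
    -- and fixed point `B'`. Such a function divided by its argument decreases, so `B > B' > 0` is
    -- impossible; the products below are this cross-multiplication.
    by_contra hcon
    rw [not_le] at hcon
    have hB0 : 0 < B := by linarith
    have hgle : (l' - 1) * g ≤ 2 * c + (a - 1) * B := by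
      by_cases hg : 0 ≤ g
      · have := mul_le_mul_of_nonneg_right hll hg
        linarith
      · have h1 : (l' - 1) * g ≤ 0 := mul_nonpos_of_nonneg_of_nonpos p1.le (by linarith)
        have h2 : 0 ≤ (a - 1) * B := mul_nonneg (by linarith) hB0.le
        linarith
    have hhle : (l' - 2 * κ) * h ≤ (a - 1) * B := by
      have h2 : 0 ≤ (a - 1) * B := mul_nonneg (by linarith) hB0.le
      by_cases hh : 0 ≤ h
      · have := mul_le_mul_of_nonneg_right hll hh
        linarith
      · have h1 : (l' - 2 * κ) * h ≤ 0 := mul_nonpos_of_nonneg_of_nonpos p2.le (by linarith)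
        linarith
    have eg' : (l' - 1) * g' = 2 * c + (a - 1) * B' := by linarith
    have eh' : (l' - 2 * κ) * h' = (a - 1) * B' := by linarith
    have m1 := mul_le_mul_of_nonneg_left hgle (mul_nonneg p2.le hB'0.le)
    have m2 := mul_le_mul_of_nonneg_left hhle (mul_nonneg (mul_nonneg p1.le hκ) hB'0.le)
    have m3 : 0 < (l' - 2 * κ) * (c * (B - B')) :=
      mul_pos p2 (mul_pos hc (by linarith))
    have n1 : B * ((l' - 2 * κ) * ((l' - 1) * g')) =
      B * ((l' - 2 * κ) * (2 * c + (a - 1) * B')) := by rw [eg']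
    have n2 : B * ((l' - 1) * κ * ((l' - 2 * κ) * h')) =
      B * ((l' - 1) * κ * ((a - 1) * B')) := by rw [eh']
    have n3 : (l' - 1) * (l' - 2 * κ) * (B * B') =
        (l' - 1) * (l' - 2 * κ) * (B * (g' / 2 + κ * h')) := by rw [hB']
    have n4 : (l' - 1) * (l' - 2 * κ) * (B' * B) =
        (l' - 1) * (l' - 2 * κ) * (B' * (g / 2 + κ * h)) := by rw [hB]
    linarith
  refine ⟨hBB, ?_⟩
  have h1 : (l - 1) * g ≤ (l - 1) * g' := by
    have := mul_le_mul_of_nonneg_left hBB (by linarith : 0 ≤ a - 1)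
    have := mul_le_mul_of_nonneg_right hll hg'.le
    linarith
  exact le_of_mul_le_mul_left h1 q1

end EdgeBounds

/-! ### The star is optimal among the edges outside `K`. -/

section StarOptimal

open scoped Classical
open Finset

variable {V : Type*}

/-- The graph on `V` consisting of the edges of `G` with both ends outside `K`. -/
def outsideGraph (G : SimpleGraph V) (K : Finset V) : SimpleGraph V where
  Adj u v := G.Adj u v ∧ u ∉ K ∧ v ∉ K
  symm := ⟨fun _ _ h => ⟨h.1.symm, h.2.2, h.2.1⟩⟩
  loopless := ⟨fun _ h => G.loopless.irrefl _ h.1⟩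

theorem outsideGraph_adj {G : SimpleGraph V} {K : Finset V} {u v : V} :
    (outsideGraph G K).Adj u v ↔ G.Adj u v ∧ u ∉ K ∧ v ∉ K := Iff.rfl

variable [Fintype V] {α : ℝ} {G : SimpleGraph V} {K : Finset V}

theorem alphaOp_outside (hK : ∀ i ∈ K, ∀ w, w ≠ i → G.Adj i w) (x : V → ℝ)
    (hx1 : ∀ i ∈ K, x i = 1) {v : V} (hv : v ∉ K) :
    alphaOp α G x v = α * #K * x v + (1 - α) * #K + alphaOp α (outsideGraph G K) x v := by
  have h1 : alphaOp α G x v = ∑ w, ((if w ∈ K then α * x v + (1 - α) * x w else 0) +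
      if (outsideGraph G K).Adj v w then α * x v + (1 - α) * x w else 0) := by
    refine Finset.sum_congr rfl fun w _ => ?_
    by_cases hw : w ∈ K
    · have : G.Adj v w := (hK w hw v (by rintro rfl; exact hv hw)).symm
      simp [outsideGraph_adj, hw, this]
    · simp [outsideGraph_adj, hw, hv]
  rw [h1, Finset.sum_add_distrib, ← Finset.sum_filter, Finset.filter_mem_eq_inter,
    Finset.univ_inter, Finset.sum_congr rfl fun w hw => by rw [hx1 w hw]]
  simp only [sum_const, nsmul_eq_mul, alphaOp]
  ring

theorem alphaOp_outside_of_mem (x : V → ℝ) {v : V} (hv : v ∈ K) :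
    alphaOp α (outsideGraph G K) x v = 0 := by
  refine Finset.sum_eq_zero fun w _ => ?_
  rw [if_neg]
  exact fun h => h.2.1 hv

theorem two_mul_ncard_outsideGraph (hK : ∀ i ∈ K, ∀ w, w ≠ i → G.Adj i w) :
    2 * (G.edgeSet.ncard : ℝ) = #K * (Fintype.card V - 1) + #K * (Fintype.card V - #K) +
      2 * (outsideGraph G K).edgeSet.ncard := by
  have hdeg : ∀ v, ∑ w, (if G.Adj v w then (1 : ℝ) else 0) = alphaOp 1 G (fun _ => 1) v :=
    fun v => by simp [alphaOp]
  have hdeg' : ∀ v, ∑ w, (if (outsideGraph G K).Adj v w then (1 : ℝ) else 0) =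
      alphaOp 1 (outsideGraph G K) (fun _ => 1) v := fun v => by simp [alphaOp]
  rw [← sum_adj_eq_two_mul_ncard, ← sum_adj_eq_two_mul_ncard, ← Finset.sum_add_sum_compl K,
    ← Finset.sum_add_sum_compl K (fun v => ∑ w, if (outsideGraph G K).Adj v w then (1 : ℝ) else 0)]
  simp only [hdeg, hdeg']
  rw [Finset.sum_congr rfl fun v hv => alphaOp_of_dominating 1 (fun _ => 1) (hK v hv),
    Finset.sum_congr (s₁ := Kᶜ) rfl fun v hv =>
      alphaOp_outside (α := 1) hK (fun _ => 1) (fun _ _ => rfl) (mem_compl.1 hv),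
    Finset.sum_congr (s₁ := K) rfl fun v hv =>
      alphaOp_outside_of_mem (α := 1) (G := G) (fun _ => (1 : ℝ)) hv]
  simp only [sum_const, nsmul_eq_mul, Finset.sum_add_distrib, card_univ]
  rw [card_compl, Nat.cast_sub (card_le_univ K)]
  ring

/-- Among graphs with a given set `K` of dominating vertices and at least one, but not too many,
further edges, no graph has larger spectral radius than the star join; for graphs with the same
spectral radius the further edges pairwise meet. -/
theorem star_optimal {L : Finset V} {z : V} (hα₀ : 1 / 2 ≤ α) (hα₁ : α < 1)
    (hKne : K.Nonempty) (hK : ∀ i ∈ K, ∀ w, w ≠ i → G.Adj i w)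
    (hzK : z ∉ K) (hzL : z ∉ L) (hKL : Disjoint K L) (hL : L.Nonempty)
    (hR : (outsideGraph G K).edgeSet.ncard = #L)
    (hY : 20 * (#K : ℝ) ≤ 3 * (Fintype.card V - 1 - #K))
    (hle : alphaRadius α (starJoin K z L) ≤ alphaRadius α G) :
    (∀ u v b c, (outsideGraph G K).Adj u v → (outsideGraph G K).Adj b c →
      b = u ∨ b = v ∨ c = u ∨ c = v) ∧
    ∃ (y : V → ℝ) (g : ℝ), (∀ u v, (outsideGraph G K).Adj u v → y u + y v = g) ∧
      (1 / 2 < α → 2 ≤ #L → ∃ u v, (outsideGraph G K).Adj u v ∧ y u ≠ y v) := by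
  set R := outsideGraph G K with hRdef
  have hk1 : (1 : ℝ) ≤ #K := by exact_mod_cast hKne.card_pos
  have ha1 : (1 : ℝ) ≤ #L := by exact_mod_cast hL.card_pos
  have hn : #K + 2 ≤ Fintype.card V := by
    have : (#K : ℝ) + 2 ≤ Fintype.card V := by linarith
    exact_mod_cast this
  obtain ⟨X, ζ, t, η, hX, -, -, -, -, hζ, ht, hη, e₁, e₂, e₃, e₄, hρ'⟩ :=
    exists_perron_starJoin (by linarith) hα₁ hKne hzK hzL hKL hn
  have hcard := card_starJoin_parts hzK hzL hKL
  obtain ⟨y, hy, hy1, hysum⟩ := exists_scaled_perron hα₁ hKne hK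
  set ρ := alphaRadius α G
  set ρ' := alphaRadius α (starJoin K z L)
  set δ := #(K ∪ insert z L)ᶜ
  set l := ρ - α * #K with hl
  set l' := ρ' - α * #K with hl'
  set c := (1 - α) * #K with hc
  set κ := α - 1 / 2 with hκ
  have hlbig : α * ((Fintype.card V : ℝ) - 1 - #K) < l' := by linarith
  have hl1 : 1 < l' := by
    have : 1 / 2 * ((Fintype.card V : ℝ) - 1 - #K) ≤ α * ((Fintype.card V : ℝ) - 1 - #K) :=
      mul_le_mul_of_nonneg_right hα₀ (by linarith)
    linarith
  have hll : l' ≤ l := by linarith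
  have hRy : ∀ v, v ∉ K → alphaOp α R y v = l * y v - c := by
    intro v hv
    have h1 := hy.2 v
    rw [alphaOp_outside hK y hy1 hv] at h1
    linarith
  -- the system of equations for the star
  have hζt : (#L - 1) * t = (l' - α * #L + (1 - α)) * (ζ - t) := by
    rw [hl']; linear_combination e₃ - e₂
  have hh' : 0 ≤ ζ - t := by
    have hpos : 0 < l' - α * #L + (1 - α) := by
      have : α * #L ≤ α * ((Fintype.card V : ℝ) - 1 - #K) := by
        refine mul_le_mul_of_nonneg_left ?_ (by linarith)
        have : (0 : ℝ) ≤ δ := Nat.cast_nonneg _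
        linarith
      linarith
    have : 0 ≤ (#L - 1) * t := mul_nonneg (by linarith) ht.le
    rw [hζt] at this
    exact nonneg_of_mul_nonneg_right this hpos
  have eg : l' * (ζ + t) = 2 * c + (ζ + t) + (#L - 1) * ((ζ + t) / 2 + κ * (ζ - t)) := by
    rw [hl', hc, hκ]; linear_combination e₂ + e₃
  have eh : l' * (ζ - t) = 2 * κ * (ζ - t) + (#L - 1) * ((ζ + t) / 2 + κ * (ζ - t)) := by
    rw [hl', hκ]; linear_combination e₂ - e₃
  -- the system of inequalities for `G`
  obtain ⟨u₀, v₀, huv₀⟩ : ∃ u v, R.Adj u v := by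
    by_contra! hcon
    have : R.edgeSet = ∅ := by
      rw [SimpleGraph.edgeSet_eq_empty]
      ext u v
      simp [hcon u v]
    rw [this, Set.ncard_empty] at hR
    exact hL.card_pos.ne hR
  have hPne : ((univ : Finset (V × V)).filter fun p => R.Adj p.1 p.2).Nonempty :=
    ⟨(u₀, v₀), by simpa using huv₀⟩
  obtain ⟨⟨u₁, v₁⟩, huv₁, hgmax⟩ := exists_max_image _ (fun p : V × V => y p.1 + y p.2) hPne
  obtain ⟨⟨u₂, v₂⟩, huv₂, hhmax⟩ := exists_max_image _ (fun p : V × V => y p.1 - y p.2) hPne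
  simp only [mem_filter, mem_univ, true_and, Prod.forall] at huv₁ hgmax huv₂ hhmax
  set g := y u₁ + y v₁ with hg
  set h := y u₂ - y v₂ with hh
  set C := g / 2 + κ * h with hC
  -- An edge contribution is half the sum of its end entries plus `κ` times their difference, so the
  -- maximal sum and difference bound all of them.
  have hCb : ∀ u v, R.Adj u v → α * y u + (1 - α) * y v ≤ C := by
    intro u v huv
    have h1 := hgmax u v huv
    have h2 := mul_le_mul_of_nonneg_left (hhmax u v huv) (by linarith : 0 ≤ κ)
    rw [hκ] at h2
    rw [hC, hκ]
    linarith
  have hC0 : 0 < C := lt_of_lt_of_le (add_pos (mul_pos (by linarith) (hy.1 u₀))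
    (mul_pos (by linarith) (hy.1 v₀))) (hCb u₀ v₀ huv₀)
  have hdeg : ∀ u v, R.Adj u v → (R.degree u : ℝ) + R.degree v ≤ #L + 1 := by
    intro u v huv
    rw [← hR]
    exact_mod_cast degree_add_degree_le huv
  have hedge : ∀ u v, R.Adj u v →
      l * (y u + y v) ≤ 2 * c + (y u + y v) + (R.degree u + R.degree v - 2) * C := by
    intro u v huv
    have h1 := alphaOp_le_of_edge_bound hCb huv
    have h2 := alphaOp_le_of_edge_bound hCb huv.symm
    rw [hRy u huv.2.1] at h1
    rw [hRy v huv.2.2] at h2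
    linarith
  have ig : l * g ≤ 2 * c + g + (#L - 1) * C := by
    have := mul_le_mul_of_nonneg_right (hdeg u₁ v₁ huv₁) hC0.le
    have := hedge u₁ v₁ huv₁
    linarith
  have ih : l * h ≤ 2 * κ * h + (#L - 1) * C := by
    have h1 := alphaOp_le_of_edge_bound hCb huv₂
    have h2 := le_alphaOp_of_adj (by linarith) hα₁.le (fun v => (hy.1 v).le) huv₂.symm
    rw [hRy u₂ huv₂.2.1] at h1
    rw [hRy v₂ huv₂.2.2] at h2
    have h3 : (1 : ℝ) ≤ R.degree v₂ := by
      have : 0 < R.degree v₂ := by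
        rw [SimpleGraph.degree_pos_iff_exists_adj]; exact ⟨u₂, huv₂.symm⟩
      exact_mod_cast this
    have h4 : ((R.degree u₂ : ℝ) - 1) * C ≤ (#L - 1) * C :=
      mul_le_mul_of_nonneg_right (by linarith [hdeg u₂ v₂ huv₂]) hC0.le
    rw [hκ, hh]
    linarith
  have hc0 : 0 < c := mul_pos (by linarith) (by linarith)
  obtain ⟨hCC, hgg⟩ := star_system_le ha1 hc0 (by linarith) hl1 (by linarith) hll
    (add_pos hζ ht) hh' eg eh ig ih
  -- comparison of the sums
  have hsumR : ∑ v, alphaOp α R y v = l * ∑ v ∈ Kᶜ, y v - c * (Fintype.card V - #K) := by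
    rw [← Finset.sum_add_sum_compl K, Finset.sum_congr rfl fun v hv =>
      alphaOp_outside_of_mem (α := α) (G := G) y hv,
      Finset.sum_congr (s₁ := Kᶜ) rfl fun v hv => hRy v (mem_compl.1 hv),
      Finset.sum_sub_distrib, ← Finset.mul_sum]
    simp only [sum_const_zero, zero_add, sum_const, nsmul_eq_mul]
    rw [card_compl, Nat.cast_sub (card_le_univ K)]
    ring
  have htwo := two_mul_sum_alphaOp (α := α) R y
  have hedges : (∑ u, ∑ v, if R.Adj u v then (1 : ℝ) else 0) = 2 * #L := by
    rw [sum_adj_eq_two_mul_ncard, hR]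
  have hsumle : ∑ u, ∑ v, (if R.Adj u v then y u + y v else 0) ≤ 2 * #L * (ζ + t) := by
    rw [← hedges, Finset.sum_mul]
    refine Finset.sum_le_sum fun u _ => ?_
    rw [Finset.sum_mul]
    refine Finset.sum_le_sum fun v _ => ?_
    split_ifs with huv
    · rw [one_mul]; exact (hgmax u v huv).trans hgg
    · simp
  have hSy : ∑ v, y v = #K + ∑ v ∈ Kᶜ, y v := by
    rw [← Finset.sum_add_sum_compl K, Finset.sum_congr rfl hy1]; simp
  rw [hSy] at hysum
  set S₁ := ∑ v ∈ Kᶜ, y v with hS₁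
  have hS₁0 : 0 ≤ S₁ := Finset.sum_nonneg fun v _ => (hy.1 v).le
  set S₂ := ζ + #L * t + δ * η with hS₂
  have hstar : l' * S₂ = c * (Fintype.card V - #K) + #L * (ζ + t) := by
    rw [hcard, hl', hc, hS₂]
    linear_combination e₂ + (#L : ℝ) * e₃ + (δ : ℝ) * e₄
  have hSle : l' * S₁ ≤ l' * S₂ := by
    have := mul_le_mul_of_nonneg_right hll hS₁0
    linarith
  -- The edge sums give `S₁ ≤ S₂`, while `ρ' ≤ ρ` and the affine relation between radius and total
  -- weight give the converse. Equality then propagates to the radii and to every edge sum.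
  have hS12 : S₁ ≤ S₂ := le_of_mul_le_mul_left hSle (by linarith)
  have hSeq : S₁ = S₂ := by
    refine le_antisymm hS12 ?_
    have h1 : (1 - α) * S₂ ≤ (1 - α) * S₁ := by rw [hS₂]; linarith
    exact le_of_mul_le_mul_left h1 (by linarith)
  have hρeq : l = l' := by
    have : (1 - α) * S₁ = (1 - α) * S₂ := by rw [hSeq]
    rw [hS₂] at this
    linarith
  have hsumeq : ∑ u, ∑ v, (if R.Adj u v then (ζ + t) - (y u + y v) else 0) = 0 := by
    have h1 : ∑ u, ∑ v, (if R.Adj u v then (ζ + t) - (y u + y v) else 0) =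
        (∑ u, ∑ v, if R.Adj u v then (1 : ℝ) else 0) * (ζ + t) -
          ∑ u, ∑ v, (if R.Adj u v then y u + y v else 0) := by
      rw [Finset.sum_mul, ← Finset.sum_sub_distrib]
      refine Finset.sum_congr rfl fun u _ => ?_
      rw [Finset.sum_mul, ← Finset.sum_sub_distrib]
      refine Finset.sum_congr rfl fun v _ => ?_
      split_ifs <;> simp
    rw [h1, hedges, ← htwo, hsumR, hρeq, hSeq, hstar]
    ring
  have hedgeeq : ∀ u v, R.Adj u v → y u + y v = ζ + t := by
    have hnn : ∀ u v, 0 ≤ (if R.Adj u v then (ζ + t) - (y u + y v) else 0) := fun u v => by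
      split_ifs with huv
      · have := (hgmax u v huv).trans hgg
        linarith
      · exact le_rfl
    intro u v huv
    have h1 := (Finset.sum_eq_zero_iff_of_nonneg fun u _ =>
      Finset.sum_nonneg fun v _ => hnn u v).1 hsumeq u (mem_univ u)
    have h2 := (Finset.sum_eq_zero_iff_of_nonneg fun v _ => hnn u v).1 h1 v (mem_univ v)
    rw [if_pos huv] at h2
    linarith
  have hC'0 : 0 < (ζ + t) / 2 + κ * (ζ - t) := lt_of_lt_of_le hC0 hCC
  -- With equal radii the edge inequality reads this way, and `C ≤ C'` forces the degree sum up to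
  -- `#L + 1`, so that every edge meets `uv`.
  have hdegC : ∀ u v, R.Adj u v →
      (#L - 1) * ((ζ + t) / 2 + κ * (ζ - t)) ≤ (R.degree u + R.degree v - 2) * C := by
    intro u v huv
    have := hedge u v huv
    rw [hedgeeq u v huv, hρeq, eg] at this
    linarith
  have hdeg2 : ∀ u v, R.Adj u v → (2 : ℝ) ≤ R.degree u + R.degree v := by
    intro u v huv
    have h3 : 0 < R.degree v := by
      rw [SimpleGraph.degree_pos_iff_exists_adj]; exact ⟨u, huv.symm⟩
    have h4 : 0 < R.degree u := by
      rw [SimpleGraph.degree_pos_iff_exists_adj]; exact ⟨v, huv⟩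
    exact_mod_cast (show 2 ≤ R.degree u + R.degree v by omega)
  refine ⟨fun u v b d huv hbd => meets_of_degree_add_degree huv ?_ hbd, y, ζ + t, hedgeeq,
    fun hα ha2 => ⟨u₂, v₂, huv₂, fun heq => ?_⟩⟩
  · have h1 := hdegC u v huv
    have h2 := mul_le_mul_of_nonneg_left hCC (by linarith [hdeg2 u v huv] :
      (0 : ℝ) ≤ R.degree u + R.degree v - 2)
    have h3 := le_of_mul_le_mul_right (h1.trans h2) hC'0
    rw [hR]
    have h4 : (#L : ℝ) + 1 ≤ R.degree u + R.degree v := by linarith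
    exact_mod_cast h4
  -- If the maximal difference `h` vanished, `C` would be half an edge sum, whereas the star has `κ
  -- > 0` and `ζ > t`, hence a strictly larger value.
  · have ha2' : (2 : ℝ) ≤ #L := by exact_mod_cast ha2
    have h1 := hdegC u₁ v₁ huv₁
    have h2 := mul_le_mul_of_nonneg_right (hdeg u₁ v₁ huv₁) hC0.le
    have h3 : (#L - 1) * ((ζ + t) / 2 + κ * (ζ - t)) ≤ (#L - 1) * C := by linarith
    have h4 := le_of_mul_le_mul_left h3 (by linarith)
    have h5 : h = 0 := by rw [hh, heq, sub_self]
    rw [hC, h5, mul_zero, add_zero] at h4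
    have h6 : 0 < l' * (ζ - t) - 2 * κ * (ζ - t) := by
      rw [eh]
      have := mul_pos (by linarith : (0 : ℝ) < #L - 1) hC'0
      linarith
    have h7 : 0 < ζ - t := by
      rcases hh'.eq_or_lt with h0 | h0
      · rw [← h0] at h6; simp at h6
      · exact h0
    have h8 := mul_pos (by linarith : 0 < κ) h7
    linarith

end StarOptimal

/-! ### Star or triangle, the tie at `α = 1/2`, and isomorphisms. -/

section Classification

open scoped Classical
open Finset

variable {V W : Type*}

/-- The graph in which the vertices of `K` are adjacent to all other vertices, and the vertices of
`T` are moreover pairwise adjacent. -/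
def cliqueJoin (K T : Finset V) : SimpleGraph V where
  Adj v w := v ≠ w ∧ (v ∈ K ∨ w ∈ K ∨ (v ∈ T ∧ w ∈ T))
  symm := ⟨fun v w h => ⟨h.1.symm, by tauto⟩⟩
  loopless := ⟨fun v h => h.1 rfl⟩

theorem cliqueJoin_adj {K T : Finset V} {v w : V} :
    (cliqueJoin K T).Adj v w ↔ v ≠ w ∧ (v ∈ K ∨ w ∈ K ∨ (v ∈ T ∧ w ∈ T)) := Iff.rfl

theorem cliqueJoin_dominating {K T : Finset V} {v w : V} (hv : v ∈ K) (hw : w ≠ v) :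
    (cliqueJoin K T).Adj v w :=
  ⟨hw.symm, Or.inl hv⟩

/-- Pairwise meeting edges form a star or a triangle. -/
theorem star_or_triangle {R : SimpleGraph V}
    (h : ∀ u v b c, R.Adj u v → R.Adj b c → b = u ∨ b = v ∨ c = u ∨ c = v)
    (hne : ∃ u v, R.Adj u v) :
    (∃ z, ∀ b c, R.Adj b c → b = z ∨ c = z) ∨
      ∃ u v w, R.Adj u v ∧ R.Adj v w ∧ R.Adj u w ∧
        ∀ b c, R.Adj b c → (b = u ∨ b = v ∨ b = w) ∧ (c = u ∨ c = v ∨ c = w) := by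
  obtain ⟨u, v, huv⟩ := hne
  by_cases h1 : ∀ b c, R.Adj b c → b = u ∨ c = u
  · exact Or.inl ⟨u, h1⟩
  by_cases h2 : ∀ b c, R.Adj b c → b = v ∨ c = v
  · exact Or.inl ⟨v, h2⟩
  right
  push Not at h1 h2
  have key1 : ∃ w, R.Adj v w ∧ w ≠ u := by
    obtain ⟨b, c, hbc, hb, hc⟩ := h1
    rcases h u v b c huv hbc with e | e | e | e
    · exact absurd e hb
    · subst e; exact ⟨c, hbc, hc⟩
    · exact absurd e hc
    · subst e; exact ⟨b, hbc.symm, hb⟩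
  have key2 : ∃ w, R.Adj u w ∧ w ≠ v := by
    obtain ⟨b, c, hbc, hb, hc⟩ := h2
    rcases h u v b c huv hbc with e | e | e | e
    · subst e; exact ⟨c, hbc, hc⟩
    · exact absurd e hb
    · subst e; exact ⟨b, hbc.symm, hb⟩
    · exact absurd e hc
  obtain ⟨w, hvw, hwu⟩ := key1
  obtain ⟨w', huw', hwv'⟩ := key2
  have hww : w' = w := by
    rcases h v w u w' hvw huw' with e | e | e | e
    · exact absurd e huv.ne
    · exact absurd e.symm hwu
    · exact absurd e hwv'
    · exact e
  subst hww
  refine ⟨u, v, w', huv, hvw, huw', fun b c hbc => ?_⟩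
  have e1 := h u v b c huv hbc
  have e2 := h v w' b c hvw hbc
  have e3 := h u w' b c huw' hbc
  have n1 := huv.ne
  have n2 := hvw.ne
  have n3 := huw'.ne
  have n4 := hbc.ne
  grind

theorem ncard_edgeSet_triangle {R : SimpleGraph V} {u v w : V} (huv : R.Adj u v) (hvw : R.Adj v w)
    (huw : R.Adj u w)
    (h : ∀ b c, R.Adj b c → (b = u ∨ b = v ∨ b = w) ∧ (c = u ∨ c = v ∨ c = w)) :
    R.edgeSet.ncard = 3 := by
  rw [Set.ncard_eq_three]
  refine ⟨s(u, v), s(v, w), s(u, w), ?_, ?_, ?_, ?_⟩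
  · rw [Ne, Sym2.eq_iff]
    rintro (⟨h1, -⟩ | ⟨h1, -⟩)
    exacts [huv.ne h1, huw.ne h1]
  · rw [Ne, Sym2.eq_iff]
    rintro (⟨-, h1⟩ | ⟨h1, -⟩)
    exacts [hvw.ne h1, huw.ne h1]
  · rw [Ne, Sym2.eq_iff]
    rintro (⟨h1, -⟩ | ⟨-, h1⟩)
    exacts [huv.ne h1.symm, huw.ne h1.symm]
  · ext e
    induction e with
    | _ b c =>
      simp only [SimpleGraph.mem_edgeSet, Set.mem_insert_iff, Set.mem_singleton_iff]
      constructor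
      · intro hbc
        obtain ⟨h1, h2⟩ := h b c hbc
        rcases h1 with rfl | rfl | rfl <;> rcases h2 with rfl | rfl | rfl
        · exact (hbc.ne rfl).elim
        · exact Or.inl rfl
        · exact Or.inr (Or.inr rfl)
        · exact Or.inl Sym2.eq_swap
        · exact (hbc.ne rfl).elim
        · exact Or.inr (Or.inl rfl)
        · exact Or.inr (Or.inr Sym2.eq_swap)
        · exact Or.inr (Or.inl Sym2.eq_swap)
        · exact (hbc.ne rfl).elim
      · rintro (h1 | h1 | h1)
        all_goals
          rw [← SimpleGraph.mem_edgeSet, h1]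
          assumption

section

variable [Fintype V] {K L T : Finset V} {z : V}

theorem alphaOp_cliqueJoin_clique (hKT : Disjoint K T) (α : ℝ) (x : V → ℝ) {v : V} (hv : v ∈ T) :
    alphaOp α (cliqueJoin K T) x v =
      α * (#K + #T - 1) * x v + (1 - α) * (∑ w ∈ K, x w + ∑ w ∈ T.erase v, x w) := by
  have hdis : Disjoint K (T.erase v) := hKT.mono_right (erase_subset v T)
  rw [alphaOp_eq_sum_of_adj_iff (N := K ∪ T.erase v), card_union_of_disjoint hdis, sum_union hdis,
    card_erase_of_mem hv, Nat.cast_add, Nat.cast_sub (card_pos.2 ⟨v, hv⟩)]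
  · push_cast; ring
  · intro w
    rw [cliqueJoin_adj, mem_union, mem_erase]
    have hvK : v ∉ K := fun h => disjoint_left.1 hKT h hv
    constructor
    · rintro ⟨h1, h2⟩
      have := h1.symm
      tauto
    · rintro (h1 | h1)
      · exact ⟨by rintro rfl; exact hvK h1, by tauto⟩
      · exact ⟨h1.1.symm, by tauto⟩

theorem alphaOp_cliqueJoin_other (α : ℝ) (x : V → ℝ) {v : V} (hvK : v ∉ K) (hvT : v ∉ T) :
    alphaOp α (cliqueJoin K T) x v = α * #K * x v + (1 - α) * ∑ w ∈ K, x w := by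
  rw [alphaOp_eq_sum_of_adj_iff (N := K)]
  intro w
  rw [cliqueJoin_adj]
  constructor
  · tauto
  · intro h
    exact ⟨by rintro rfl; exact hvK h, by tauto⟩

/-- The Perron vector of the star join is redistributed: `(ζ + t) / 2` on the triangle and `η` on
all other vertices outside `K`. For `α = 1/2` and three leaves, `η = (3 t - ζ) / 2`, so the total
weight is unchanged and the same `ρ` remains an eigenvalue with a positive eigenvector. -/
theorem alphaRadius_cliqueJoin_triangle (hK : K.Nonempty) (hzK : z ∉ K) (hzL : z ∉ L)
    (hKL : Disjoint K L) (hKT : Disjoint K T) (hL : #L = 3) (hT : #T = 3) :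
    alphaRadius (1 / 2) (cliqueJoin K T) = alphaRadius (1 / 2) (starJoin K z L) := by
  have hcard := card_starJoin_parts hzK hzL hKL
  have hn : #K + 2 ≤ Fintype.card V := by
    have : (#K : ℝ) + 2 ≤ Fintype.card V := by
      rw [hcard, hL]
      have : (0 : ℝ) ≤ #(K ∪ insert z L)ᶜ := Nat.cast_nonneg _
      push_cast
      linarith
    exact_mod_cast this
  obtain ⟨X, ζ, t, η, -, -, -, -, -, hζ, ht, hη, e₁, e₂, e₃, e₄, hρ⟩ :=
    exists_perron_starJoin (α := 1 / 2) (by norm_num) (by norm_num) hK hzK hzL hKL hn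
  set ρ := alphaRadius (1 / 2) (starJoin K z L)
  set δ := #(K ∪ insert z L)ᶜ
  rw [hL] at e₁ e₂ hcard
  push_cast at e₁ e₂ hcard
  have hηt : η = 3 / 2 * t - 1 / 2 * ζ := by
    have hpos : (ρ - 1 / 2 * #K) ≠ 0 := by
      have : (#K : ℝ) + 2 ≤ Fintype.card V := by exact_mod_cast hn
      have : 0 < ρ - 1 / 2 * #K := by linarith
      exact this.ne'
    refine mul_left_cancel₀ hpos ?_
    linear_combination e₄ - 3 / 2 * e₃ + 1 / 2 * e₂
  refine (IsPerronPair.eq_alphaRadius (α := 1 / 2) (by norm_num) (G := cliqueJoin K T) (ρ := ρ)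
    (x := fun v => if v ∈ K then 1 else if v ∈ T then (ζ + t) / 2 else η) ?_ ⟨fun v => ?_,
    fun v => ?_⟩).symm
  · obtain ⟨o, ho⟩ := hK
    exact connected_of_dominating (o := o) fun w hw => cliqueJoin_dominating ho hw
  · beta_reduce
    split_ifs
    exacts [one_pos, by positivity, hη]
  · have hsK : ∑ w ∈ K, (if w ∈ K then (1 : ℝ) else if w ∈ T then (ζ + t) / 2 else η) = #K := by
      rw [Finset.sum_congr rfl fun w hw => if_pos hw]; simp
    have hT' : ∀ w ∈ T, (if w ∈ K then (1 : ℝ) else if w ∈ T then (ζ + t) / 2 else η) =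
        (ζ + t) / 2 := fun w hw => by
      rw [if_neg fun h => disjoint_left.1 hKT h hw, if_pos hw]
    beta_reduce
    by_cases hvK : v ∈ K
    · have hsum : ∑ w, (if w ∈ K then (1 : ℝ) else if w ∈ T then (ζ + t) / 2 else η) =
          #K + 3 * ((ζ + t) / 2) + (Fintype.card V - #K - 3) * η := by
        rw [← Finset.sum_add_sum_compl (K ∪ T), sum_union hKT, hsK, Finset.sum_congr rfl hT',
          Finset.sum_congr (s₁ := (K ∪ T)ᶜ) (g := fun _ => η) rfl fun w hw => by
            rw [mem_compl, mem_union, not_or] at hw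
            rw [if_neg hw.1, if_neg hw.2]]
        simp only [sum_const, nsmul_eq_mul]
        rw [card_compl, Nat.cast_sub (card_le_univ _), card_union_of_disjoint hKT, hT]
        push_cast
        ring
      rw [alphaOp_of_dominating _ _ fun w hw => cliqueJoin_dominating hvK hw, hsum, if_pos hvK,
        hcard]
      rw [hcard] at e₁
      linear_combination -e₁ + 1 / 2 * hηt
    · by_cases hvT : v ∈ T
      · rw [alphaOp_cliqueJoin_clique hKT _ _ hvT, hsK,
          Finset.sum_congr rfl fun w hw => hT' w (mem_of_mem_erase hw), hT' v hvT]
        simp only [sum_const, nsmul_eq_mul]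
        rw [card_erase_of_mem hvT, hT]
        push_cast
        linear_combination -1 / 2 * (e₂ + e₃)
      · rw [alphaOp_cliqueJoin_other _ _ hvK hvT, hsK, if_neg hvK, if_neg hvT]
        linear_combination -e₄

/-- The maximal graphs with a given number of edges are star joins, except for `α = 1/2` and three
surplus edges, where a triangle may replace the star. -/
theorem IsRadiusMaximal.eq_starJoin_or_cliqueJoin {α : ℝ} {G : SimpleGraph V} (hα₀ : 1 / 2 ≤ α)
    (hα₁ : α < 1) (hG : IsRadiusMaximal α G) {k a : ℕ} (hk : 1 ≤ k)
    (hm : 2 * (G.edgeSet.ncard : ℝ) =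
      k * (Fintype.card V - 1) + k * (Fintype.card V - k) + 2 * a)
    (ha : a + k + 2 ≤ Fintype.card V)
    (hY : 20 * (k : ℝ) ≤ 3 * (Fintype.card V - 1 - k))
    (hY' : 0 < a → 20 * ((k : ℝ) + 1) ≤ 3 * (Fintype.card V - 2 - k)) :
    (∃ (K L : Finset V) (z : V), #K = k ∧ #L = a ∧ z ∉ K ∧ z ∉ L ∧ Disjoint K L ∧
      G = starJoin K z L) ∨
    (α = 1 / 2 ∧ a = 3 ∧ ∃ K T : Finset V, #K = k ∧ #T = 3 ∧ Disjoint K T ∧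
      G = cliqueJoin K T) := by
  obtain ⟨K, rfl, hdom⟩ := hG.exists_dominating_finset hα₀ hα₁ hk hm ha hY hY'
  have hKne : K.Nonempty := card_pos.1 hk
  set R := outsideGraph G K with hR
  have hcount : R.edgeSet.ncard = a := by
    have := two_mul_ncard_outsideGraph hdom
    rw [hm] at this
    have : ((outsideGraph G K).edgeSet.ncard : ℝ) = a := by linarith
    exact_mod_cast this
  have hadj : ∀ u v, G.Adj u v ↔ u ≠ v ∧ (u ∈ K ∨ v ∈ K ∨ R.Adj u v) := by
    intro u v
    rw [hR, outsideGraph_adj]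
    constructor
    · intro h
      refine ⟨h.ne, ?_⟩
      tauto
    · rintro ⟨h1, h2 | h2 | h2⟩
      · exact hdom u h2 v h1.symm
      · exact (hdom v h2 u h1).symm
      · exact h2.1
  have hstar : ∀ z, z ∉ K → (∀ b c, R.Adj b c → b = z ∨ c = z) →
      ∃ (K' L : Finset V) (z : V), #K' = #K ∧ #L = a ∧ z ∉ K' ∧ z ∉ L ∧ Disjoint K' L ∧
      G = starJoin K' z L := by
    intro z hzK hz
    set L := univ.filter fun w => R.Adj z w with hL
    have hzL : z ∉ L := by simp [hL]
    have hKL : Disjoint K L := disjoint_right.2 fun v hv => (mem_filter.1 hv).2.2.2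
    have hGeq : G = starJoin K z L := by
      ext u v
      rw [hadj, starJoin_adj]
      simp only [hL, mem_filter, mem_univ, true_and]
      constructor
      · rintro ⟨h1, h2 | h2 | h2⟩
        · tauto
        · tauto
        · rcases hz u v h2 with rfl | rfl
          · tauto
          · have := h2.symm
            tauto
      · rintro ⟨h1, h2 | h2 | ⟨rfl, h2⟩ | ⟨rfl, h2⟩⟩
        · tauto
        · tauto
        · tauto
        · have := h2.symm
          tauto
    refine ⟨K, L, z, rfl, ?_, hzK, hzL, hKL, hGeq⟩
    have h1 := two_mul_ncard_starJoin hzK hzL hKL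
    rw [← hGeq, hm] at h1
    have : (#L : ℝ) = a := by linarith
    exact_mod_cast this
  obtain ⟨z₀, hz₀⟩ : (Kᶜ).Nonempty := by
    rw [← card_pos, card_compl]; omega
  rw [mem_compl] at hz₀
  -- With no surplus edges any vertex outside `K` serves as the centre of an empty star.
  rcases Nat.eq_zero_or_pos a with ha0 | ha0
  · refine Or.inl (hstar z₀ hz₀ fun b c hbc => ?_)
    rw [ha0, Set.ncard_eq_zero (Set.toFinite _), SimpleGraph.edgeSet_eq_empty] at hcount
    rw [hcount] at hbc
    exact hbc.elim
  · obtain ⟨L, hLsub, hLa⟩ := exists_subset_card_eq (s := (insert z₀ K)ᶜ) (n := a) (by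
      rw [card_compl, card_insert_of_notMem hz₀]; omega)
    have hz₀L : z₀ ∉ L := fun h => (mem_compl_insert.1 (hLsub h)).1 rfl
    have hKL : Disjoint K L := disjoint_left.2 fun v hv hv' => (mem_compl_insert.1 (hLsub hv')).2 hv
    have hle : alphaRadius α (starJoin K z₀ L) ≤ alphaRadius α G := by
      refine hG.2 _ (starJoin_connected hKne) ?_
      have h1 := two_mul_ncard_starJoin hz₀ hz₀L hKL
      rw [hLa] at h1
      have : ((starJoin K z₀ L).edgeSet.ncard : ℝ) = G.edgeSet.ncard := by linarith
      exact_mod_cast this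
    obtain ⟨hmeet, y, g, hyg, hyne⟩ := star_optimal hα₀ hα₁ hKne hdom hz₀ hz₀L hKL
      (card_pos.1 (by omega)) (hcount.trans hLa.symm) hY hle
    have hne : ∃ u v, R.Adj u v := by
      by_contra! hcon
      have : R.edgeSet = ∅ := by
        rw [SimpleGraph.edgeSet_eq_empty]
        ext u v
        simp [hcon u v]
      rw [this, Set.ncard_empty] at hcount
      omega
    rcases star_or_triangle hmeet hne with ⟨z, hz⟩ | ⟨u, v, w, huv, hvw, huw, htri⟩
    · refine Or.inl (hstar z ?_ hz)
      obtain ⟨u, v, huv⟩ := hne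
      rcases hz u v huv with rfl | rfl
      exacts [huv.2.1, huv.2.2]
    · right
      have ha3 : a = 3 := by
        rw [← hcount, ncard_edgeSet_triangle huv hvw huw htri]
      refine ⟨?_, ha3, K, {u, v, w}, rfl, ?_, ?_, ?_⟩
      -- Equal sums along the three sides make `y` constant on the triangle, contrary to the unequal
      -- edge guaranteed for `α > 1/2`.
      · by_contra hα
        obtain ⟨b, c, hbc, hne⟩ := hyne (lt_of_le_of_ne hα₀ (Ne.symm hα)) (by omega)
        have e1 := hyg u v huv
        have e2 := hyg v w hvw
        have e3 := hyg u w huw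
        have f1 : y u = g / 2 := by linarith
        have f2 : y v = g / 2 := by linarith
        have f3 : y w = g / 2 := by linarith
        obtain ⟨h1, h2⟩ := htri b c hbc
        apply hne
        rcases h1 with rfl | rfl | rfl <;> rcases h2 with rfl | rfl | rfl <;> simp [f1, f2, f3]
      · rw [card_eq_three]
        exact ⟨u, v, w, huv.ne, huw.ne, hvw.ne, rfl⟩
      · rw [disjoint_right]
        intro b hb
        simp only [mem_insert, mem_singleton] at hb
        rcases hb with rfl | rfl | rfl
        exacts [huv.2.1, huv.2.2, hvw.2.2]
      · ext b c
        rw [hadj, cliqueJoin_adj]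
        simp only [mem_insert, mem_singleton]
        refine and_congr_right fun hbc => or_congr_right (or_congr_right ⟨htri b c, ?_⟩)
        have h1 := huv.symm
        have h2 := hvw.symm
        have h3 := huw.symm
        rintro ⟨rfl | rfl | rfl, rfl | rfl | rfl⟩ <;> first | assumption | exact absurd rfl hbc

end

section Isomorphism

variable [Fintype V] [Fintype W]

/-- Adjacency of distinct vertices depends only on their colours, so any bijection between equally
coloured classes is an isomorphism. -/
theorem nonempty_iso_of_color {ι : Type*} [DecidableEq ι] {G : SimpleGraph V} {H : SimpleGraph W} (c : V → ι)
    (d : W → ι) (rel : ι → ι → Prop) (hG : ∀ v w, G.Adj v w ↔ v ≠ w ∧ rel (c v) (c w))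
    (hH : ∀ v w, H.Adj v w ↔ v ≠ w ∧ rel (d v) (d w))
    (hcard : ∀ i, #(univ.filter fun v => c v = i) = #(univ.filter fun w => d w = i)) :
    Nonempty (G ≃g H) := by
  have hfib : ∀ i, Nonempty ({v // c v = i} ≃ {w // d w = i}) := fun i => by
    refine Fintype.card_eq.1 ?_
    rw [Fintype.card_subtype, Fintype.card_subtype, hcard i]
  set e : V ≃ W := Equiv.ofFiberEquiv fun i => (hfib i).some
  have he : ∀ v, d (e v) = c v := fun v => Equiv.ofFiberEquiv_map _ v
  refine ⟨⟨e, ?_⟩⟩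
  intro v w
  rw [hG, hH, he, he, e.injective.ne_iff]

theorem exists_color_starJoin {K L : Finset V} {z : V} (hzK : z ∉ K) (hzL : z ∉ L)
    (hKL : Disjoint K L) :
    ∃ c : V → Fin 4, (∀ v w, (starJoin K z L).Adj v w ↔ v ≠ w ∧
      ((c v = 0 ∨ c w = 0) ∨ (c v = 1 ∧ c w = 2) ∨ (c w = 1 ∧ c v = 2))) ∧
    #(univ.filter fun v => c v = 0) = #K ∧ #(univ.filter fun v => c v = 1) = 1 ∧
    #(univ.filter fun v => c v = 2) = #L ∧
    #(univ.filter fun v => c v = 3) = Fintype.card V - (#K + (#L + 1)) := by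
  have hdis : ∀ v, v ∈ K → v ∉ L := fun v hv hv' => disjoint_left.1 hKL hv hv'
  set c : V → Fin 4 := fun v => if v ∈ K then 0 else if v = z then 1 else if v ∈ L then 2 else 3
    with hc
  have c0 : ∀ v, c v = 0 ↔ v ∈ K := fun v => by simp only [hc]; split_ifs <;> simp_all
  have c1 : ∀ v, c v = 1 ↔ v = z := fun v => by
    simp only [hc]
    split_ifs with h1 h2 h3
    · simp only [zero_ne_one, false_iff]; rintro rfl; exact hzK h1
    all_goals simp_all
  have c2 : ∀ v, c v = 2 ↔ v ∈ L := fun v => by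
    simp only [hc]
    split_ifs with h1 h2 h3
    · have := hdis v h1
      simp_all
    all_goals simp_all
  have c3 : ∀ v, c v = 3 ↔ v ∈ (K ∪ insert z L)ᶜ := fun v => by
    simp only [hc, mem_compl, mem_union, mem_insert]
    split_ifs <;> simp_all
  refine ⟨c, fun v w => ?_, ?_, ?_, ?_, ?_⟩
  · rw [starJoin_adj, c0, c0, c1, c1, c2, c2]
    tauto
  · simp [c0]
  · simp only [c1]
    exact card_eq_one.2 ⟨z, by ext; simp⟩
  · simp [c2]
  · simp only [c3, Finset.filter_mem_eq_inter, Finset.univ_inter]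
    rw [card_compl, card_union_of_disjoint, card_insert_of_notMem hzL]
    rw [disjoint_insert_right]
    exact ⟨hzK, hKL⟩

theorem nonempty_iso_starJoin {K L : Finset V} {z : V} {K' L' : Finset W} {z' : W}
    (hzK : z ∉ K) (hzL : z ∉ L) (hKL : Disjoint K L) (hzK' : z' ∉ K') (hzL' : z' ∉ L')
    (hKL' : Disjoint K' L') (hK : #K = #K') (hL : #L = #L')
    (hV : Fintype.card V = Fintype.card W) :
    Nonempty (starJoin K z L ≃g starJoin K' z' L') := by
  obtain ⟨c, hc, hc0, hc1, hc2, hc3⟩ := exists_color_starJoin hzK hzL hKL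
  obtain ⟨d, hd, hd0, hd1, hd2, hd3⟩ := exists_color_starJoin hzK' hzL' hKL'
  refine nonempty_iso_of_color c d
    (fun i j => (i = 0 ∨ j = 0) ∨ (i = 1 ∧ j = 2) ∨ (j = 1 ∧ i = 2)) hc hd fun i => ?_
  fin_cases i
  · exact hc0.trans (hK.trans hd0.symm)
  · exact hc1.trans hd1.symm
  · exact hc2.trans (hL.trans hd2.symm)
  · refine hc3.trans (Eq.trans ?_ hd3.symm)
    rw [hV, hK, hL]

theorem exists_color_cliqueJoin {K T : Finset V} (hKT : Disjoint K T) :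
    ∃ c : V → Fin 3, (∀ v w, (cliqueJoin K T).Adj v w ↔ v ≠ w ∧
      ((c v = 0 ∨ c w = 0) ∨ (c v = 1 ∧ c w = 1))) ∧
    #(univ.filter fun v => c v = 0) = #K ∧ #(univ.filter fun v => c v = 1) = #T ∧
    #(univ.filter fun v => c v = 2) = Fintype.card V - (#K + #T) := by
  have hdis : ∀ v, v ∈ K → v ∉ T := fun v hv hv' => disjoint_left.1 hKT hv hv'
  set c : V → Fin 3 := fun v => if v ∈ K then 0 else if v ∈ T then 1 else 2 with hc
  have c0 : ∀ v, c v = 0 ↔ v ∈ K := fun v => by simp only [hc]; split_ifs <;> simp_all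
  have c1 : ∀ v, c v = 1 ↔ v ∈ T := fun v => by
    simp only [hc]
    split_ifs with h1 h2
    · have := hdis v h1
      simp_all
    all_goals simp_all
  have c2 : ∀ v, c v = 2 ↔ v ∈ (K ∪ T)ᶜ := fun v => by
    simp only [hc, mem_compl, mem_union]
    split_ifs <;> simp_all
  refine ⟨c, fun v w => ?_, ?_, ?_, ?_⟩
  · rw [cliqueJoin_adj, c0, c0, c1, c1]
    tauto
  · simp [c0]
  · simp [c1]
  · simp only [c2, Finset.filter_mem_eq_inter, Finset.univ_inter]
    rw [card_compl, card_union_of_disjoint hKT]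

theorem nonempty_iso_cliqueJoin {K T : Finset V} {K' T' : Finset W} (hKT : Disjoint K T)
    (hKT' : Disjoint K' T') (hK : #K = #K') (hT : #T = #T')
    (hV : Fintype.card V = Fintype.card W) :
    Nonempty (cliqueJoin K T ≃g cliqueJoin K' T') := by
  obtain ⟨c, hc, hc0, hc1, hc2⟩ := exists_color_cliqueJoin hKT
  obtain ⟨d, hd, hd0, hd1, hd2⟩ := exists_color_cliqueJoin hKT'
  refine nonempty_iso_of_color c d
    (fun i j => (i = 0 ∨ j = 0) ∨ (i = 1 ∧ j = 1)) hc hd fun i => ?_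
  fin_cases i
  · exact hc0.trans (hK.trans hd0.symm)
  · exact hc1.trans (hT.trans hd1.symm)
  · refine hc2.trans (Eq.trans ?_ hd2.symm)
    rw [hV, hK, hT]

theorem alphaOp_iso (α : ℝ) {G : SimpleGraph V} {H : SimpleGraph W} (e : G ≃g H) (x : W → ℝ)
    (v : V) : alphaOp α G (fun w => x (e w)) v = alphaOp α H x (e v) := by
  simp only [alphaOp]
  rw [← Equiv.sum_comp e.toEquiv]
  refine Finset.sum_congr rfl fun w _ => ?_
  have : H.Adj (e v) (e.toEquiv w) ↔ G.Adj v w := e.map_adj_iff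
  simp only [this]
  rfl

/-- The centre `z` has degree `#K + 3`, while the clique join has only the degrees `n - 1`, `#K + 2`
and `#K`; `n ≥ #K + 5` excludes `n - 1 = #K + 3`. -/
theorem isEmpty_iso_starJoin_cliqueJoin {K L : Finset V} {z : V} {K' T : Finset W}
    (hzK : z ∉ K) (hzL : z ∉ L) (hKL : Disjoint K L) (hKT : Disjoint K' T) (hK : #K = #K')
    (hL : #L = 3) (hT : #T = 3) (hW : #K + 5 ≤ Fintype.card W) :
    IsEmpty (starJoin K z L ≃g cliqueJoin K' T) := by
  refine ⟨fun e => ?_⟩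
  have h := alphaOp_iso 1 e (fun _ => 1) z
  rw [alphaOp_starJoin_center hzK hzL hKL, hL] at h
  have hW' : (#K : ℝ) + 5 ≤ Fintype.card W := by exact_mod_cast hW
  by_cases h1 : e z ∈ K'
  · rw [alphaOp_of_dominating _ _ fun w hw => cliqueJoin_dominating h1 hw] at h
    norm_num at h
    linarith
  · by_cases h2 : e z ∈ T
    · rw [alphaOp_cliqueJoin_clique hKT _ _ h2, hK, hT] at h
      norm_num at h
      linarith
    · rw [alphaOp_cliqueJoin_other _ _ h1 h2, hK] at h
      norm_num at h

end Isomorphism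

end Classification

/-! ### Quasi-star parameters and the extremal graphs. -/

section QuasiStar

open scoped Classical
open Finset

theorem two_mul_ncard_cliqueJoin {V : Type*} [Fintype V] {K T : Finset V} (hKT : Disjoint K T) :
    2 * ((cliqueJoin K T).edgeSet.ncard : ℝ) =
      #K * (Fintype.card V - 1) + #K * (Fintype.card V - #K) + #T * (#T - 1) := by
  have hdeg : ∀ v, ∑ w, (if (cliqueJoin K T).Adj v w then (1 : ℝ) else 0) =
      alphaOp 1 (cliqueJoin K T) (fun _ => 1) v := fun v => by simp [alphaOp]
  rw [← sum_adj_eq_two_mul_ncard]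
  simp only [hdeg]
  have hK : ∀ v ∈ K, alphaOp 1 (cliqueJoin K T) (fun _ => 1) v = Fintype.card V - 1 := fun v hv => by
    rw [alphaOp_of_dominating _ _ fun w hw => cliqueJoin_dominating hv hw]
    ring
  have hT : ∀ v ∈ T, alphaOp 1 (cliqueJoin K T) (fun _ => 1) v = #K + #T - 1 := fun v hv => by
    rw [alphaOp_cliqueJoin_clique hKT _ _ hv]
    ring
  have hO : ∀ v ∈ (K ∪ T)ᶜ, alphaOp 1 (cliqueJoin K T) (fun _ => 1) v = #K := fun v hv => by
    rw [mem_compl, mem_union, not_or] at hv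
    rw [alphaOp_cliqueJoin_other _ _ hv.1 hv.2]
    ring
  rw [← Finset.sum_add_sum_compl (K ∪ T), sum_union hKT, Finset.sum_congr rfl hK,
    Finset.sum_congr rfl hT, Finset.sum_congr rfl hO]
  simp only [sum_const, nsmul_eq_mul]
  rw [card_compl, Nat.cast_sub (card_le_univ _), card_union_of_disjoint hKT]
  push_cast
  ring

theorem cliqueJoin_connected {V : Type*} {K T : Finset V} (hK : K.Nonempty) :
    (cliqueJoin K T).Connected := by
  obtain ⟨o, ho⟩ := hK
  exact connected_of_dominating (o := o) fun w hw => cliqueJoin_dominating ho hw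

theorem graphJoin_star_iso {V : Type*} [Fintype V] {K L : Finset V} {z : V} {k a b : ℕ}
    (hzK : z ∉ K) (hzL : z ∉ L) (hKL : Disjoint K L) (hK : #K = k) (hL : #L = a)
    (hV : Fintype.card V = k + (1 + a + b)) :
    Nonempty (starJoin K z L ≃g graphJoin (⊤ : SimpleGraph (Fin k))
      (SimpleGraph.sum (completeBipartiteGraph (Fin 1) (Fin a)) (⊥ : SimpleGraph (Fin b)))) := by
  have hinj : Function.Injective
      fun i : Fin a => (Sum.inr (Sum.inl (Sum.inr i)) : Fin k ⊕ ((Fin 1 ⊕ Fin a) ⊕ Fin b)) :=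
    fun i j h => by simpa using h
  have : graphJoin (⊤ : SimpleGraph (Fin k))
      (SimpleGraph.sum (completeBipartiteGraph (Fin 1) (Fin a)) (⊥ : SimpleGraph (Fin b))) =
      starJoin (univ.map Function.Embedding.inl) (Sum.inr (Sum.inl (Sum.inl 0)))
        (univ.map ⟨_, hinj⟩) := by
    ext v w
    rw [starJoin_adj]
    rcases v with v | (v | v) | v <;> rcases w with w | (w | w) | w <;>
      simp [graphJoin, Subsingleton.elim _ (0 : Fin 1)]
  rw [this]
  exact nonempty_iso_starJoin hzK hzL hKL (by simp) (by simp)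
    (by rw [disjoint_left]; simp) (by simp [hK]) (by simp [hL]) (by simp [hV])

theorem graphJoin_clique_iso {V : Type*} [Fintype V] {K T : Finset V} {k t b : ℕ}
    (hKT : Disjoint K T) (hK : #K = k) (hT : #T = t) (hV : Fintype.card V = k + (t + b)) :
    Nonempty (cliqueJoin K T ≃g graphJoin (⊤ : SimpleGraph (Fin k))
      (SimpleGraph.sum (⊤ : SimpleGraph (Fin t)) (⊥ : SimpleGraph (Fin b)))) := by
  have hinj : Function.Injective
      fun i : Fin t => (Sum.inr (Sum.inl i) : Fin k ⊕ (Fin t ⊕ Fin b)) :=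
    fun i j h => by simpa using h
  have : graphJoin (⊤ : SimpleGraph (Fin k))
      (SimpleGraph.sum (⊤ : SimpleGraph (Fin t)) (⊥ : SimpleGraph (Fin b))) =
      cliqueJoin (univ.map Function.Embedding.inl) (univ.map ⟨_, hinj⟩) := by
    ext v w
    rw [cliqueJoin_adj]
    rcases v with v | v | v <;> rcases w with w | w | w <;> simp [graphJoin]
  rw [this]
  exact nonempty_iso_cliqueJoin hKT (by rw [disjoint_left]; simp) (by simp [hK]) (by simp [hT])
    (by simp [hV])

theorem two_mul_sum_Icc_sub {n k : ℕ} (h : k ≤ n) :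
    2 * ((∑ i ∈ Icc 1 k, (n - i) : ℕ) : ℝ) = k * (n - 1) + k * (n - k) := by
  induction k with
  | zero => simp
  | succ k ih =>
    rw [Finset.sum_Icc_succ_top (by omega), Nat.cast_add, mul_add, ih (by omega), Nat.cast_sub h]
    push_cast
    ring

theorem starK_le (n m : ℕ) : starK n m ≤ n - 1 := Nat.findGreatest_le _

theorem sum_starK_le (n m : ℕ) : ∑ i ∈ Icc 1 (starK n m), (n - i) ≤ m :=
  Nat.findGreatest_spec (P := fun k => ∑ i ∈ Icc 1 k, (n - i) ≤ m) (Nat.zero_le _) (by simp)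

theorem le_starK {n m k : ℕ} (hk : k ≤ n - 1) (h : ∑ i ∈ Icc 1 k, (n - i) ≤ m) :
    k ≤ starK n m :=
  Nat.le_findGreatest hk h

theorem two_mul_eq_starK_add_starA {n m : ℕ} :
    2 * (m : ℝ) = starK n m * (n - 1) + starK n m * (n - starK n m) + 2 * starA n m := by
  rw [← two_mul_sum_Icc_sub ((starK_le n m).trans (Nat.sub_le _ _)), ← mul_add, ← Nat.cast_add,
    starA, Nat.add_sub_cancel' (sum_starK_le n m)]

/-- For `r ≥ 3` the radicand is at least `17`, so the root exceeds `4` and `n ≥ 15 r - 21`. This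
gives `3 n ≥ 45 r - 63 ≥ 23 r + 3`, the last step being tight at `r = 3`. -/
theorem three_mul_ge_of_sqrt {r n : ℕ} (hr : 3 ≤ r)
    (hn : (n : ℝ) >
      (30 * (r : ℝ) - 63 + 5 * Real.sqrt (32 * (r : ℝ) ^ 2 - 136 * (r : ℝ) + 137)) / 2) :
    23 * r + 3 ≤ 3 * n := by
  have hr' : (3 : ℝ) ≤ r := by exact_mod_cast hr
  have h4 : (4 : ℝ) ≤ Real.sqrt (32 * (r : ℝ) ^ 2 - 136 * (r : ℝ) + 137) := by
    refine Real.le_sqrt_of_sq_le ?_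
    nlinarith
  have : (30 * (r : ℝ) - 43) < 2 * n := by linarith
  have : (30 * r : ℝ) < 2 * n + 43 := by linarith
  have : 30 * r < 2 * n + 43 := by exact_mod_cast this
  omega

theorem one_le_starK {n m : ℕ} (hn : 2 ≤ n) (hm₁ : (n : ℝ) - 1 ≤ m) : 1 ≤ starK n m := by
  refine le_starK (by omega) ?_
  have : (n : ℝ) ≤ (m + 1 : ℕ) := by push_cast; linarith
  have : n ≤ m + 1 := by exact_mod_cast this
  simp
  omega

section Parameters

variable {r n m : ℕ}

theorem starK_le_of_le (hn : r < n)
    (hm₂ : (m : ℝ) ≤ (r : ℝ) * n - (r : ℝ) * ((r : ℝ) + 1) / 2) : starK n m ≤ r := by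
  by_contra! hcon
  have h1 : (r : ℝ) + 1 ≤ starK n m := by exact_mod_cast hcon
  have h2 : starK n m + 1 ≤ n := by have := starK_le n m; omega
  have h2 : (starK n m : ℝ) + 1 ≤ n := by exact_mod_cast h2
  have h3 : (r : ℝ) + 1 ≤ n := by exact_mod_cast hn
  have h4 := two_mul_eq_starK_add_starA (n := n) (m := m)
  have h5 : (0 : ℝ) ≤ starA n m := Nat.cast_nonneg _
  nlinarith [mul_pos (by linarith : (0 : ℝ) < starK n m - r)
    (by linarith : (0 : ℝ) < 2 * n - starK n m - r - 1)]

theorem starK_succ_le_of_pos (hn : r < n)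
    (hm₂ : (m : ℝ) ≤ (r : ℝ) * n - (r : ℝ) * ((r : ℝ) + 1) / 2) (ha : 0 < starA n m) :
    starK n m + 1 ≤ r := by
  by_contra! hcon
  have hk : starK n m = r := le_antisymm (starK_le_of_le hn hm₂) (by omega)
  have h4 := two_mul_eq_starK_add_starA (n := n) (m := m)
  have h5 : (0 : ℝ) < starA n m := by exact_mod_cast ha
  rw [hk] at h4
  linarith

/-- Maximality of `k` means that the next summand `n - (k + 1)` exceeds `a`. -/
theorem starA_add_starK_le (hn : r + 2 ≤ n)
    (hm₂ : (m : ℝ) ≤ (r : ℝ) * n - (r : ℝ) * ((r : ℝ) + 1) / 2) :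
    starA n m + starK n m + 2 ≤ n := by
  have hk := starK_le_of_le (by omega) hm₂
  have h1 : m < ∑ i ∈ Icc 1 (starK n m + 1), (n - i) := by
    by_contra! hcon
    have := le_starK (by omega) hcon
    omega
  rw [Finset.sum_Icc_succ_top (by omega)] at h1
  have h2 := sum_starK_le n m
  rw [starA]
  omega

/-- A surplus of three over the `k`-th partial sum cannot reach the next one, whose summand `n - k -
1` is larger than three; so the given `k` is `starK n m`. -/
theorem isExceptionalSize_iff (hn : r + 4 ≤ n) (hm₁ : (n : ℝ) - 1 ≤ m)
    (hm₂ : (m : ℝ) ≤ (r : ℝ) * n - (r : ℝ) * ((r : ℝ) + 1) / 2) :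
    IsExceptionalSize r n m ↔ starA n m = 3 := by
  have h4 := two_mul_eq_starK_add_starA (n := n) (m := m)
  constructor
  · rintro ⟨k, hk1, hkr, hkm⟩
    have h1 := two_mul_sum_Icc_sub (n := n) (k := k) (by omega)
    have h2 : k ≤ starK n m := by
      refine le_starK (by omega) ?_
      have : ((∑ i ∈ Icc 1 k, (n - i) : ℕ) : ℝ) ≤ m := by linarith
      exact_mod_cast this
    have h3 : starK n m ≤ k := by
      by_contra! hcon
      have hkr' := starK_le_of_le (by omega) hm₂
      have e1 : (k : ℝ) + 1 ≤ starK n m := by exact_mod_cast hcon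
      have e2 : (starK n m : ℝ) + 4 ≤ n := by exact_mod_cast (by omega : starK n m + 4 ≤ n)
      have e3 : (0 : ℝ) ≤ starA n m := Nat.cast_nonneg _
      nlinarith [mul_nonneg (by linarith : (0 : ℝ) ≤ starK n m - k - 1)
        (by linarith : (0 : ℝ) ≤ 2 * n - starK n m - k - 1)]
    have hk : starK n m = k := le_antisymm h3 h2
    rw [hk] at h4
    have : (starA n m : ℝ) = 3 := by linarith
    exact_mod_cast this
  · intro h
    refine ⟨starK n m, one_le_starK (by omega) hm₁,
      starK_succ_le_of_pos (by omega) hm₂ (by omega), ?_⟩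
    rw [h] at h4
    push_cast at h4
    linarith

end Parameters

section Extremal

variable {n m : ℕ} {α : ℝ}

theorem ncard_edgeSet_congr {V W : Type*} [Fintype V] [Fintype W] {G : SimpleGraph V}
    {H : SimpleGraph W} (e : G ≃g H) : G.edgeSet.ncard = H.edgeSet.ncard := by
  have h : (2 : ℝ) * G.edgeSet.ncard = 2 * H.edgeSet.ncard := by
    rw [← sum_adj_eq_two_mul_ncard, ← sum_adj_eq_two_mul_ncard, ← Equiv.sum_comp e.toEquiv]
    refine Finset.sum_congr rfl fun v _ => ?_
    rw [← Equiv.sum_comp e.toEquiv]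
    refine Finset.sum_congr rfl fun w _ => ?_
    have : H.Adj (e.toEquiv v) (e.toEquiv w) ↔ G.Adj v w := e.map_adj_iff
    simp only [this]
  have h' : (G.edgeSet.ncard : ℝ) = H.edgeSet.ncard := by linarith
  exact_mod_cast h'

theorem IsExtremal.isRadiusMaximal {G : SimpleGraph (Fin n)} (h : IsExtremal α n m G) :
    IsRadiusMaximal α G :=
  ⟨h.1.1, fun H hH hcard => h.2 H ⟨hH, hcard.trans h.1.2⟩⟩

theorem IsExtremal.of_iso {G G' : SimpleGraph (Fin n)} (h : IsExtremal α n m G) (e : G' ≃g G) :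
    IsExtremal α n m G' :=
  ⟨⟨e.connected_iff.2 h.1.1, (ncard_edgeSet_congr e).trans h.1.2⟩, fun H hH => by
    rw [alphaRadius_congr α e]
    exact h.2 H hH⟩

theorem exists_isExtremal (h : (connectedGraphs n m).Nonempty) :
    ∃ G, IsExtremal α n m G :=
  Set.exists_max_image _ (alphaRadius α) (Set.toFinite _) h

theorem exists_parts {V : Type*} [Fintype V] {k a t : ℕ} (ha : k + (a + 1) ≤ Fintype.card V)
    (ht : k + t ≤ Fintype.card V) : ∃ (K L T : Finset V) (z : V), #K = k ∧ #L = a ∧ #T = t ∧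
      z ∉ K ∧ z ∉ L ∧ Disjoint K L ∧ Disjoint K T := by
  obtain ⟨K, -, hK⟩ := exists_subset_card_eq (s := (univ : Finset V)) (n := k)
    (by rw [card_univ]; omega)
  obtain ⟨T, hT, hTt⟩ := exists_subset_card_eq (s := Kᶜ) (n := t) (by rw [card_compl]; omega)
  obtain ⟨M, hM, hMa⟩ := exists_subset_card_eq (s := Kᶜ) (n := a + 1) (by rw [card_compl]; omega)
  obtain ⟨z, L, hzL, rfl, hL⟩ := card_eq_succ.1 hMa
  exact ⟨K, L, T, z, hK, hL, hTt, mem_compl.1 (hM (mem_insert_self z L)), hzL,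
    disjoint_right.2 fun v hv => mem_compl.1 (hM (mem_insert_of_mem hv)),
    disjoint_right.2 fun v hv => mem_compl.1 (hT hv)⟩

/-- The extremal graphs are the quasi-star graph and, for `α = 1/2` and `a = 3`, its variant with a
triangle. -/
theorem isExtremal_iff (hα₀ : 1 / 2 ≤ α) (hα₁ : α < 1) (hk : 1 ≤ starK n m)
    (ha : starA n m + starK n m + 2 ≤ n) (hY : 20 * (starK n m : ℝ) ≤ 3 * (n - 1 - starK n m))
    (hY' : 0 < starA n m → 20 * ((starK n m : ℝ) + 1) ≤ 3 * (n - 2 - starK n m))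
    (G : SimpleGraph (Fin n)) :
    IsExtremal α n m G ↔ Nonempty (G ≃g quasiStar n m) ∨
      (α = 1 / 2 ∧ starA n m = 3 ∧ Nonempty (G ≃g quasiStarTilde n m)) := by
  have hm := two_mul_eq_starK_add_starA (n := n) (m := m)
  have hS : ∀ {K L : Finset (Fin n)} {z : Fin n}, z ∉ K → z ∉ L → Disjoint K L → #K = starK n m →
      #L = starA n m → Nonempty (starJoin K z L ≃g quasiStar n m) :=
    fun hzK hzL hKL hK hL => graphJoin_star_iso hzK hzL hKL hK hL (by rw [Fintype.card_fin]; omega)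
  have hT : starA n m = 3 → ∀ {K T : Finset (Fin n)}, Disjoint K T → #K = starK n m → #T = 3 →
      Nonempty (cliqueJoin K T ≃g quasiStarTilde n m) :=
    fun h3 _ _ hKT hK hT => graphJoin_clique_iso hKT hK hT (by rw [Fintype.card_fin]; omega)
  have hclass : ∀ {G : SimpleGraph (Fin n)}, IsExtremal α n m G →
      (∃ (K L : Finset (Fin n)) (z : Fin n), #K = starK n m ∧ #L = starA n m ∧ z ∉ K ∧ z ∉ L ∧
        Disjoint K L ∧ G = starJoin K z L) ∨ (α = 1 / 2 ∧ starA n m = 3 ∧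
        ∃ K T : Finset (Fin n), #K = starK n m ∧ #T = 3 ∧ Disjoint K T ∧ G = cliqueJoin K T) := by
    intro G hG
    refine hG.isRadiusMaximal.eq_starJoin_or_cliqueJoin hα₀ hα₁ hk ?_ ?_ ?_ ?_
    · rw [hG.1.2, Fintype.card_fin, hm]
    · rwa [Fintype.card_fin]
    · rwa [Fintype.card_fin]
    · rwa [Fintype.card_fin]
  -- `T` is needed only when `a = 3`; the default size `0` avoids a cardinality condition in the
  -- other cases.
  obtain ⟨K, L, T, z, hKk, hLa, hT3, hzK, hzL, hKL, hKT⟩ :=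
    exists_parts (V := Fin n) (k := starK n m) (a := starA n m)
      (t := if starA n m = 3 then 3 else 0) (by rw [Fintype.card_fin]; omega)
      (by rw [Fintype.card_fin]; split_ifs <;> omega)
  have hKne : K.Nonempty := card_pos.1 (by omega)
  have hSmem : starJoin K z L ∈ connectedGraphs n m := by
    refine ⟨starJoin_connected hKne, ?_⟩
    have h1 := two_mul_ncard_starJoin hzK hzL hKL
    rw [Fintype.card_fin, hKk, hLa, ← hm] at h1
    have : ((starJoin K z L).edgeSet.ncard : ℝ) = m := by linarith
    exact_mod_cast this
  -- A maximizer exists by finiteness. It is either isomorphic to this star join or a clique join of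
  -- equal radius, so the star join is extremal in both cases.
  have hSext : IsExtremal α n m (starJoin K z L) := by
    obtain ⟨G₁, hG₁⟩ := exists_isExtremal (α := α) ⟨_, hSmem⟩
    rcases hclass hG₁ with ⟨K', L', z', hK', hL', hzK', hzL', hKL', rfl⟩ |
      ⟨rfl, h3, K', T', hK', hT', hKT', rfl⟩
    · obtain ⟨e⟩ := hS hzK hzL hKL hKk hLa
      obtain ⟨e'⟩ := hS hzK' hzL' hKL' hK' hL'
      exact hG₁.of_iso (e.trans e'.symm)
    · refine ⟨hSmem, fun H hH => (hG₁.2 H hH).trans ?_⟩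
      obtain ⟨e⟩ := nonempty_iso_cliqueJoin hKT' hKT
        (hK'.trans hKk.symm) (by rw [hT', hT3, if_pos h3]) rfl
      rw [alphaRadius_congr _ e]
      exact (alphaRadius_cliqueJoin_triangle hKne hzK hzL hKL hKT (hLa.trans h3)
        (by rw [hT3, if_pos h3])).le
  constructor
  · intro hG
    rcases hclass hG with ⟨K', L', z', hK', hL', hzK', hzL', hKL', rfl⟩ |
      ⟨hα, h3, K', T', hK', hT', hKT', rfl⟩
    · exact Or.inl (hS hzK' hzL' hKL' hK' hL')
    · exact Or.inr ⟨hα, h3, hT h3 hKT' hK' hT'⟩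
  · rintro (⟨⟨e⟩⟩ | ⟨rfl, h3, ⟨e⟩⟩)
    · obtain ⟨e'⟩ := hS hzK hzL hKL hKk hLa
      exact hSext.of_iso (e.trans e'.symm)
    · rw [if_pos h3] at hT3
      obtain ⟨e'⟩ := hT h3 hKT hKk hT3
      refine IsExtremal.of_iso ⟨⟨cliqueJoin_connected hKne, ?_⟩, fun H hH => ?_⟩ (e.trans e'.symm)
      · have h1 := two_mul_ncard_cliqueJoin hKT
        rw [Fintype.card_fin, hKk, hT3] at h1
        rw [h3] at hm
        push_cast at h1 hm
        have : ((cliqueJoin K T).edgeSet.ncard : ℝ) = m := by linarith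
        exact_mod_cast this
      · rw [alphaRadius_cliqueJoin_triangle hKne hzK hzL hKL hKT (hLa.trans h3) hT3]
        exact hSext.2 H hH

theorem isEmpty_iso_quasiStar (h3 : starA n m = 3) (ha : starA n m + starK n m + 2 ≤ n) :
    IsEmpty (quasiStar n m ≃g quasiStarTilde n m) := by
  obtain ⟨K, L, T, z, hKk, hLa, hT3, hzK, hzL, hKL, hKT⟩ :=
    exists_parts (V := Fin n) (k := starK n m) (a := starA n m) (t := 3)
      (by rw [Fintype.card_fin]; omega) (by rw [Fintype.card_fin]; omega)
  obtain ⟨e⟩ : Nonempty (starJoin K z L ≃g quasiStar n m) :=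
    graphJoin_star_iso hzK hzL hKL hKk hLa (by rw [Fintype.card_fin]; omega)
  obtain ⟨e'⟩ : Nonempty (cliqueJoin K T ≃g quasiStarTilde n m) :=
    graphJoin_clique_iso hKT hKk hT3 (by rw [Fintype.card_fin]; omega)
  have := isEmpty_iso_starJoin_cliqueJoin hzK hzL hKL hKT rfl (hLa.trans h3) hT3
    (by rw [Fintype.card_fin]; omega)
  exact ⟨fun f => this.elim ((e.trans f).trans e'.symm)⟩

end Extremal

end QuasiStar

theorem theorem1p3 (r n m : ℕ) (α : ℝ) (hr : 3 ≤ r)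
    (hn : (n : ℝ) >
      (30 * (r : ℝ) - 63 + 5 * Real.sqrt (32 * (r : ℝ) ^ 2 - 136 * (r : ℝ) + 137)) / 2)
    (hm₁ : (n : ℝ) - 1 ≤ m)
    (hm₂ : (m : ℝ) ≤ (r : ℝ) * n - (r : ℝ) * ((r : ℝ) + 1) / 2) :
    ((1 / 2 < α ∧ α < 1) ∨ (α = 1 / 2 ∧ ¬ IsExceptionalSize r n m) →
      ∀ G : SimpleGraph (Fin n), IsExtremal α n m G ↔ Nonempty (G ≃g quasiStar n m)) ∧
    (α = 1 / 2 ∧ IsExceptionalSize r n m →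
      (∀ G : SimpleGraph (Fin n), IsExtremal α n m G ↔
        (Nonempty (G ≃g quasiStar n m) ∨ Nonempty (G ≃g quasiStarTilde n m))) ∧
      IsEmpty (quasiStar n m ≃g quasiStarTilde n m)) := by
  have hn' := three_mul_ge_of_sqrt hr hn
  have hk := one_le_starK (by omega) hm₁
  have hkr := starK_le_of_le (by omega) hm₂
  have ha := starA_add_starK_le (by omega) hm₂
  have hY : 20 * (starK n m : ℝ) ≤ 3 * (n - 1 - starK n m) := by
    have : 20 * starK n m + 3 * starK n m + 3 ≤ 3 * n := by omega
    have : 20 * (starK n m : ℝ) + 3 * starK n m + 3 ≤ 3 * n := by exact_mod_cast this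
    linarith
  have hY' : 0 < starA n m → 20 * ((starK n m : ℝ) + 1) ≤ 3 * (n - 2 - starK n m) := fun h => by
    have := starK_succ_le_of_pos (by omega) hm₂ h
    have : 20 * starK n m + 3 * starK n m + 26 ≤ 3 * n := by omega
    have : 20 * (starK n m : ℝ) + 3 * starK n m + 26 ≤ 3 * n := by exact_mod_cast this
    linarith
  rw [isExceptionalSize_iff (by omega) hm₁ hm₂]
  refine ⟨fun h G => ?_, fun h => ⟨fun G => ?_, isEmpty_iso_quasiStar h.2 ha⟩⟩
  · have hα₀ : 1 / 2 ≤ α := h.elim (fun h => h.1.le) fun h => h.1.ge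
    have hα₁ : α < 1 := h.elim (fun h => h.2) fun h => by rw [h.1]; norm_num
    rw [isExtremal_iff hα₀ hα₁ hk ha hY hY', or_iff_left]
    rintro ⟨h1, h3, -⟩
    exact h.elim (fun h => h.1.ne' h1) fun h => h.2 h3
  · rw [isExtremal_iff h.1.ge (by rw [h.1]; norm_num) hk ha hY hY', and_iff_right h.1,
      and_iff_right h.2]
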